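/- Let $0<q<1$, let $s>0$ be rational, and let $\kappa,\lambda,\upsilon,\varsigma\in\mathbb{R}$. For $x\in\mathbb{C}$ put $q^x:=e^{x\log q}$. Write $(u;p)_\infty=\prod_{i\ge 0}(1-up^i)$, $\theta(u;p)=(u;p)_\infty(p/u;p)_\infty$, and use the convention that several arguments before the semicolon denote a product, e.g. $\theta(u_1,\dots,u_r;p)=\prod_i\theta(u_i;p)$. Set $$(a,b,c,d)=\bigl(q^{\kappa+\lambda},-q^{\kappa-\lambda},q^{\frac s2+\upsilon+\varsigma},-q^{\frac s2+\upsilon-\varsigma}\bigr),$$ and let $(\widetilde a,\widetilde b,\widetilde c,\widetilde d)$ be obtained from it by interchanging $\lambda$ and $\upsilon$. A superscript $d$ on a function below means that it is taken with $\lambda$ and $\upsilon$ interchanged. Let $$(\mathcal{D}f)(x)=A(x)\bigl(f(x+s)-f(x)\bigr)+A(-x)\bigl(f(x-s)-f(x)\bigr),\qquad A(x)=\frac{(1-aq^x)(1-bq^x)(1-cq^x)(1-dq^x)}{\widetilde a(1-q^{2x})(1-q^{s+2x})},$$ $$W(x,z)=q^{(\kappa+\lambda+x)(\kappa+\upsilon+z)/s},\qquad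 \mathrm{St}(x)=\bigl(q^{s+x}/a,\,q^{s+x}/b,\,q^{s+x}/c,\,q^{s+x}/d;\,q^s\bigr)_\infty,$$ $$c(x,z)=\frac{\theta\bigl(\widetilde a q^{-z},\widetilde b q^{-z},\widetilde c q^{-z},\tfrac{d}{\widetilde a}q^{x-z};q^s\bigr)}{W(x,z)\,\theta\bigl(q^{-2z},dq^x;q^s\bigr)}.$$ There are unique entire functions $\Gamma_r$ ($r\ge 0$) on $\mathbb{C}$ such that (1) $\Gamma_0(z)=(q^{s+2z};q^s)_\infty$; (2) the series $\Psi(x,z)=\sum_{r\ge0}\Gamma_r(z)q^{rx}$ converges normally on compact subsets of $\mathbb{C}\times\mathbb{C}$; (3) the meromorphic function $$\Phi(x,z)=\frac{W(x,z)}{\mathrm{St}(x)\,\mathrm{St}^d(z)}\,\Psi(x,z)$$ satisfies $\bigl(\mathcal{D}_x-q^z-q^{-z}+\widetilde a+\widetilde a^{-1}\bigr)\Phi(x,z)=0$, where $\mathcal{D}_x$ is $\mathcal{D}$ acting on the variable $x$. This function $\Phi$ (the asymptotically free eigenfunction) satisfies, as an identity of meromorphic functions of $(x,z)\in\mathbb{C}\times\mathbb{C}$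 (that is, at every point where no denominator occurring in it vanishes), the connection formula $$\Phi(-x,z)=\frac{c(x,z)-c^d(z,x)}{c^d(z,-x)}\,\Phi(x,z)+\frac{c(x,-z)}{c^d(z,-x)}\,\Phi(x,-z).$$ -/

import Mathlib

namespace AskeyWilson

noncomputable section

/-- The infinite `p`-shifted factorial `(u; p)_∞ = ∏_{i ≥ 0} (1 - u p^i)` (used for `|p| < 1`). -/
def qPoch (u p : ℂ) : ℂ := ∏' i : ℕ, (1 - u * p ^ i)

/-- The modified Jacobi theta function `θ(u; p) = (u, p/u; p)_∞`. -/
def theta (u p : ℂ) : ℂ := qPoch u p * qPoch (p / u) p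

/-- The parameters: deformation parameter `q`, step-size `s`, and the four Hecke parameters
`κ, lam, υ, ς`. This is plain data; `0 < q < 1` and `0 < s` are hypotheses where needed. -/
structure Params where
  q : ℝ
  s : ℝ
  κ : ℝ
  lam : ℝ
  υ : ℝ
  ς : ℝ

namespace Params

variable (P : Params)

/-- The dual parameters: `lam` and `υ` are interchanged. -/
def dual : Params := ⟨P.q, P.s, P.κ, P.υ, P.lam, P.ς⟩

/-- `q^x = exp (x log q)` for complex `x`. -/
def qpow (x : ℂ) : ℂ := (P.q : ℂ) ^ x

/-- The nome `q^s`. -/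
def nome : ℂ := P.qpow P.s

/-- The Askey--Wilson parameters. The dual ones are those of `P.dual`. -/
def a : ℂ := P.qpow (P.κ + P.lam)
def b : ℂ := -P.qpow (P.κ - P.lam)
def c : ℂ := P.qpow (P.s / 2 + P.υ + P.ς)
def d : ℂ := -P.qpow (P.s / 2 + P.υ - P.ς)

/-- The coefficient `A(x)` of the Askey--Wilson second order difference operator. -/
def A (x : ℂ) : ℂ :=
  (1 - P.a * P.qpow x) * (1 - P.b * P.qpow x) * (1 - P.c * P.qpow x) * (1 - P.d * P.qpow x) /
    (P.dual.a * (1 - P.qpow (2 * x)) * (1 - P.qpow (P.s + 2 * x)))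

/-- The Askey--Wilson second order difference operator with step-size `s`. -/
def D (f : ℂ → ℂ) (x : ℂ) : ℂ :=
  P.A x * (f (x + P.s) - f x) + P.A (-x) * (f (x - P.s) - f x)

/-- `W(x,z) = q^{(κ+lam+x)(κ+υ+z)/s}`. -/
def W (x z : ℂ) : ℂ := P.qpow ((P.κ + P.lam + x) * (P.κ + P.υ + z) / P.s)

/-- The singular term `St(x) = (q^{s+x}/a, q^{s+x}/b, q^{s+x}/c, q^{s+x}/d; q^s)_∞`. -/
def St (x : ℂ) : ℂ :=
  qPoch (P.qpow (P.s + x) / P.a) P.nome * qPoch (P.qpow (P.s + x) / P.b) P.nome *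
    qPoch (P.qpow (P.s + x) / P.c) P.nome * qPoch (P.qpow (P.s + x) / P.d) P.nome

/-- `Ψ(x,z) = ∑_{r ≥ 0} Γ_r(z) q^{rx}`. -/
def Psi (Γ : ℕ → ℂ → ℂ) (x z : ℂ) : ℂ := ∑' r : ℕ, Γ r z * P.qpow (r * x)

/-- `Φ(x,z) = W(x,z) / (St(x) St^d(z)) Ψ(x,z)`, where `St^d` is the singular term for the
dual parameters. -/
def Phi (Γ : ℕ → ℂ → ℂ) (x z : ℂ) : ℂ := P.W x z / (P.St x * P.dual.St z) * P.Psi Γ x z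

/-- The characterization of the coefficients `Γ_r` of the asymptotically free eigenfunction:
they are entire, `Γ_0(z) = (q^{s+2z}; q^s)_∞`, the series `Ψ` converges normally on compact
subsets of `ℂ × ℂ`, and the meromorphic function `Φ` satisfies the eigenvalue equation
`((D_x - q^z - q^{-z} + ã + ã⁻¹) Φ)(x,z) = 0`. The identity of meromorphic functions is
expressed at all points where no denominator occurring in it vanishes. -/
structure IsAsymptoticallyFree (Γ : ℕ → ℂ → ℂ) : Prop where
  holomorphic : ∀ r, Differentiable ℂ (Γ r)
  initial : ∀ z, Γ 0 z = qPoch (P.qpow (P.s + 2 * z)) P.nome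
  normal_convergence : ∀ K : Set (ℂ × ℂ), IsCompact K →
    ∃ u : ℕ → ℝ, Summable u ∧ ∀ r, ∀ w ∈ K, ‖Γ r w.2 * P.qpow (r * w.1)‖ ≤ u r
  eigenvalue_equation : ∀ x z : ℂ,
    P.qpow (2 * x) ≠ 1 → P.qpow (P.s + 2 * x) ≠ 1 → P.qpow (P.s - 2 * x) ≠ 1 →
    P.St x ≠ 0 → P.St (x + P.s) ≠ 0 → P.St (x - P.s) ≠ 0 → P.dual.St z ≠ 0 →
    P.D (fun y => P.Phi Γ y z) x +
      (-P.qpow z - P.qpow (-z) + P.dual.a + (P.dual.a)⁻¹) * P.Phi Γ x z = 0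

/-- The numerator of the normalized `c`-function. -/
def cNum (x z : ℂ) : ℂ :=
  theta (P.dual.a * P.qpow (-z)) P.nome * theta (P.dual.b * P.qpow (-z)) P.nome *
    theta (P.dual.c * P.qpow (-z)) P.nome * theta (P.d * P.qpow (x - z) / P.dual.a) P.nome

/-- The denominator of the normalized `c`-function. -/
def cDen (x z : ℂ) : ℂ :=
  P.W x z * (theta (P.qpow (-2 * z)) P.nome * theta (P.d * P.qpow x) P.nome)

/-- The normalized `c`-function `c(x,z)`. The function `c^d` is `P.dual.cFun`. -/
def cFun (x z : ℂ) : ℂ := P.cNum x z / P.cDen x z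

end Params

end

end AskeyWilson

open Filter Topology

namespace AskeyWilson

/-! ### Infinite shifted factorials and first order recursions -/

section QPochhammer

variable {p : ℂ}

/-! Put `X = q^x`, `Z = q^z`, `p = q^s`, `t = ã`. Removing the factor `W / (St St^d)` turns the
eigenvalue equation into a second order `p`-difference equation in `X` with polynomial coefficients
(`SeriesEq`, `D_Phi`). For generic `Z` a power series solution is determined by its constant term,
and the constant term `(pZ²; p)_∞` cancels every denominator `1 - Z²p^i` produced by the recursion.
This gives entire `Γ_r`, and their uniqueness: first for generic `z`, then by continuity.
Convergence for all `X` is hidden in the scalar recursion, because the leading coefficient `1 - pX²`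
has zeros. An equivalent first order system (`FirstEq`, `SecondEq`) has no such singularities and
forces the coefficients to decay faster than any geometric sequence (`coupled_recursion_bound`,
`exists_norm_gam_le`).

The connection formula is a linear relation between `Ψ(X⁻¹,Z)`, `Ψ(X,Z)` and `Ψ(X,Z⁻¹)`. Such a
relation holds for purely algebraic reasons (`pluecker`), with three bilinear expressions as
coefficients; the content is their evaluation.

The `casoratian` satisfies a first order recursion in `X`, hence is fixed by its value at `X = 0`.
For the other two, the essential tool is a contiguity relation for `Z ↦ Z/p` (`Psi_contiguity`): a
suitable combination of the components of the first order system at `Z` solves the system at `Z/p`.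
It makes `normForm` satisfy a first order recursion in `Z`, fixed at `Z = 0`, where `Ψ` is a single
Pochhammer symbol. It makes `mixedForm` quasi-periodic in `Z`, and a function of theta type is
determined by its values at the zeros of a comparison theta product with a different multiplier
(`eq_zero_of_multiplier`). At those zeros `mixedForm` either degenerates to `normForm`, already
known, or enters multiplied by zero. Inserting the three values in `pluecker` gives
`Psi_connection`; restoring the prefactors gives the theorem. -/

theorem summable_norm_mul_pow (hp : ‖p‖ < 1) (u : ℂ) : Summable fun i : ℕ => ‖-(u * p ^ i)‖ := by
  simpa [norm_mul, norm_pow] using (summable_geometric_of_lt_one (norm_nonneg _) hp).mul_left ‖u‖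

theorem multipliable_qPoch (hp : ‖p‖ < 1) (u : ℂ) :
    Multipliable fun i : ℕ => 1 - u * p ^ i := by
  simpa [sub_eq_add_neg] using multipliable_one_add_of_summable (summable_norm_mul_pow hp u)

@[simp] theorem qPoch_zero_left (p : ℂ) : qPoch 0 p = 1 := by simp [qPoch]

theorem qPoch_step (hp : ‖p‖ < 1) (u : ℂ) : qPoch u p = (1 - u) * qPoch (p * u) p := by
  unfold qPoch
  rw [tprod_eq_zero_mul' (f := fun i : ℕ => 1 - u * p ^ i)]
  · simp only [pow_zero, mul_one, pow_succ]
    congr 1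
    exact tprod_congr fun i => by ring
  · exact (multipliable_qPoch hp (p * u)).congr fun i => by ring

theorem differentiable_qPoch (hp : ‖p‖ < 1) : Differentiable ℂ fun u => qPoch u p := by
  intro u
  have hK : HasProdLocallyUniformlyOn (fun (i : ℕ) (x : ℂ) => 1 + -(x * p ^ i))
      (fun x => ∏' i : ℕ, (1 + -(x * p ^ i))) (Metric.ball (0 : ℂ) (‖u‖ + 1)) := by
    refine Summable.hasProdLocallyUniformlyOn_one_add (u := fun i => (‖u‖ + 1) * ‖p‖ ^ i)
      Metric.isOpen_ball ?_ ?_ ?_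
    · exact (summable_geometric_of_lt_one (norm_nonneg _) hp).mul_left _
    · refine Filter.Eventually.of_forall fun i x hx => ?_
      rw [norm_neg, norm_mul, norm_pow]
      have : ‖x‖ < ‖u‖ + 1 := by simpa using hx
      gcongr
    · intro i; fun_prop
  have hd : DifferentiableOn ℂ (fun x => ∏' i : ℕ, (1 + -(x * p ^ i)))
      (Metric.ball (0 : ℂ) (‖u‖ + 1)) :=
    hK.differentiableOn (.of_forall fun s => by
      simpa [Finset.prod_fn] using DifferentiableOn.finsetProd (fun _ _ => by fun_prop))
      Metric.isOpen_ball
  have := hd.differentiableAt (Metric.isOpen_ball.mem_nhds (by simp : u ∈ _))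
  simpa [qPoch, sub_eq_add_neg] using! this

theorem continuous_qPoch (hp : ‖p‖ < 1) : Continuous fun u => qPoch u p :=
  (differentiable_qPoch hp).continuous

theorem qPoch_eq_zero_iff (hp : ‖p‖ < 1) {u : ℂ} : qPoch u p = 0 ↔ ∃ i : ℕ, u * p ^ i = 1 := by
  constructor
  · intro h
    by_contra! hne
    refine tprod_one_add_ne_zero_of_summable (f := fun i : ℕ => -(u * p ^ i)) (fun i => ?_)
      (summable_norm_mul_pow hp u) (by simpa [qPoch, sub_eq_add_neg] using h)
    rw [← sub_eq_add_neg]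
    exact sub_ne_zero.2 (hne i).symm
  · rintro ⟨i, hi⟩
    induction i generalizing u with
    | zero => rw [qPoch_step hp]; simp_all
    | succ n ih => rw [qPoch_step hp, ih (by rw [← hi]; ring), mul_zero]

theorem qPoch_self_ne_zero (hp : ‖p‖ < 1) : qPoch p p ≠ 0 := by
  rw [Ne, qPoch_eq_zero_iff hp]
  rintro ⟨i, hi⟩
  rw [← pow_succ'] at hi
  have := congrArg norm hi
  rw [norm_pow, norm_one] at this
  exact (pow_lt_one₀ (norm_nonneg _) hp (Nat.succ_ne_zero i)).ne this

/-- Two functions that are continuous at `0` and satisfy the same first order recursion along the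
sequence `p ^ n * X` are proportional at `X`. -/
theorem mul_eq_mul_of_step (hp : ‖p‖ < 1) {f h : ℂ → ℂ} (hf : ContinuousAt f 0)
    (hh : ContinuousAt h 0) {X : ℂ} (c : ℕ → ℂ)
    (hfs : ∀ n : ℕ, f (p ^ n * X) = c n * f (p ^ (n + 1) * X))
    (hhs : ∀ n : ℕ, h (p ^ n * X) = c n * h (p ^ (n + 1) * X)) : f X * h 0 = h X * f 0 := by
  have key : ∀ g : ℂ → ℂ, (∀ n : ℕ, g (p ^ n * X) = c n * g (p ^ (n + 1) * X)) →
      ∀ n : ℕ, g X = (∏ i ∈ Finset.range n, c i) * g (p ^ n * X) := by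
    intro g hg n
    induction n with
    | zero => simp
    | succ n ih => rw [Finset.prod_range_succ, ih, hg n]; ring
  have hlim : Tendsto (fun n : ℕ => p ^ n * X) atTop (𝓝 0) := by
    simpa using (tendsto_pow_atTop_nhds_zero_of_norm_lt_one hp).mul_const X
  have h1 : ∀ n : ℕ, f X * h (p ^ n * X) = h X * f (p ^ n * X) := fun n => by
    rw [key f hfs n, key h hhs n]; ring
  have l1 : Tendsto (fun n : ℕ => f X * h (p ^ n * X)) atTop (𝓝 (f X * h 0)) :=
    (hh.tendsto.comp hlim).const_mul _
  have l2 : Tendsto (fun n : ℕ => h X * f (p ^ n * X)) atTop (𝓝 (h X * f 0)) :=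
    (hf.tendsto.comp hlim).const_mul _
  simp_rw [h1] at l1
  exact tendsto_nhds_unique l1 l2

end QPochhammer

/-! ### Theta functions: functional equations and simplicity of the zeros -/

section Theta

variable {p : ℂ}

theorem theta_mul_nome (hp : ‖p‖ < 1) (hp0 : p ≠ 0) {u : ℂ} (hu : u ≠ 0) :
    theta (p * u) p = -u⁻¹ * theta u p := by
  have h1 : p / (p * u) = u⁻¹ := by field_simp
  rw [theta, theta, h1, qPoch_step hp u, qPoch_step hp u⁻¹, ← div_eq_mul_inv]
  field_simp
  ring

theorem theta_inv (hp : ‖p‖ < 1) {u : ℂ} (hu : u ≠ 0) : theta u⁻¹ p = -u⁻¹ * theta u p := by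
  have h1 : p / u⁻¹ = p * u := by field_simp
  rw [theta, theta, h1, qPoch_step hp u, qPoch_step hp u⁻¹, ← div_eq_mul_inv]
  field_simp
  ring

theorem theta_div_nome (hp : ‖p‖ < 1) (hp0 : p ≠ 0) {u : ℂ} (hu : u ≠ 0) :
    theta (u / p) p = -(u / p) * theta u p := by
  have h := theta_mul_nome hp hp0 (u := u / p) (div_ne_zero hu hp0)
  rw [mul_div_cancel₀ _ hp0] at h
  rw [h]
  field_simp

theorem theta_one (hp : ‖p‖ < 1) : theta 1 p = 0 := by
  rw [theta, (qPoch_eq_zero_iff hp).2 ⟨0, by simp⟩, zero_mul]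

theorem theta_nome_zpow (hp : ‖p‖ < 1) (hp0 : p ≠ 0) (k : ℤ) : theta (p ^ k) p = 0 := by
  induction k using Int.induction_on with
  | zero => simpa using theta_one hp
  | succ n ih =>
    rw [zpow_add_one₀ hp0, mul_comm, theta_mul_nome hp hp0 (zpow_ne_zero _ hp0), ih, mul_zero]
  | pred n ih =>
    rw [zpow_sub_one₀ hp0, ← div_eq_mul_inv, theta_div_nome hp hp0 (zpow_ne_zero _ hp0), ih,
      mul_zero]

theorem theta_eq_zero_iff (hp : ‖p‖ < 1) (hp0 : p ≠ 0) {u : ℂ} (hu : u ≠ 0) :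
    theta u p = 0 ↔ ∃ k : ℤ, u = p ^ k := by
  constructor
  · intro h
    rcases mul_eq_zero.1 h with h | h
    · obtain ⟨i, hi⟩ := (qPoch_eq_zero_iff hp).1 h
      exact ⟨-i, by rw [zpow_neg, zpow_natCast]; exact eq_inv_of_mul_eq_one_left hi⟩
    · obtain ⟨i, hi⟩ := (qPoch_eq_zero_iff hp).1 h
      refine ⟨i + 1, ?_⟩
      rw [zpow_add_one₀ hp0, zpow_natCast]
      field_simp at hi
      rw [← hi]; ring
  · rintro ⟨k, rfl⟩
    exact theta_nome_zpow hp hp0 k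

theorem differentiableAt_theta (hp : ‖p‖ < 1) {u : ℂ} (hu : u ≠ 0) :
    DifferentiableAt ℂ (fun u => theta u p) u := by
  have h2 : DifferentiableAt ℂ (fun u : ℂ => p / u) u := by fun_prop (disch := exact hu)
  exact (differentiable_qPoch hp u).mul ((differentiable_qPoch hp (p / u)).comp u h2)

/-- Differentiate `θ(pv) = -v⁻¹ θ(v)`; at a zero the term coming from the derivative of `v⁻¹` drops
out. -/
theorem deriv_theta_mul_nome (hp : ‖p‖ < 1) (hp0 : p ≠ 0) {u : ℂ} (hu : u ≠ 0)
    (h0 : theta u p = 0) :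
    p * deriv (fun u => theta u p) (p * u) = -u⁻¹ * deriv (fun u => theta u p) u := by
  have hl : HasDerivAt (fun v => theta (p * v) p) (deriv (fun u => theta u p) (p * u) * p) u := by
    have := (differentiableAt_theta hp (mul_ne_zero hp0 hu)).hasDerivAt
    exact this.comp u (by simpa using (hasDerivAt_id u).const_mul p)
  have hr : HasDerivAt (fun v => -v⁻¹ * theta v p)
      (-(-(u ^ 2)⁻¹) * theta u p + -u⁻¹ * deriv (fun u => theta u p) u) u :=
    (hasDerivAt_inv hu).neg.mul (differentiableAt_theta hp hu).hasDerivAt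
  have he : (fun v => theta (p * v) p) =ᶠ[𝓝 u] fun v => -v⁻¹ * theta v p := by
    filter_upwards [isOpen_ne.mem_nhds hu] with v hv using theta_mul_nome hp hp0 hv
  have := (hl.congr_of_eventuallyEq he.symm).unique hr
  rw [h0] at this
  rw [mul_comm, this]; ring

theorem deriv_theta_one (hp : ‖p‖ < 1) :
    deriv (fun u => theta u p) 1 = -qPoch p p ^ 2 := by
  have he : (fun u => theta u p) = fun u => (1 - u) * (qPoch (p * u) p * qPoch (p / u) p) := by
    funext u
    rw [theta, qPoch_step hp u]; ring
  have h2 : DifferentiableAt ℂ (fun u : ℂ => p / u) 1 := by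
    fun_prop (disch := exact one_ne_zero)
  have h3 : DifferentiableAt ℂ (fun u : ℂ => p * u) 1 := by fun_prop
  have hd : DifferentiableAt ℂ (fun u : ℂ => qPoch (p * u) p * qPoch (p / u) p) 1 :=
    ((differentiable_qPoch hp (p * 1)).comp (1 : ℂ) h3).mul
      ((differentiable_qPoch hp (p / 1)).comp (1 : ℂ) h2)
  have h1 : HasDerivAt (fun u : ℂ => 1 - u) (-1) 1 := by
    simpa using (hasDerivAt_id (1 : ℂ)).const_sub 1
  rw [he, (h1.fun_mul hd.hasDerivAt).deriv]
  simp
  ring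

/-- The zero at `1` is simple because the factor `1 - u` splits off with nonzero cofactor, and the
differentiated functional equation transports simplicity along all powers of `p`. Simplicity is what
makes quotients by theta products entire. -/
theorem deriv_theta_ne_zero (hp : ‖p‖ < 1) (hp0 : p ≠ 0) {u : ℂ} (hu : u ≠ 0)
    (h0 : theta u p = 0) : deriv (fun u => theta u p) u ≠ 0 := by
  obtain ⟨k, rfl⟩ := (theta_eq_zero_iff hp hp0 hu).1 h0
  clear hu h0
  induction k using Int.induction_on with
  | zero => simpa [deriv_theta_one hp] using qPoch_self_ne_zero hp
  | succ n ih =>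
    have hz := zpow_ne_zero (n : ℤ) hp0
    have h := deriv_theta_mul_nome hp hp0 hz (theta_nome_zpow hp hp0 _)
    rw [zpow_add_one₀ hp0, mul_comm _ p]
    intro hc
    rw [hc, mul_zero] at h
    exact mul_ne_zero (neg_ne_zero.2 (inv_ne_zero hz)) ih h.symm
  | pred n ih =>
    have hz := zpow_ne_zero (-(n : ℤ) - 1) hp0
    have h := deriv_theta_mul_nome hp hp0 hz (theta_nome_zpow hp hp0 _)
    intro hc
    rw [hc, mul_zero, ← zpow_one_add₀ hp0, add_sub_cancel] at h
    exact mul_ne_zero hp0 ih h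

end Theta

end AskeyWilson

namespace AskeyWilson

/-! ### Quasi-periodic entire functions and theta-type uniqueness -/

section Quotients

/-- An entire function vanishing on the zeros of an entire function with simple zeros is divisible
by it. -/
theorem exists_entire_quotient {f g : ℂ → ℂ} (hf : Differentiable ℂ f) (hg : Differentiable ℂ g)
    (h0 : ∀ w, g w = 0 → f w = 0 ∧ deriv g w ≠ 0) :
    ∃ h : ℂ → ℂ, Differentiable ℂ h ∧ ∀ w, f w = h w * g w := by
  -- At a zero of `g` the l'Hôpital value is the right one: near it the quotient equals the quotient
  -- of the two `dslope`s, whose denominator does not vanish.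
  refine ⟨fun w => if g w = 0 then deriv f w / deriv g w else f w / g w, fun w₀ => ?_,
    fun w => ?_⟩
  · by_cases hw : g w₀ = 0
    · obtain ⟨hf0, hg0⟩ := h0 w₀ hw
      have df : Differentiable ℂ (dslope f w₀) := by
        rw [← differentiableOn_univ] at hf ⊢
        exact (Complex.differentiableOn_dslope univ_mem).2 hf
      have dg : Differentiable ℂ (dslope g w₀) := by
        rw [← differentiableOn_univ] at hg ⊢
        exact (Complex.differentiableOn_dslope univ_mem).2 hg
      have hne : dslope g w₀ w₀ ≠ 0 := by rwa [dslope_same]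
      refine ((df w₀).fun_div (dg w₀) hne).congr_of_eventuallyEq ?_
      filter_upwards [(dg w₀).continuousAt.eventually_ne hne] with w hw'
      have ef : f w = (w - w₀) * dslope f w₀ w := by
        have := sub_smul_dslope f w₀ w
        simpa [hf0] using this.symm
      have eg : g w = (w - w₀) * dslope g w₀ w := by
        have := sub_smul_dslope g w₀ w
        simpa [hw] using this.symm
      rcases eq_or_ne w w₀ with rfl | hww
      · simp [hw]
      · have h1 : w - w₀ ≠ 0 := sub_ne_zero.2 hww
        rw [if_neg (by rw [eg]; exact mul_ne_zero h1 hw'), ef, eg, mul_div_mul_left _ _ h1]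
    · refine ((hf w₀).fun_div (hg w₀) hw).congr_of_eventuallyEq ?_
      filter_upwards [(hg w₀).continuousAt.eventually_ne hw] with w hw'
      rw [if_neg hw']
  · by_cases hw : g w = 0
    · simp [hw, (h0 w hw).1]
    · simp [hw]

theorem dense_ne_zero_of_simple {g : ℂ → ℂ} (hg : Differentiable ℂ g)
    (h0 : ∀ w, g w = 0 → deriv g w ≠ 0) : Dense {w | g w ≠ 0} := by
  intro w
  by_cases hw : g w = 0
  · have := (hg w).hasDerivAt.eventually_ne (c := 0) (h0 w hw)
    exact mem_closure_iff_frequently.2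
      ((this.frequently).filter_mono nhdsWithin_le_nhds)
  · exact subset_closure hw

/-- An entire function that is `2πi`-periodic and multiplicatively quasi-periodic in a second,
independent direction is an exponential. -/
theorem eq_mul_exp_of_quasiperiodic {H : ℂ → ℂ} (hH : Differentiable ℂ H) {ℓ μ : ℂ}
    (hℓ : ℓ.re ≠ 0) (hμ : μ ≠ 0) (h1 : ∀ w, H (w + 2 * Real.pi * Complex.I) = H w)
    (h2 : ∀ w, H (w + ℓ) = μ * H w) :
    ∀ w, H w = H 0 * Complex.exp ((Real.log ‖μ‖ / ℓ.re : ℝ) * w) := by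
  -- Since `c` is real, `exp(-cw)` keeps its modulus under `w ↦ w + 2πi`, and `c · Re ℓ = log ‖μ‖`
  -- cancels the multiplier of the other translation. So `‖G‖` is doubly periodic, hence bounded,
  -- and Liouville applies.
  set c : ℝ := Real.log ‖μ‖ / ℓ.re with hc
  let G : ℂ → ℂ := fun w => H w * Complex.exp (-(c * w))
  have hG : Differentiable ℂ G := by
    intro w
    have := hH w
    fun_prop
  have n1 : ∀ w, ‖G (w + 2 * Real.pi * Complex.I)‖ = ‖G w‖ := by
    intro w
    simp [G, h1, Complex.norm_exp]
  have n2 : ∀ w, ‖G (w + ℓ)‖ = ‖G w‖ := by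
    intro w
    have hcl : c * ℓ.re = Real.log ‖μ‖ := by rw [hc]; field_simp
    simp only [G, h2, norm_mul, Complex.norm_exp]
    have : (-(c * (w + ℓ)) : ℂ).re = -Real.log ‖μ‖ + (-(c * w) : ℂ).re := by
      simp [mul_add, hcl]
    rw [this, Real.exp_add, Real.exp_neg, Real.exp_log (norm_pos_iff.2 hμ)]
    field_simp [norm_ne_zero_iff.2 hμ]
  have m1 : ∀ (n : ℤ) (w : ℂ), ‖G (w + n * (2 * Real.pi * Complex.I))‖ = ‖G w‖ := by
    intro n
    induction n using Int.induction_on with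
    | zero => simp
    | succ n ih => intro w; rw [← ih w, ← n1 (w + (n : ℤ) * (2 * Real.pi * Complex.I))]; congr 2; push_cast; ring
    | pred n ih => intro w; rw [← ih w, ← n1]; congr 2; push_cast; ring
  have m2 : ∀ (n : ℤ) (w : ℂ), ‖G (w + n * ℓ)‖ = ‖G w‖ := by
    intro n
    induction n using Int.induction_on with
    | zero => simp
    | succ n ih => intro w; rw [← ih w, ← n2 (w + (n : ℤ) * ℓ)]; congr 2; push_cast; ring
    | pred n ih => intro w; rw [← ih w, ← n2]; congr 2; push_cast; ring
  have hcpt : IsCompact (Metric.closedBall (0 : ℂ) (|ℓ.re| + 2 * Real.pi)) :=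
    isCompact_closedBall _ _
  obtain ⟨C, hC⟩ := hcpt.exists_bound_of_continuousOn hG.continuous.continuousOn
  have hb : ∀ w, ‖G w‖ ≤ C := by
    intro w
    -- Reduce the real part by multiples of `ℓ` first; the later translations by `2πi` do not
    -- disturb it.
    let n : ℤ := ⌊w.re / ℓ.re⌋
    let v : ℂ := w + (-n : ℤ) * ℓ
    let m : ℤ := ⌊v.im / (2 * Real.pi)⌋
    let y : ℂ := v + (-m : ℤ) * (2 * Real.pi * Complex.I)
    have e : ‖G y‖ = ‖G w‖ := by rw [m1, m2]
    have hyre : |y.re| ≤ |ℓ.re| := by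
      have : y.re = Int.fract (w.re / ℓ.re) * ℓ.re := by
        have h3 : w.re / ℓ.re * ℓ.re = w.re := by field_simp
        simp only [y, v, n, Int.fract, sub_mul, h3]
        simp
        ring
      rw [this, abs_mul, abs_of_nonneg (Int.fract_nonneg _)]
      exact mul_le_of_le_one_left (abs_nonneg _) (Int.fract_lt_one _).le
    have hyim : |y.im| ≤ 2 * Real.pi := by
      have : y.im = Int.fract (v.im / (2 * Real.pi)) * (2 * Real.pi) := by
        have h3 : v.im / (2 * Real.pi) * (2 * Real.pi) = v.im := by
          field_simp [Real.pi_ne_zero]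
        rw [Int.fract, sub_mul, h3]
        simp [y, m]
        ring
      rw [this, abs_mul, abs_of_nonneg (Int.fract_nonneg _), abs_of_pos Real.two_pi_pos]
      exact mul_le_of_le_one_left Real.two_pi_pos.le (Int.fract_lt_one _).le
    rw [← e]
    refine hC y ?_
    rw [mem_closedBall_zero_iff]
    exact (Complex.norm_le_abs_re_add_abs_im y).trans (add_le_add hyre hyim)
  intro w
  have hconst : G w = G 0 := hG.apply_eq_apply_of_bounded
    (isBounded_iff_forall_norm_le.2 ⟨C, by rintro _ ⟨w, rfl⟩; exact hb w⟩) w 0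
  have : H w = G w * Complex.exp (c * w) := by
    simp [G, mul_assoc, ← Complex.exp_add]
  rw [this, hconst]
  simp [G]

/-- A nonzero `H` would be a multiple of `exp(cw)`; its `2πi`-periodicity forces `c` to be an
integer `n`, and then `‖μ‖ = ‖exp ℓ‖ ^ n`. -/
theorem eq_zero_of_quasiperiodic {H : ℂ → ℂ} (hH : Differentiable ℂ H) {ℓ μ : ℂ}
    (hℓ : ℓ.re ≠ 0) (hμ : μ ≠ 0) (h1 : ∀ w, H (w + 2 * Real.pi * Complex.I) = H w)
    (h2 : ∀ w, H (w + ℓ) = μ * H w) (hk : ∀ k : ℤ, ‖μ‖ ≠ ‖Complex.exp ℓ‖ ^ k) : ∀ w, H w = 0 := by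
  have key := eq_mul_exp_of_quasiperiodic hH hℓ hμ h1 h2
  set c : ℝ := Real.log ‖μ‖ / ℓ.re with hc
  suffices H 0 = 0 by intro w; rw [key w, this, zero_mul]
  by_contra hne
  have h3 := h1 0
  rw [key (0 + _), zero_add] at h3
  have h4 : Complex.exp (c * (2 * Real.pi * Complex.I)) = 1 := by
    simpa [hne] using h3
  obtain ⟨n, hn⟩ := Complex.exp_eq_one_iff.1 h4
  have h5 : (c : ℂ) = n := mul_right_cancel₀ Complex.two_pi_I_ne_zero hn
  have h6 : c = n := by exact_mod_cast h5
  refine hk n ?_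
  rw [Complex.norm_exp, ← Real.rpow_intCast, ← Real.exp_mul, ← h6, hc, mul_div_cancel₀ _ hℓ,
    Real.exp_log (norm_pos_iff.2 hμ)]

variable {p : ℂ}

/-- Pull `F / G` back along `exp`. The multipliers of `F` and `G` differ only by the constant `μ`,
so the quotient has a constant multiplier; its functional equations hold where `G` is nonzero and
extend by density. -/
theorem exists_quasiperiodic_quotient (hp : ‖p‖ < 1) (hp0 : p ≠ 0) {F G : ℂ → ℂ} {e : ℂ → ℂ} {μ : ℂ}
    (hF : ∀ X ≠ 0, DifferentiableAt ℂ F X) (hG : ∀ X ≠ 0, DifferentiableAt ℂ G X)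
    (he : ∀ X ≠ 0, e X ≠ 0)
    (hFp : ∀ X ≠ 0, F (p * X) = μ * e X * F X) (hGp : ∀ X ≠ 0, G (p * X) = e X * G X)
    (h0 : ∀ X ≠ 0, G X = 0 → F X = 0 ∧ deriv G X ≠ 0) :
    ∃ H : ℂ → ℂ, Differentiable ℂ H ∧ (∀ w, F (Complex.exp w) = H w * G (Complex.exp w)) ∧
      (∀ w, H (w + 2 * Real.pi * Complex.I) = H w) ∧
      (∀ w, H (w + Complex.log p) = μ * H w) ∧ (Complex.log p).re ≠ 0 := by
  have dg : ∀ w, HasDerivAt (fun w => G (Complex.exp w))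
      (deriv G (Complex.exp w) * Complex.exp w) w := fun w =>
    (hG _ (Complex.exp_ne_zero w)).hasDerivAt.comp w (Complex.hasDerivAt_exp w)
  have df : Differentiable ℂ fun w => F (Complex.exp w) := fun w =>
    ((hF _ (Complex.exp_ne_zero w)).hasDerivAt.comp w (Complex.hasDerivAt_exp w)).differentiableAt
  have dG : Differentiable ℂ fun w => G (Complex.exp w) := fun w => (dg w).differentiableAt
  have hs : ∀ w, G (Complex.exp w) = 0 → deriv (fun w => G (Complex.exp w)) w ≠ 0 := by
    intro w hw
    rw [(dg w).deriv]
    exact mul_ne_zero (h0 _ (Complex.exp_ne_zero w) hw).2 (Complex.exp_ne_zero w)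
  obtain ⟨H, hH, hHe⟩ := exists_entire_quotient df dG fun w hw =>
    ⟨(h0 _ (Complex.exp_ne_zero w) hw).1, hs w hw⟩
  have hdense := dense_ne_zero_of_simple dG hs
  have hexp : Complex.exp (Complex.log p) = p := Complex.exp_log hp0
  refine ⟨H, hH, hHe, ?_, ?_, ?_⟩
  · refine congrFun (Continuous.ext_on hdense ?_ hH.continuous ?_)
    · exact hH.continuous.comp (by fun_prop)
    · intro w hw
      have h1 := hHe (w + 2 * Real.pi * Complex.I)
      rw [Complex.exp_periodic w, hHe w] at h1
      exact (mul_right_cancel₀ hw h1).symm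
  · refine congrFun (Continuous.ext_on hdense ?_ (hH.continuous.const_mul μ) ?_)
    · exact hH.continuous.comp (by fun_prop)
    · intro w hw
      have h1 := hHe (w + Complex.log p)
      have hne := Complex.exp_ne_zero w
      rw [Complex.exp_add, hexp, mul_comm _ p, hFp _ hne, hGp _ hne, hHe w] at h1
      have h2 : e (Complex.exp w) * G (Complex.exp w) ≠ 0 := mul_ne_zero (he _ hne) hw
      refine mul_right_cancel₀ h2 ?_
      simp only at h1 ⊢
      linear_combination -h1
  · rw [Complex.log_re]
    exact (Real.log_neg (norm_pos_iff.2 hp0) hp).ne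

/-- Theta-type uniqueness: multipliers whose quotient is not a power of the nome. -/
theorem eq_zero_of_multiplier (hp : ‖p‖ < 1) (hp0 : p ≠ 0) {F G : ℂ → ℂ} {e : ℂ → ℂ} {μ : ℂ}
    (hF : ∀ X ≠ 0, DifferentiableAt ℂ F X) (hG : ∀ X ≠ 0, DifferentiableAt ℂ G X)
    (he : ∀ X ≠ 0, e X ≠ 0) (hμ : μ ≠ 0) (hk : ∀ k : ℤ, ‖μ‖ ≠ ‖p‖ ^ k)
    (hFp : ∀ X ≠ 0, F (p * X) = μ * e X * F X) (hGp : ∀ X ≠ 0, G (p * X) = e X * G X)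
    (h0 : ∀ X ≠ 0, G X = 0 → F X = 0 ∧ deriv G X ≠ 0) :
    ∀ X ≠ 0, F X = 0 := by
  obtain ⟨H, hH, hHe, h1, h2, hℓ⟩ := exists_quasiperiodic_quotient hp hp0 hF hG he hFp hGp h0
  intro X hX
  have h4 := hHe (Complex.log X)
  rw [Complex.exp_log hX] at h4
  rw [h4, eq_zero_of_quasiperiodic hH hℓ hμ h1 h2 (by rwa [Complex.exp_log hp0]), zero_mul]

end Quotients

end AskeyWilson

namespace AskeyWilson

/-! ### Power series with infinite radius of convergence -/

section EntireSeries

open PowerSeries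

/-- Power series with infinite radius of convergence. -/
def IsEntire (f : ℂ⟦X⟧) : Prop := ∀ x : ℂ, Summable fun n => ‖coeff n f * x ^ n‖

/-- The sum of a power series at a point. -/
noncomputable def seriesEval (f : ℂ⟦X⟧) (x : ℂ) : ℂ := ∑' n, coeff n f * x ^ n

theorem IsEntire.mul {f g : ℂ⟦X⟧} (hf : IsEntire f) (hg : IsEntire g) : IsEntire (f * g) := by
  intro x
  have := summable_norm_sum_mul_antidiagonal_of_summable_norm (hf x) (hg x)
  refine this.congr fun n => ?_
  rw [coeff_mul, Finset.sum_mul]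
  congr 1
  refine Finset.sum_congr rfl fun kl hkl => ?_
  rw [← Finset.HasAntidiagonal.mem_antidiagonal.1 hkl, pow_add]; ring

theorem seriesEval_mul {f g : ℂ⟦X⟧} (hf : IsEntire f) (hg : IsEntire g) (x : ℂ) :
    seriesEval (f * g) x = seriesEval f x * seriesEval g x := by
  unfold seriesEval
  rw [tsum_mul_tsum_eq_tsum_sum_antidiagonal_of_summable_norm (hf x) (hg x)]
  refine tsum_congr fun n => ?_
  rw [coeff_mul, Finset.sum_mul]
  refine Finset.sum_congr rfl fun kl hkl => ?_
  rw [← Finset.HasAntidiagonal.mem_antidiagonal.1 hkl, pow_add]; ring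

theorem IsEntire.add {f g : ℂ⟦X⟧} (hf : IsEntire f) (hg : IsEntire g) : IsEntire (f + g) := by
  intro x
  refine Summable.of_nonneg_of_le (fun _ => norm_nonneg _) (fun n => ?_) ((hf x).add (hg x))
  rw [map_add, add_mul]
  exact norm_add_le _ _

theorem seriesEval_add {f g : ℂ⟦X⟧} (hf : IsEntire f) (hg : IsEntire g) (x : ℂ) :
    seriesEval (f + g) x = seriesEval f x + seriesEval g x := by
  unfold seriesEval
  rw [← (hf x).of_norm.tsum_add (hg x).of_norm]
  exact tsum_congr fun n => by rw [map_add, add_mul]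

theorem hasSum_C (r x : ℂ) : HasSum (fun n => coeff n (C r : ℂ⟦X⟧) * x ^ n) r := by
  have := hasSum_single (f := fun n => coeff n (C r : ℂ⟦X⟧) * x ^ n) 0 (fun n hn => by
    simp [coeff_C, hn])
  simpa using this

theorem isEntire_C (r : ℂ) : IsEntire (C r) := by
  intro x
  refine summable_of_ne_finset_zero (s := {0}) fun n hn => ?_
  simp [coeff_C, Finset.mem_singleton.not.1 hn]

theorem seriesEval_C (r x : ℂ) : seriesEval (C r) x = r := (hasSum_C r x).tsum_eq

theorem isEntire_X : IsEntire (X : ℂ⟦X⟧) := by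
  intro x
  refine summable_of_ne_finset_zero (s := {1}) fun n hn => ?_
  simp [coeff_X, Finset.mem_singleton.not.1 hn]

theorem seriesEval_X (x : ℂ) : seriesEval (X : ℂ⟦X⟧) x = x := by
  unfold seriesEval
  rw [tsum_eq_single 1 (fun n hn => by simp [coeff_X, hn])]
  simp

theorem IsEntire.rescale {f : ℂ⟦X⟧} (hf : IsEntire f) (s : ℂ) :
    IsEntire (PowerSeries.rescale s f) := by
  intro x
  refine (hf (s * x)).congr fun n => ?_
  rw [coeff_rescale, mul_pow]; congr 1; ring

theorem seriesEval_rescale (f : ℂ⟦X⟧) (s x : ℂ) :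
    seriesEval (PowerSeries.rescale s f) x = seriesEval f (s * x) :=
  tsum_congr fun n => by rw [coeff_rescale, mul_pow]; ring

theorem seriesEval_zero (f : ℂ⟦X⟧) : seriesEval f 0 = coeff 0 f := by
  unfold seriesEval
  rw [tsum_eq_single 0 (fun n hn => by simp [hn])]
  simp

theorem IsEntire.one : IsEntire 1 := by simpa using isEntire_C 1

theorem IsEntire.neg {f : ℂ⟦X⟧} (hf : IsEntire f) : IsEntire (-f) := by
  simpa using (isEntire_C (-1)).mul hf

theorem seriesEval_one (x : ℂ) : seriesEval 1 x = 1 := by simpa using seriesEval_C 1 x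

theorem seriesEval_neg (f : ℂ⟦X⟧) (x : ℂ) : seriesEval (-f) x = -seriesEval f x := by
  unfold seriesEval
  rw [← tsum_neg]
  exact tsum_congr fun n => by rw [map_neg, neg_mul]

theorem IsEntire.sub {f g : ℂ⟦X⟧} (hf : IsEntire f) (hg : IsEntire g) : IsEntire (f - g) := by
  simpa [sub_eq_add_neg] using hf.add hg.neg

theorem seriesEval_sub {f g : ℂ⟦X⟧} (hf : IsEntire f) (hg : IsEntire g) (x : ℂ) :
    seriesEval (f - g) x = seriesEval f x - seriesEval g x := by
  rw [sub_eq_add_neg, seriesEval_add hf hg.neg, seriesEval_neg, sub_eq_add_neg]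

theorem IsEntire.pow {f : ℂ⟦X⟧} (hf : IsEntire f) (n : ℕ) : IsEntire (f ^ n) := by
  induction n with
  | zero => simpa using IsEntire.one
  | succ n ih => rw [pow_succ]; exact ih.mul hf

theorem seriesEval_pow {f : ℂ⟦X⟧} (hf : IsEntire f) (n : ℕ) (x : ℂ) :
    seriesEval (f ^ n) x = seriesEval f x ^ n := by
  induction n with
  | zero => simpa using seriesEval_one x
  | succ n ih => rw [pow_succ, seriesEval_mul (hf.pow n) hf, ih, pow_succ]

theorem IsEntire.differentiable {f : ℂ⟦X⟧} (hf : IsEntire f) :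
    Differentiable ℂ (seriesEval f) := by
  intro x
  have hd : DifferentiableOn ℂ (fun y => ∑' n, coeff n f * y ^ n) (Metric.ball 0 (‖x‖ + 1)) := by
    refine Complex.differentiableOn_tsum_of_summable_norm
      (u := fun n => ‖coeff n f * ((‖x‖ + 1 : ℝ) : ℂ) ^ n‖) (hf _) (fun n => by fun_prop)
      Metric.isOpen_ball fun n y hy => ?_
    have hy' : ‖y‖ ≤ ‖x‖ + 1 := by simpa using (mem_ball_zero_iff.1 hy).le
    rw [norm_mul, norm_mul, norm_pow, norm_pow, Complex.norm_real,
      Real.norm_of_nonneg (by positivity)]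
    gcongr
  exact hd.differentiableAt (Metric.isOpen_ball.mem_nhds (by simp))

theorem IsEntire.continuous {f : ℂ⟦X⟧} (hf : IsEntire f) : Continuous (seriesEval f) :=
  hf.differentiable.continuous

theorem IsEntire.of_X_pow_mul {g : ℂ⟦X⟧} {k : ℕ} (hf : IsEntire (X ^ k * g)) : IsEntire g := by
  intro x
  rcases eq_or_ne x 0 with rfl | hx
  · refine summable_of_ne_finset_zero (s := {0}) fun n hn => ?_
    simp [Finset.mem_singleton.not.1 hn]
  · have h1 := (summable_nat_add_iff k).2 (hf x)
    refine (h1.mul_left (‖x ^ k‖⁻¹)).congr fun n => ?_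
    have : ‖x ^ k‖ ≠ 0 := norm_ne_zero_iff.2 (pow_ne_zero _ hx)
    rw [coeff_X_pow_mul, pow_add, norm_mul, norm_mul, norm_mul]
    field_simp

/-- Identity principle for entire power series. -/
theorem IsEntire.eq_zero_of_frequently {f : ℂ⟦X⟧} (hf : IsEntire f)
    (h : ∃ᶠ x in 𝓝[≠] (0 : ℂ), seriesEval f x = 0) : f = 0 := by
  by_contra hne
  -- After removing the exact power of `X`, the cofactor is nonzero at `0` and hence nearby, so the
  -- zeros of the sum cannot accumulate at `0`.
  obtain ⟨g, hg⟩ := X_pow_order_dvd (φ := f)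
  set k := f.order.toNat with hk
  have hge : IsEntire g := IsEntire.of_X_pow_mul (k := k) (hg ▸ hf)
  have hg0 : coeff 0 g ≠ 0 := by
    have h1 : coeff k f = coeff 0 g := by
      conv_lhs => rw [hg]
      simpa using coeff_X_pow_mul g k 0
    rw [← h1]
    exact coeff_order hne
  have hev : ∀ᶠ x in 𝓝[≠] (0 : ℂ), seriesEval f x ≠ 0 := by
    have h1 : ∀ᶠ x in 𝓝 (0 : ℂ), seriesEval g x ≠ 0 :=
      hge.continuous.continuousAt.eventually_ne (by rwa [seriesEval_zero])
    filter_upwards [h1.filter_mono nhdsWithin_le_nhds, self_mem_nhdsWithin] with x hx hx0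
    rw [hg, seriesEval_mul (isEntire_X.pow k) hge, seriesEval_pow isEntire_X, seriesEval_X]
    exact mul_ne_zero (pow_ne_zero _ hx0) hx
  obtain ⟨x, h1, h2⟩ := (h.and_eventually hev).exists
  exact h2 h1

end EntireSeries

end AskeyWilson

/-! ### The gauged eigenvalue equation and its formal solution -/

namespace AskeyWilson

/-- Askey--Wilson parameters `(a, b, c, d)` together with the nome `p` and a square root
`t` of `abcd / p`. -/
@[ext]
structure AWData where
  p : ℂ
  a : ℂ
  b : ℂ
  c : ℂ
  d : ℂ
  t : ℂ
  p_ne : p ≠ 0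
  p_lt : ‖p‖ < 1
  a_ne : a ≠ 0
  b_ne : b ≠ 0
  c_ne : c ≠ 0
  d_ne : d ≠ 0
  t_ne : t ≠ 0
  rel : a * b * c * d = p * t ^ 2

namespace AWData

noncomputable section

variable (D : AWData)

def e1 : ℂ := D.a + D.b + D.c + D.d
def e2 : ℂ := D.a * D.b + D.a * D.c + D.a * D.d + D.b * D.c + D.b * D.d + D.c * D.d
def e3 : ℂ := D.a * D.b * D.c + D.a * D.b * D.d + D.a * D.c * D.d + D.b * D.c * D.d

/-- `(1 - ax)(1 - bx)(1 - cx)(1 - dx)`. -/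
def E1 (x : ℂ) : ℂ := 1 - D.e1 * x + D.e2 * x ^ 2 - D.e3 * x ^ 3 + D.p * D.t ^ 2 * x ^ 4

/-- `(1 - x/a)(1 - x/b)(1 - x/c)(1 - x/d)`. -/
def E2 (x : ℂ) : ℂ :=
  1 - D.e3 / (D.p * D.t ^ 2) * x + D.e2 / (D.p * D.t ^ 2) * x ^ 2 -
    D.e1 / (D.p * D.t ^ 2) * x ^ 3 + 1 / (D.p * D.t ^ 2) * x ^ 4

theorem E1_eq (x : ℂ) :
    D.E1 x = (1 - D.a * x) * (1 - D.b * x) * (1 - D.c * x) * (1 - D.d * x) := by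
  rw [E1, ← D.rel, e1, e2, e3]; ring

theorem E2_eq (x : ℂ) :
    D.E2 x = (1 - x / D.a) * (1 - x / D.b) * (1 - x / D.c) * (1 - x / D.d) := by
  have := D.a_ne
  have := D.b_ne
  have := D.c_ne
  have := D.d_ne
  rw [E2, ← D.rel, e1, e2, e3]
  field_simp
  ring

section Polynomials

open Polynomial

def polyE1 : ℂ[X] :=
  1 - C D.e1 * X + C D.e2 * X ^ 2 - C D.e3 * X ^ 3 + C (D.p * D.t ^ 2) * X ^ 4

def polyE2 : ℂ[X] :=
  1 - C (D.e3 / (D.p * D.t ^ 2)) * X + C (D.e2 / (D.p * D.t ^ 2)) * X ^ 2 -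
    C (D.e1 / (D.p * D.t ^ 2)) * X ^ 3 + C (1 / (D.p * D.t ^ 2)) * X ^ 4

/-- With `X = q^x` and `p = q^s`, this and `polyV` are, the former up to a monomial factor, the
denominators `1 - q^{s-2x}` and `1 - q^{s+2x}` of `A(-x)` and `A(x)`. -/
def polyU : ℂ[X] := 1 - C D.p⁻¹ * X ^ 2

def polyV : ℂ[X] := 1 - C D.p * X ^ 2

/-- The polynomial `q(s X)`. -/
def dilate (s : ℂ) (q : Polynomial ℂ) : Polynomial ℂ :=
  q.comp (Polynomial.C s * Polynomial.X)

/-- `polyL`, `polyR1` and `polyR2` are the coefficients left after clearing denominators, sorted by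
their dependence on `Z`: `polyL` goes with `Z²`, `polyR1` with `Z`, `polyR2` with `Z² + 1`. -/
def polyL : ℂ[X] := D.polyE1 * dilate D.p D.polyE2 * D.polyU

def polyR1 : ℂ[X] :=
  C D.t⁻¹ * D.polyU * D.polyE1 + C D.t * D.polyV * D.polyE2 -
    C (D.t + D.t⁻¹) * (1 - X ^ 2) * D.polyV * D.polyU

def polyR2 : ℂ[X] := (1 - X ^ 2) * D.polyV * D.polyU

@[simp] theorem eval_polyE1 (x : ℂ) : D.polyE1.eval x = D.E1 x := by simp [polyE1, E1]
@[simp] theorem eval_polyE2 (x : ℂ) : D.polyE2.eval x = D.E2 x := by simp [polyE2, E2]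
@[simp] theorem eval_polyU (x : ℂ) : D.polyU.eval x = 1 - D.p⁻¹ * x ^ 2 := by simp [polyU]
@[simp] theorem eval_polyV (x : ℂ) : D.polyV.eval x = 1 - D.p * x ^ 2 := by simp [polyV]
@[simp] theorem eval_dilate (s : ℂ) (q : Polynomial ℂ) (x : ℂ) :
    (dilate s q).eval x = q.eval (s * x) := by simp [dilate]

end Polynomials

section Series

open PowerSeries

theorem rescale_coe (s : ℂ) (q : Polynomial ℂ) :
    rescale s (q : ℂ⟦X⟧) = (dilate s q : Polynomial ℂ) := by
  ext n
  rw [coeff_rescale, Polynomial.coeff_coe, Polynomial.coeff_coe, dilate,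
    Polynomial.comp_C_mul_X_coeff, mul_comm]

theorem isEntire_coe (q : Polynomial ℂ) : IsEntire (q : ℂ⟦X⟧) := by
  induction q using Polynomial.induction_on' with
  | add f g hf hg => rw [Polynomial.coe_add]; exact hf.add hg
  | monomial n a =>
    rw [← Polynomial.C_mul_X_pow_eq_monomial]
    simpa using (isEntire_C a).mul (isEntire_X.pow n)

theorem seriesEval_coe (q : Polynomial ℂ) (x : ℂ) : seriesEval (q : ℂ⟦X⟧) x = q.eval x := by
  induction q using Polynomial.induction_on' with
  | add f g hf hg =>
    rw [Polynomial.coe_add, seriesEval_add (isEntire_coe f) (isEntire_coe g), hf, hg]; simp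
  | monomial n a =>
    rw [← Polynomial.C_mul_X_pow_eq_monomial]
    simp [seriesEval_mul (isEntire_C a) (isEntire_X.pow n), seriesEval_C,
      seriesEval_pow isEntire_X, seriesEval_X]

/-- The gauged eigenvalue equation, as an equation for formal power series. -/
def SeriesEq (Z : ℂ) (f : ℂ⟦X⟧) : Prop :=
  C (Z ^ 2) * (D.polyL : ℂ⟦X⟧) * rescale D.p f + (D.polyV : ℂ⟦X⟧) * rescale D.p⁻¹ f =
    (C Z * (D.polyR1 : ℂ⟦X⟧) + C (Z ^ 2 + 1) * (D.polyR2 : ℂ⟦X⟧)) * f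

/-- The contribution of the `k`-th coefficient to degree `r` of the right side minus the left side
of `SeriesEq`. -/
def recCoeff (Z : ℂ) (r k : ℕ) : ℂ :=
  Z * D.polyR1.coeff (r - k) + (Z ^ 2 + 1) * D.polyR2.coeff (r - k) -
    Z ^ 2 * D.polyL.coeff (r - k) * D.p ^ k - D.polyV.coeff (r - k) * D.p⁻¹ ^ k

/-- The indicial factor: it vanishes at `r = 0`, which leaves the constant term free, and for `r >
0` only if `Z² p^r = 1`. -/
theorem recCoeff_self (Z : ℂ) (r : ℕ) :
    D.recCoeff Z r r = -(D.p⁻¹ ^ r * (1 - D.p ^ r) * (1 - Z ^ 2 * D.p ^ r)) := by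
  have hp := D.p_ne
  have ht := D.t_ne
  have h1 : D.polyR1.coeff 0 = 0 := by
    rw [Polynomial.coeff_zero_eq_eval_zero]; simp [polyR1, E1, E2, add_comm]
  have h2 : D.polyR2.coeff 0 = 1 := by
    rw [Polynomial.coeff_zero_eq_eval_zero]; simp [polyR2]
  have h3 : D.polyL.coeff 0 = 1 := by
    rw [Polynomial.coeff_zero_eq_eval_zero]; simp [polyL, E1, E2]
  have h4 : D.polyV.coeff 0 = 1 := by
    rw [Polynomial.coeff_zero_eq_eval_zero]; simp
  simp only [recCoeff, Nat.sub_self, h1, h2, h3, h4, inv_pow]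
  field_simp
  ring

theorem seriesEq_iff (Z : ℂ) (f : ℂ⟦X⟧) :
    D.SeriesEq Z f ↔ ∀ r, D.p⁻¹ ^ r * (1 - D.p ^ r) * (1 - Z ^ 2 * D.p ^ r) * coeff r f =
      ∑ k ∈ Finset.range r, D.recCoeff Z r k * coeff k f := by
  rw [SeriesEq, PowerSeries.ext_iff]
  refine forall_congr' fun r => ?_
  have key : ∀ (q : Polynomial ℂ) (g : ℂ⟦X⟧), coeff r ((q : ℂ⟦X⟧) * g) =
      ∑ k ∈ Finset.range (r + 1), q.coeff (r - k) * coeff k g := by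
    intro q g
    rw [mul_comm, coeff_mul, Finset.Nat.sum_antidiagonal_eq_sum_range_succ
      (fun i j => coeff i g * coeff j (q : ℂ⟦X⟧))]
    exact Finset.sum_congr rfl fun k _ => by rw [Polynomial.coeff_coe, mul_comm]
  rw [map_add, mul_assoc, coeff_C_mul, key, key, add_mul, map_add, mul_assoc, mul_assoc,
    coeff_C_mul, coeff_C_mul, key, key]
  have : ∑ k ∈ Finset.range (r + 1), D.recCoeff Z r k * coeff k f =
      Z * ∑ k ∈ Finset.range (r + 1), D.polyR1.coeff (r - k) * coeff k f +
      (Z ^ 2 + 1) * ∑ k ∈ Finset.range (r + 1), D.polyR2.coeff (r - k) * coeff k f -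
      Z ^ 2 * ∑ k ∈ Finset.range (r + 1), D.polyL.coeff (r - k) * coeff k (rescale D.p f) -
      ∑ k ∈ Finset.range (r + 1), D.polyV.coeff (r - k) * coeff k (rescale D.p⁻¹ f) := by
    simp only [Finset.mul_sum, ← Finset.sum_add_distrib, ← Finset.sum_sub_distrib]
    refine Finset.sum_congr rfl fun k _ => ?_
    rw [recCoeff, coeff_rescale, coeff_rescale]; ring
  rw [Finset.sum_range_succ, recCoeff_self] at this
  constructor
  · intro h; linear_combination h - this
  · intro h; linear_combination h + this

/-- The polynomial part of the coefficients of the asymptotically free solution. -/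
def redCoeff (Z : ℂ) (r : ℕ) : ℂ :=
  if r = 0 then 1 else D.p ^ r / (1 - D.p ^ r) *
    ∑ k : Fin r, D.recCoeff Z r k * (∏ i ∈ Finset.Ioo (k : ℕ) r, (1 - Z ^ 2 * D.p ^ i)) *
      redCoeff Z k
  termination_by r
  decreasing_by exact k.2

/-- The coefficients of the asymptotically free solution, as functions of `Z = q^z`. -/
def gam (r : ℕ) (Z : ℂ) : ℂ := D.redCoeff Z r * qPoch (D.p ^ (r + 1) * Z ^ 2) D.p

theorem redCoeff_zero (Z : ℂ) : D.redCoeff Z 0 = 1 := by rw [redCoeff, if_pos rfl]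

theorem redCoeff_of_ne_zero (Z : ℂ) {r : ℕ} (hr : r ≠ 0) :
    D.redCoeff Z r = D.p ^ r / (1 - D.p ^ r) *
      ∑ k ∈ Finset.range r, D.recCoeff Z r k *
        (∏ i ∈ Finset.Ioo k r, (1 - Z ^ 2 * D.p ^ i)) * D.redCoeff Z k := by
  rw [redCoeff, if_neg hr, Finset.sum_range]

theorem gam_zero (Z : ℂ) : D.gam 0 Z = qPoch (D.p * Z ^ 2) D.p := by
  rw [gam, redCoeff_zero, one_mul, zero_add, pow_one]

theorem pow_ne_one {r : ℕ} (hr : r ≠ 0) : D.p ^ r ≠ 1 := by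
  intro h
  have := congrArg norm h
  rw [norm_pow, norm_one] at this
  exact (pow_lt_one₀ (norm_nonneg _) D.p_lt hr).ne this

theorem qPoch_eq_prod_Ioc (Z : ℂ) (k r : ℕ) (h : k ≤ r) :
    qPoch (D.p ^ (k + 1) * Z ^ 2) D.p =
      (∏ i ∈ Finset.Ioc k r, (1 - Z ^ 2 * D.p ^ i)) * qPoch (D.p ^ (r + 1) * Z ^ 2) D.p := by
  induction r, h using Nat.le_induction with
  | base => simp
  | succ r h ih =>
    rw [ih, qPoch_step D.p_lt, ← Finset.insert_Ioc_right_eq_Ioc_add_one h,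
      Finset.prod_insert (by simp)]
    ring_nf

/-- The Pochhammer tails attached to the indices `k < r` differ by `∏_{k < i ≤ r} (1 - Z²p^i)`. The
factors with `i < r` are those built into `redCoeff`, and `i = r` is the indicial factor, so nothing
is ever divided by `1 - Z²p^i` and the recursion holds for every `Z`. -/
theorem gam_rec (Z : ℂ) (r : ℕ) :
    D.p⁻¹ ^ r * (1 - D.p ^ r) * (1 - Z ^ 2 * D.p ^ r) * D.gam r Z =
      ∑ k ∈ Finset.range r, D.recCoeff Z r k * D.gam k Z := by
  rcases eq_or_ne r 0 with rfl | hr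
  · simp
  have h1 : 1 - D.p ^ r ≠ 0 := sub_ne_zero.2 (D.pow_ne_one hr).symm
  have hp := D.p_ne
  have : ∀ k ∈ Finset.range r, D.recCoeff Z r k * D.gam k Z =
      (1 - Z ^ 2 * D.p ^ r) * qPoch (D.p ^ (r + 1) * Z ^ 2) D.p * (D.recCoeff Z r k *
        (∏ i ∈ Finset.Ioo k r, (1 - Z ^ 2 * D.p ^ i)) * D.redCoeff Z k) := by
    intro k hk
    have hk' := Finset.mem_range.1 hk
    rw [gam, D.qPoch_eq_prod_Ioc Z k r hk'.le, ← Finset.Ioo_insert_right hk',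
      Finset.prod_insert (by simp)]
    ring
  rw [Finset.sum_congr rfl this, ← Finset.mul_sum, gam, D.redCoeff_of_ne_zero Z hr, inv_pow]
  field_simp

/-- The asymptotically free solution as a formal power series in `X = q^x`. -/
def psi (Z : ℂ) : ℂ⟦X⟧ := PowerSeries.mk fun r => D.gam r Z

theorem seriesEq_psi (Z : ℂ) : D.SeriesEq Z (D.psi Z) := by
  rw [seriesEq_iff]
  intro r
  simpa [psi] using D.gam_rec Z r

theorem eq_of_seriesEq {Z : ℂ} {f g : ℂ⟦X⟧} (hZ : ∀ r : ℕ, r ≠ 0 → Z ^ 2 * D.p ^ r ≠ 1)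
    (hf : D.SeriesEq Z f) (hg : D.SeriesEq Z g) (h0 : coeff 0 f = coeff 0 g) : f = g := by
  rw [seriesEq_iff] at hf hg
  ext r
  induction r using Nat.strong_induction_on with
  | _ r ih =>
    rcases eq_or_ne r 0 with rfl | hr
    · exact h0
    have h1 : D.p⁻¹ ^ r * (1 - D.p ^ r) * (1 - Z ^ 2 * D.p ^ r) ≠ 0 :=
      mul_ne_zero (mul_ne_zero (pow_ne_zero _ (inv_ne_zero D.p_ne))
        (sub_ne_zero.2 (D.pow_ne_one hr).symm)) (sub_ne_zero.2 (hZ r hr).symm)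
    refine mul_left_cancel₀ h1 ?_
    rw [hf r, hg r]
    exact Finset.sum_congr rfl fun k hk => by rw [ih k (Finset.mem_range.1 hk)]

theorem differentiable_redCoeff (r : ℕ) : Differentiable ℂ fun Z => D.redCoeff Z r := by
  induction r using Nat.strong_induction_on with
  | _ r ih =>
    rcases eq_or_ne r 0 with rfl | hr
    · simp [redCoeff_zero]
    simp only [D.redCoeff_of_ne_zero _ hr]
    refine Differentiable.const_mul (Differentiable.fun_sum fun k hk => ?_) _
    refine Differentiable.mul (Differentiable.mul ?_ ?_) (ih k (Finset.mem_range.1 hk))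
    · unfold recCoeff; fun_prop
    · exact Differentiable.fun_finsetProd (fun i _ => by fun_prop)

theorem differentiable_gam (r : ℕ) : Differentiable ℂ (D.gam r) := by
  refine (D.differentiable_redCoeff r).mul ((differentiable_qPoch D.p_lt).comp ?_)
  fun_prop

end Series

end

end AWData

end AskeyWilson

namespace AskeyWilson

/-! ### A decay estimate for coupled recursions -/

section Growth

/-- A coupled recursion whose diagonal part decays forces geometric decay at every rate. -/
theorem coupled_recursion_bound {π K ρ : ℝ} (hπ0 : 0 < π) (hπ1 : π < 1) (hK : 1 ≤ K) (hρ0 : 0 < ρ)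
    (hρ1 : ρ ≤ 1) :
    ∃ N : ℕ, 4 ≤ N ∧ ∃ η > 0, ∀ x y : ℕ → ℝ, (∀ r, 0 ≤ x r) → (∀ r, 0 ≤ y r) →
      (∀ r, 4 ≤ r → x r ≤ π ^ r * (K * ∑ j ∈ Finset.range 5, x (r - j) + y r + K * y (r - 2))) →
      (∀ r, 4 ≤ r → y r ≤ π ^ r * (K * ∑ j ∈ Finset.range 5, y (r - j)) + K * (x r + x (r - 2))) →
      ∀ B, 0 ≤ B → (∀ r < N, x r ≤ B * ρ ^ r ∧ η * y r ≤ B * ρ ^ r) →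
      ∀ r, x r ≤ B * ρ ^ r ∧ η * y r ≤ B * ρ ^ r := by
  -- The terms `K (x r + x (r - 2))` carry no factor `π ^ r`. The weight `η` makes them small
  -- instead: `η K ≤ 1/4`, and the `ρ ^ 2` compensates for the index shift in `x (r - 2)`.
  set η : ℝ := ρ ^ 2 / (4 * K) with hη
  have hK0 : 0 < K := by linarith
  have hη0 : 0 < η := by positivity
  -- The cost of replacing `ρ ^ (r - j)` by `ρ ^ r` for shifts `j ≤ 4`.
  set S : ℝ := (ρ ^ 4)⁻¹ with hS
  have hS0 : 0 < S := by positivity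
  have hS1 : 1 ≤ S := (one_le_inv₀ (by positivity)).2 (pow_le_one₀ hρ0.le hρ1)
  have hlim : Tendsto (fun n : ℕ => π ^ n * (K * S * (1 + 1 / η))) atTop (𝓝 0) := by
    simpa using (tendsto_pow_atTop_nhds_zero_of_lt_one hπ0.le hπ1).mul_const (K * S * (1 + 1 / η))
  -- From `N` on, every term carrying `π ^ r` costs at most one part in 400 of the target bound or
  -- of the unknowns. The two resulting linear inequalities can then be solved for `x r` and `η * y
  -- r`, which also occur on the right.
  obtain ⟨N, hN⟩ := eventually_atTop.1 (hlim.eventually (gt_mem_nhds (by norm_num : (0 : ℝ) < 1 / 400)))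
  refine ⟨max N 4, le_max_right _ _, η, hη0, fun x y hx hy h1 h2 B hB h0 r => ?_⟩
  induction r using Nat.strong_induction_on with
  | _ r ih =>
    rcases lt_or_ge r (max N 4) with hr | hr
    · exact h0 r hr
    have hr4 : 4 ≤ r := (le_max_right _ _).trans hr
    have hε := (hN r ((le_max_left _ _).trans hr)).le
    set D : ℝ := B * ρ ^ r with hD
    have hD0 : 0 ≤ D := by positivity
    have hπr : 0 < π ^ r := pow_pos hπ0 r
    have hpow : ∀ j, 1 ≤ j → j ≤ 4 → B * ρ ^ (r - j) ≤ S * D := by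
      intro j hj1 hj
      have : ρ ^ (r - j) ≤ S * ρ ^ r := by
        have e : r = (r - j) + j := by omega
        have e2 : S * ρ ^ r = ρ ^ (r - j) * (S * ρ ^ j) := by
          conv_lhs => rw [e, pow_add]
          ring
        rw [e2]
        refine le_mul_of_one_le_right (by positivity) ?_
        rw [hS, inv_mul_eq_div, one_le_div (by positivity)]
        exact pow_le_pow_of_le_one hρ0.le hρ1 hj
      calc B * ρ ^ (r - j) ≤ B * (S * ρ ^ r) := by gcongr
        _ = S * D := by rw [hD]; ring
    have bx : ∀ j, 1 ≤ j → j ≤ 4 → x (r - j) ≤ S * D := fun j hj1 hj =>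
      (ih (r - j) (by omega)).1.trans (hpow j hj1 hj)
    have by' : ∀ j, 1 ≤ j → j ≤ 4 → η * y (r - j) ≤ S * D := fun j hj1 hj =>
      (ih (r - j) (by omega)).2.trans (hpow j hj1 hj)
    have q1 : π ^ r * K ≤ 1 / 400 := by
      refine le_trans ?_ hε
      rw [← mul_assoc, ← mul_assoc]
      have : 1 ≤ S * (1 + 1 / η) := by
        have : 0 ≤ S * (1 / η) := by positivity
        linarith
      calc π ^ r * K ≤ π ^ r * K * (S * (1 + 1 / η)) := le_mul_of_one_le_right (by positivity) this
        _ = _ := by ring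
    have q2 : π ^ r * K * S ≤ 1 / 400 := by
      refine le_trans ?_ hε
      have : 0 ≤ π ^ r * (K * S * (1 / η)) := by positivity
      calc π ^ r * K * S ≤ π ^ r * K * S + π ^ r * (K * S * (1 / η)) := by linarith
        _ = _ := by ring
    have q3 : π ^ r * K * S * (1 / η) ≤ 1 / 400 := by
      refine le_trans ?_ hε
      have : 0 ≤ π ^ r * (K * S) := by positivity
      calc π ^ r * K * S * (1 / η) ≤ π ^ r * K * S * (1 / η) + π ^ r * (K * S) := by linarith
        _ = _ := by ring
    have q4 : π ^ r * (1 / η) ≤ 1 / 400 := by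
      refine le_trans ?_ q3
      have : 1 ≤ K * S := one_le_mul_of_one_le_of_one_le hK hS1
      calc π ^ r * (1 / η) ≤ π ^ r * (1 / η) * (K * S) := le_mul_of_one_le_right (by positivity) this
        _ = _ := by ring
    have X1 := h1 r hr4
    have Y1 := h2 r hr4
    simp only [Finset.sum_range_succ, Finset.sum_range_zero, zero_add, Nat.sub_zero] at X1 Y1
    -- the lower order terms of the first recursion
    have t1 : ∀ j, 1 ≤ j → j ≤ 4 → π ^ r * K * x (r - j) ≤ D / 400 := fun j a b => by
      calc π ^ r * K * x (r - j) ≤ π ^ r * K * (S * D) := by gcongr; exact bx j a b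
        _ = π ^ r * K * S * D := by ring
        _ ≤ 1 / 400 * D := by gcongr
        _ = D / 400 := by ring
    have t2 : π ^ r * K * x r ≤ x r / 400 := by
      calc π ^ r * K * x r ≤ 1 / 400 * x r := by gcongr; exact hx r
        _ = _ := by ring
    have t3 : π ^ r * y r ≤ η * y r / 400 := by
      calc π ^ r * y r = π ^ r * (1 / η) * (η * y r) := by field_simp
        _ ≤ 1 / 400 * (η * y r) := by
          gcongr
          exact mul_nonneg hη0.le (hy r)
        _ = _ := by ring
    have t4 : π ^ r * K * y (r - 2) ≤ D / 400 := by
      calc π ^ r * K * y (r - 2) = π ^ r * K * (1 / η) * (η * y (r - 2)) := by field_simp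
        _ ≤ π ^ r * K * (1 / η) * (S * D) := mul_le_mul_of_nonneg_left (by' 2 (by norm_num) (by norm_num)) (by positivity)
        _ = π ^ r * K * S * (1 / η) * D := by ring
        _ ≤ 1 / 400 * D := by gcongr
        _ = D / 400 := by ring
    have u1 : ∀ j, 1 ≤ j → j ≤ 4 → η * (π ^ r * K * y (r - j)) ≤ D / 400 := fun j a b => by
      calc η * (π ^ r * K * y (r - j)) = π ^ r * K * (η * y (r - j)) := by ring
        _ ≤ π ^ r * K * (S * D) := mul_le_mul_of_nonneg_left (by' j a b) (by positivity)
        _ = π ^ r * K * S * D := by ring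
        _ ≤ 1 / 400 * D := by gcongr
        _ = D / 400 := by ring
    have u2 : η * (π ^ r * K * y r) ≤ η * y r / 400 := by
      calc η * (π ^ r * K * y r) = π ^ r * K * (η * y r) := by ring
        _ ≤ 1 / 400 * (η * y r) := by
          gcongr
          exact mul_nonneg hη0.le (hy r)
        _ = _ := by ring
    have ηK : η * K = ρ ^ 2 / 4 := by rw [hη]; field_simp
    have u3 : η * (K * x r) ≤ x r / 4 := by
      rw [← mul_assoc, ηK]
      have : ρ ^ 2 ≤ 1 := pow_le_one₀ hρ0.le hρ1
      nlinarith [hx r]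
    have u4 : η * (K * x (r - 2)) ≤ D / 4 := by
      rw [← mul_assoc, ηK]
      have h3 := (ih (r - 2) (by omega)).1
      have e : ρ ^ r = ρ ^ 2 * ρ ^ (r - 2) := by rw [← pow_add]; congr 1; omega
      calc ρ ^ 2 / 4 * x (r - 2) ≤ ρ ^ 2 / 4 * (B * ρ ^ (r - 2)) := by gcongr
        _ = D / 4 := by rw [hD, e]; ring
    have Y2 := mul_le_mul_of_nonneg_left Y1 hη0.le
    have a1 := t1 1 (by norm_num) (by norm_num)
    have a2 := t1 2 (by norm_num) (by norm_num)
    have a3 := t1 3 (by norm_num) (by norm_num)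
    have a4 := t1 4 (by norm_num) (by norm_num)
    have b1 := u1 1 (by norm_num) (by norm_num)
    have b2 := u1 2 (by norm_num) (by norm_num)
    have b3 := u1 3 (by norm_num) (by norm_num)
    have b4 := u1 4 (by norm_num) (by norm_num)
    have X2 : x r ≤ x r / 400 + 5 * (D / 400) + η * y r / 400 := by linarith
    have Y3 : η * y r ≤ η * y r / 400 + 4 * (D / 400) + x r / 4 + D / 4 := by linarith
    constructor <;> linarith

end Growth

end AskeyWilson

namespace AskeyWilson

namespace AWData

noncomputable section

variable (D : AWData)

/-! ### Polynomial identities behind the contiguity relation -/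

section Polynomials

open Polynomial

def polyW : ℂ[X] := 1 - X ^ 2

@[simp] theorem eval_polyW (x : ℂ) : polyW.eval x = 1 - x ^ 2 := by simp [polyW]

/-- `(1 - tZ)(1 - Z/t)`. -/
def kap (Z : ℂ) : ℂ := (1 - D.t * Z) * (1 - Z / D.t)

/-- `1 - Z²/p`. -/
def qz (Z : ℂ) : ℂ := 1 - Z ^ 2 / D.p

def eta : ℂ := (D.e1 + D.e3 / D.p) / D.t
def nu : ℂ := (D.e2 + D.t ^ 2 + D.p) / (D.t * D.p)
def sig : ℂ := (D.e1 + D.e3 / D.t ^ 2) / D.p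

/-- `q₀(Z)(1 - Z/t)(1 - tZ/p)`. -/
def kz (Z : ℂ) : ℂ := D.qz Z * (1 - Z / D.t) * (1 - D.t * Z / D.p)

/-- The coefficient of the contiguity relation in the variable `Z`. -/
def T (x Z : ℂ) : ℂ :=
  (x ^ 2 - Z ^ 2) * (D.qz Z * (1 - x ^ 2 / D.p) + D.eta / D.p * x * Z) -
    D.nu * x ^ 2 * Z * D.qz Z + D.sig * x * Z ^ 2 * (1 - x ^ 2 / D.p)

/-- Chosen so that `qz · g + S f` is the first component of a solution at `Z / p` whenever `(f, g)`
is a solution at `Z`. The matching second component is `t Z kz E2 f + Y' g`, with `Y'` given by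
`polyY'`. -/
def polyS (Z : ℂ) : ℂ[X] :=
  C (D.qz Z * (D.t * Z - Z ^ 2)) +
    C (D.qz Z * D.e1 / D.t * Z + Z * (D.sig * Z - D.eta)) * X +
    C (D.qz Z * (1 - Z / D.t)) * X ^ 2

def polyY (Z : ℂ) : ℂ[X] :=
  C (D.qz Z * Z) * (C (1 / D.t - D.t / D.p) * (1 + C D.p⁻¹ * X ^ 2) -
    C (D.e1 / (D.t * D.p) - D.e3 / (D.t * D.p ^ 2)) * X)

def polyT (Z : ℂ) : ℂ[X] := D.polyU * D.polyS Z - C (D.qz Z * (D.t * Z)) * D.polyE2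

theorem dilate_U : dilate D.p D.polyU = D.polyV := by
  have hp := D.p_ne
  refine Polynomial.funext fun x => ?_
  simp
  field_simp

theorem eval_polyT (Z x : ℂ) : (D.polyT Z).eval x = D.T x Z := by
  have hp := D.p_ne
  have ht := D.t_ne
  simp [polyT, polyS, T, E2, eta, nu, sig, qz]
  field_simp
  ring

/-- The identities `contig_A` and `contig_B` compare the coefficients of `f(X/p)` and `g` in the
first equation for the contiguous pair; `contig_C` and `contig_D` those of `g` and `f` in the
second. -/
theorem contig_A (Z : ℂ) :
    C (D.qz Z * D.kap Z) * dilate D.p⁻¹ polyW + dilate D.p⁻¹ (D.polyS Z) - C D.p⁻¹ * D.polyS Z =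
      D.polyU * C (D.kz Z) := by
  have hp := D.p_ne
  have ht := D.t_ne
  refine Polynomial.funext fun x => ?_
  simp [polyS, kz, kap]
  field_simp
  ring

theorem contig_B (Z : ℂ) :
    C (D.qz Z) * (C (Z / D.t) * dilate D.p⁻¹ D.polyE1 - C (D.t * Z / D.p) * D.polyE2) =
      D.polyU * D.polyY Z := by
  have hp := D.p_ne
  have ht := D.t_ne
  refine Polynomial.funext fun x => ?_
  simp [polyY, E1, E2]
  field_simp
  ring

def polyY' (Z : ℂ) : ℂ[X] := C D.p⁻¹ * D.polyS Z + C (D.kz Z) * D.polyU + D.polyY Z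

theorem contig_C (Z : ℂ) :
    D.polyY' Z = C D.p⁻¹ * (dilate D.p (D.polyY' Z) - C (D.kz Z) * D.polyV) +
      C (D.kap (Z / D.p) * D.qz Z) * polyW := by
  have hp := D.p_ne
  have ht := D.t_ne
  refine Polynomial.funext fun x => ?_
  simp [polyY', polyY, polyS, kz, kap, eta, sig, qz]
  field_simp
  ring

theorem contig_D (Z : ℂ) :
    C (D.t * Z * D.kz Z) * D.polyE2 =
      C D.p⁻¹ * (C (Z / D.t * D.kz Z) * D.polyE1 -
        C (D.kap Z) * polyW * (dilate D.p (D.polyY' Z) - C (D.kz Z) * D.polyV)) +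
      C (D.kap (Z / D.p)) * polyW * D.polyS Z := by
  have hp := D.p_ne
  have ht := D.t_ne
  refine Polynomial.funext fun x => ?_
  simp [polyY', polyY, polyS, kz, kap, eta, sig, E1, E2, qz]
  field_simp
  ring

end Polynomials

end

end AWData

end AskeyWilson

namespace AskeyWilson

namespace AWData

noncomputable section

variable (D : AWData)

/-! ### The first order system and contiguity in `Z` for formal series -/

section Series

open PowerSeries

theorem rescale_const (s r : ℂ) : rescale s (C r : ℂ⟦X⟧) = C r := by
  ext n
  rcases eq_or_ne n 0 with rfl | hn <;> simp [coeff_C, *]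

theorem rescale_p_inv (f : ℂ⟦X⟧) : rescale D.p (rescale D.p⁻¹ f) = f := by
  rw [rescale_rescale, inv_mul_cancel₀ D.p_ne, rescale_one, RingHom.id_apply]

theorem rescale_inv_p (f : ℂ⟦X⟧) : rescale D.p⁻¹ (rescale D.p f) = f := by
  rw [rescale_rescale, mul_inv_cancel₀ D.p_ne, rescale_one, RingHom.id_apply]

theorem coe_ne_zero_of_eval_zero {q : Polynomial ℂ} (h : q.eval 0 ≠ 0) : (q : ℂ⟦X⟧) ≠ 0 := by
  intro h0
  rw [Polynomial.coe_eq_zero_iff] at h0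
  simp [h0] at h

theorem coe_polyU_ne : (D.polyU : ℂ⟦X⟧) ≠ 0 := coe_ne_zero_of_eval_zero (by simp)

theorem coe_polyV_ne : (D.polyV : ℂ⟦X⟧) ≠ 0 := coe_ne_zero_of_eval_zero (by simp)

/-- The first equation of the first order system equivalent to `SeriesEq`. -/
def FirstEq (Z : ℂ) (f g : ℂ⟦X⟧) : Prop :=
  rescale D.p⁻¹ f = C (D.t * Z) * (D.polyE2 : ℂ⟦X⟧) * f + (D.polyU : ℂ⟦X⟧) * g

/-- The second equation of the first order system equivalent to `SeriesEq`. -/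
def SecondEq (Z : ℂ) (f g : ℂ⟦X⟧) : Prop :=
  g = C (Z / D.t) * (D.polyE1 : ℂ⟦X⟧) * rescale D.p g + C (D.kap Z) * (polyW : ℂ⟦X⟧) * f

theorem FirstEq.rescale {D : AWData} {Z : ℂ} {f g : ℂ⟦X⟧} (h : D.FirstEq Z f g) :
    f = C (D.t * Z) * (dilate D.p D.polyE2 : Polynomial ℂ) * PowerSeries.rescale D.p f +
      (D.polyV : ℂ⟦X⟧) * PowerSeries.rescale D.p g := by
  have h1 := congrArg (PowerSeries.rescale D.p) h
  rw [rescale_p_inv, map_add, map_mul (PowerSeries.rescale D.p),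
    map_mul (PowerSeries.rescale D.p) (C _), map_mul (PowerSeries.rescale D.p) (D.polyU : ℂ⟦X⟧),
    rescale_coe, rescale_coe, dilate_U, rescale_const] at h1
  exact h1

/-- Once `g` is introduced by the first equation, the defect of `SeriesEq` is `V U` times the defect
of the second equation, and power series form a domain. Cancelling `V U` removes the apparent
singularities that obstruct a direct growth estimate. -/
theorem seriesEq_iff_secondEq {Z : ℂ} {f g : ℂ⟦X⟧} (h0 : D.FirstEq Z f g) :
    D.SeriesEq Z f ↔ D.SecondEq Z f g := by
  have ht := D.t_ne
  have h1 := h0.rescale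
  unfold FirstEq at h0
  have ha : (C (Z ^ 2) : ℂ⟦X⟧) = C (Z / D.t) * C (D.t * Z) := by
    rw [← map_mul]; congr 1; field_simp
  have hb : (C (Z / D.t) : ℂ⟦X⟧) = C Z * C D.t⁻¹ := by
    rw [← map_mul]; rfl
  have hc : (C (D.t * Z) : ℂ⟦X⟧) = C Z * C D.t := by
    rw [← map_mul]; congr 1; ring
  have hk : (C (D.kap Z) : ℂ⟦X⟧) = C (Z ^ 2 + 1) - C Z * C (D.t + D.t⁻¹) := by
    rw [← map_mul, ← map_sub]; congr 1; rw [kap]; field_simp; ring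
  have hL : (D.polyL : ℂ⟦X⟧) =
      (D.polyE1 : ℂ⟦X⟧) * (dilate D.p D.polyE2 : Polynomial ℂ) * (D.polyU : ℂ⟦X⟧) := by
    simp [polyL]
  have hR1 : (D.polyR1 : ℂ⟦X⟧) = C D.t⁻¹ * (D.polyU : ℂ⟦X⟧) * (D.polyE1 : ℂ⟦X⟧) +
      C D.t * (D.polyV : ℂ⟦X⟧) * (D.polyE2 : ℂ⟦X⟧) -
      C (D.t + D.t⁻¹) * (polyW : ℂ⟦X⟧) * (D.polyV : ℂ⟦X⟧) * (D.polyU : ℂ⟦X⟧) := by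
    rw [polyR1, ← polyW]
    simp only [Polynomial.coe_sub, Polynomial.coe_add, Polynomial.coe_mul, Polynomial.coe_C]
  have hR2 : (D.polyR2 : ℂ⟦X⟧) = (polyW : ℂ⟦X⟧) * (D.polyV : ℂ⟦X⟧) * (D.polyU : ℂ⟦X⟧) := by
    rw [polyR2, ← polyW]
    simp only [Polynomial.coe_mul]
  have key : C (Z ^ 2) * (D.polyL : ℂ⟦X⟧) * PowerSeries.rescale D.p f +
      (D.polyV : ℂ⟦X⟧) * PowerSeries.rescale D.p⁻¹ f -
      (C Z * (D.polyR1 : ℂ⟦X⟧) + C (Z ^ 2 + 1) * (D.polyR2 : ℂ⟦X⟧)) * f =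
      (D.polyV : ℂ⟦X⟧) * (D.polyU : ℂ⟦X⟧) *
        (g - (C (Z / D.t) * (D.polyE1 : ℂ⟦X⟧) * PowerSeries.rescale D.p g +
          C (D.kap Z) * (polyW : ℂ⟦X⟧) * f)) := by
    rw [hL, hR1, hR2]
    generalize (dilate D.p D.polyE2 : Polynomial ℂ) = E' at *
    linear_combination (D.polyV : ℂ⟦X⟧) * h0 -
      C (Z / D.t) * (D.polyE1 : ℂ⟦X⟧) * (D.polyU : ℂ⟦X⟧) * h1 +
      (D.polyE1 : ℂ⟦X⟧) * (E' : ℂ⟦X⟧) * (D.polyU : ℂ⟦X⟧) * PowerSeries.rescale D.p f * ha +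
      (D.polyU : ℂ⟦X⟧) * (D.polyE1 : ℂ⟦X⟧) * f * hb +
      (D.polyV : ℂ⟦X⟧) * (D.polyE2 : ℂ⟦X⟧) * f * hc +
      (polyW : ℂ⟦X⟧) * (D.polyV : ℂ⟦X⟧) * (D.polyU : ℂ⟦X⟧) * f * hk
  rw [SeriesEq, SecondEq, ← sub_eq_zero, key, mul_eq_zero, sub_eq_zero]
  exact or_iff_right (mul_ne_zero D.coe_polyV_ne D.coe_polyU_ne)

/-- The second component of the first order system attached to the asymptotically free solution. -/
def chi (Z : ℂ) : ℂ⟦X⟧ :=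
  (D.polyU : ℂ⟦X⟧)⁻¹ * (rescale D.p⁻¹ (D.psi Z) - C (D.t * Z) * (D.polyE2 : ℂ⟦X⟧) * D.psi Z)

theorem firstEq_psi (Z : ℂ) : D.FirstEq Z (D.psi Z) (D.chi Z) := by
  have h : (D.polyU : ℂ⟦X⟧) * (D.polyU : ℂ⟦X⟧)⁻¹ = 1 := by
    refine PowerSeries.mul_inv_cancel _ ?_
    rw [← coeff_zero_eq_constantCoeff_apply, Polynomial.coeff_coe,
      Polynomial.coeff_zero_eq_eval_zero]
    simp
  rw [FirstEq, chi, ← mul_assoc, h]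
  ring

theorem secondEq_psi (Z : ℂ) : D.SecondEq Z (D.psi Z) (D.chi Z) :=
  (D.seriesEq_iff_secondEq (D.firstEq_psi Z)).1 (D.seriesEq_psi Z)

theorem coeff_zero_psi (Z : ℂ) : coeff 0 (D.psi Z) = D.gam 0 Z := by simp [psi]

theorem coeff_zero_chi (Z : ℂ) : coeff 0 (D.chi Z) = (1 - D.t * Z) * D.gam 0 Z := by
  have h := congrArg (coeff 0) (D.firstEq_psi Z)
  have e0 : ∀ q : Polynomial ℂ, constantCoeff (q : ℂ⟦X⟧) = q.eval 0 := fun q => by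
    rw [← coeff_zero_eq_constantCoeff_apply, Polynomial.coeff_coe,
      Polynomial.coeff_zero_eq_eval_zero]
  simp only [coeff_rescale, pow_zero, one_mul, map_add, coeff_zero_eq_constantCoeff, map_mul, e0,
    constantCoeff_C, eval_polyE2, eval_polyU] at h
  simp only [← coeff_zero_eq_constantCoeff_apply, coeff_zero_psi] at h
  simp [E2] at h
  rw [← coeff_zero_eq_constantCoeff_apply] at h
  linear_combination -h

/-- The contiguous pair solves the first order system with `Z` replaced by `Z / p`. -/
theorem contiguous_system {Z : ℂ} {f g : ℂ⟦X⟧} (h1 : D.FirstEq Z f g) (h2 : D.SecondEq Z f g) :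
    D.SeriesEq (Z / D.p) (C (D.qz Z) * g + (D.polyS Z : ℂ⟦X⟧) * f) := by
  have hp := D.p_ne
  have ht := D.t_ne
  have h1p := h1.rescale
  have h2m := congrArg (PowerSeries.rescale D.p⁻¹) h2
  rw [map_add, map_mul, map_mul, map_mul, map_mul, rescale_inv_p, rescale_coe, rescale_coe,
    rescale_const, rescale_const] at h2m
  have hA := congrArg (fun q : Polynomial ℂ => (q : ℂ⟦X⟧)) (D.contig_A Z)
  have hB := congrArg (fun q : Polynomial ℂ => (q : ℂ⟦X⟧)) (D.contig_B Z)
  have hC := congrArg (fun q : Polynomial ℂ => (q : ℂ⟦X⟧)) (D.contig_C Z)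
  have hD := congrArg (fun q : Polynomial ℂ => (q : ℂ⟦X⟧)) (D.contig_D Z)
  have hY : ((D.polyY' Z : Polynomial ℂ) : ℂ⟦X⟧) =
      C D.p⁻¹ * (D.polyS Z : ℂ⟦X⟧) + C (D.kz Z) * (D.polyU : ℂ⟦X⟧) + (D.polyY Z : ℂ⟦X⟧) := by
    rw [polyY']
    simp only [Polynomial.coe_add, Polynomial.coe_mul, Polynomial.coe_C]
  simp only [Polynomial.coe_sub, Polynomial.coe_add, Polynomial.coe_mul, Polynomial.coe_C]
    at hA hB hC hD
  have c1 : (C (D.t * Z / D.p) : ℂ⟦X⟧) = C D.p⁻¹ * C (D.t * Z) := by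
    rw [← map_mul]; congr 1; field_simp
  have c2 : (C (D.t * (Z / D.p)) : ℂ⟦X⟧) = C D.p⁻¹ * C (D.t * Z) := by
    rw [← map_mul]; congr 1; field_simp
  have c3 : (C (Z / D.p / D.t) : ℂ⟦X⟧) = C D.p⁻¹ * C (Z / D.t) := by
    rw [← map_mul]; congr 1; field_simp
  have c4 : (C (D.t * Z * D.kz Z) : ℂ⟦X⟧) = C (D.t * Z) * C (D.kz Z) := by rw [← map_mul]
  have c5 : (C (Z / D.t * D.kz Z) : ℂ⟦X⟧) = C (Z / D.t) * C (D.kz Z) := by rw [← map_mul]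
  have c6 : (C (D.qz Z * D.kap Z) : ℂ⟦X⟧) = C (D.qz Z) * C (D.kap Z) := by rw [← map_mul]
  have c7 : (C (D.kap (Z / D.p) * D.qz Z) : ℂ⟦X⟧) = C (D.kap (Z / D.p)) * C (D.qz Z) := by
    rw [← map_mul]
  have hS1 : D.FirstEq (Z / D.p) (C (D.qz Z) * g + (D.polyS Z : ℂ⟦X⟧) * f)
      (C (D.t * Z * D.kz Z) * (D.polyE2 : ℂ⟦X⟧) * f + (D.polyY' Z : ℂ⟦X⟧) * g) := by
    unfold FirstEq at h1 ⊢
    rw [map_add, map_mul, map_mul, rescale_const, rescale_coe, h2m, c2, c4, hY]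
    rw [c1] at hB
    rw [c6] at hA
    generalize PowerSeries.rescale D.p⁻¹ f = sf at *
    linear_combination sf * hA + g * hB +
      (C D.p⁻¹ * (D.polyS Z : ℂ⟦X⟧) + (D.polyU : ℂ⟦X⟧) * C (D.kz Z)) * h1
  rw [D.seriesEq_iff_secondEq hS1]
  unfold SecondEq at h2 ⊢
  have r1 : PowerSeries.rescale D.p (C (D.t * Z * D.kz Z) * (D.polyE2 : ℂ⟦X⟧) * f) =
      C (D.t * Z * D.kz Z) * (dilate D.p D.polyE2 : Polynomial ℂ) * PowerSeries.rescale D.p f := by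
    rw [map_mul (PowerSeries.rescale D.p), map_mul (PowerSeries.rescale D.p) (C _), rescale_const,
      rescale_coe]
  rw [map_add (PowerSeries.rescale D.p), r1, map_mul (PowerSeries.rescale D.p), rescale_coe, c3, c4]
  rw [c4, c5] at hD
  rw [c7] at hC
  generalize PowerSeries.rescale D.p f = F1 at *
  generalize PowerSeries.rescale D.p g = G1 at *
  generalize ((dilate D.p (D.polyY' Z) : Polynomial ℂ) : ℂ⟦X⟧) = rY at *
  linear_combination f * hD + g * hC + C D.p⁻¹ * C (Z / D.t) * (D.polyE1 : ℂ⟦X⟧) * C (D.kz Z) * h1p +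
    C D.p⁻¹ * (rY - C (D.kz Z) * (D.polyV : ℂ⟦X⟧)) * h2

/-- Both sides solve the equation at `Z / p`, so by uniqueness only the constant terms need
comparison: `qz (1 - tZ) + qz (tZ - Z²) = (1 - Z²/p)(1 - Z²)`, exactly the two factors by which the
Pochhammer symbols differ. -/
theorem psi_div_p_eq {Z : ℂ} (hZ : ∀ r : ℕ, r ≠ 0 → (Z / D.p) ^ 2 * D.p ^ r ≠ 1) :
    D.psi (Z / D.p) = C (D.qz Z) * D.chi Z + (D.polyS Z : ℂ⟦X⟧) * D.psi Z := by
  refine D.eq_of_seriesEq hZ (D.seriesEq_psi _)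
    (D.contiguous_system (D.firstEq_psi Z) (D.secondEq_psi Z)) ?_
  have hp := D.p_ne
  have e0 : constantCoeff (D.polyS Z : ℂ⟦X⟧) = (D.polyS Z).eval 0 := by
    rw [← coeff_zero_eq_constantCoeff_apply, Polynomial.coeff_coe,
      Polynomial.coeff_zero_eq_eval_zero]
  rw [coeff_zero_psi, map_add, coeff_C_mul, coeff_zero_chi, coeff_zero_eq_constantCoeff_apply (_ * _), map_mul, e0,
    ← coeff_zero_eq_constantCoeff_apply, coeff_zero_psi, gam_zero, gam_zero]
  have e1 : D.p * (Z / D.p) ^ 2 = Z ^ 2 / D.p := by field_simp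
  rw [e1, qPoch_step D.p_lt, qPoch_step D.p_lt (D.p * (Z ^ 2 / D.p))]
  have e2 : D.p * (Z ^ 2 / D.p) = Z ^ 2 := by field_simp
  rw [e2]
  simp [polyS, qz]
  ring

/-- The auxiliary series `chi` is eliminated with the first equation, leaving a relation between
values of `psi` alone. -/
theorem contiguity_series {Z : ℂ} (hZ : ∀ r : ℕ, r ≠ 0 → (Z / D.p) ^ 2 * D.p ^ r ≠ 1) :
    (D.polyU : ℂ⟦X⟧) * D.psi (Z / D.p) =
      C (D.qz Z) * rescale D.p⁻¹ (D.psi Z) + (D.polyT Z : ℂ⟦X⟧) * D.psi Z := by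
  have h1 := D.firstEq_psi Z
  unfold FirstEq at h1
  have h3 : ((D.polyT Z : Polynomial ℂ) : ℂ⟦X⟧) = (D.polyU : ℂ⟦X⟧) * (D.polyS Z : ℂ⟦X⟧) -
      C (D.qz Z) * C (D.t * Z) * (D.polyE2 : ℂ⟦X⟧) := by
    rw [← map_mul, polyT]
    simp only [Polynomial.coe_sub, Polynomial.coe_mul, Polynomial.coe_C]
  rw [D.psi_div_p_eq hZ, h1, h3]
  ring

end Series

end

end AWData

end AskeyWilson

namespace AskeyWilson

namespace AWData

noncomputable section

variable (D : AWData)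

/-! ### Convergence, and the passage from series to functions -/

section Series

open PowerSeries

theorem coeff_coe_mul_of_degree_le {q : Polynomial ℂ} (hq : q.natDegree ≤ 4) (g : ℂ⟦X⟧) {r : ℕ}
    (hr : 4 ≤ r) : coeff r ((q : ℂ⟦X⟧) * g) =
      ∑ j ∈ Finset.range 5, q.coeff j * coeff (r - j) g := by
  rw [coeff_mul, Finset.Nat.sum_antidiagonal_eq_sum_range_succ
    (fun i j => coeff i (q : ℂ⟦X⟧) * coeff j g)]
  simp only [Polynomial.coeff_coe]
  symm
  refine Finset.sum_subset (fun j hj => ?_) fun j _ hj => ?_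
  · simp only [Finset.mem_range] at hj ⊢; omega
  · rw [Polynomial.coeff_eq_zero_of_natDegree_lt (by simp at hj; omega), zero_mul]

theorem norm_coeff_coe_mul_le {q : Polynomial ℂ} (hq : q.natDegree ≤ 4) (g : ℂ⟦X⟧) {r : ℕ}
    (hr : 4 ≤ r) : ‖coeff r ((q : ℂ⟦X⟧) * g)‖ ≤
      (∑ j ∈ Finset.range 5, ‖q.coeff j‖) * ∑ j ∈ Finset.range 5, ‖coeff (r - j) g‖ := by
  rw [coeff_coe_mul_of_degree_le hq g hr, Finset.sum_mul]
  refine (norm_sum_le _ _).trans (Finset.sum_le_sum fun j hj => ?_)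
  rw [norm_mul]
  gcongr
  exact Finset.single_le_sum (f := fun j => ‖coeff (r - j) g‖) (fun _ _ => norm_nonneg _) hj

theorem coeff_one_sub_mul (c : ℂ) (g : ℂ⟦X⟧) {r : ℕ} (hr : 2 ≤ r) :
    coeff r ((1 - C c * X ^ 2) * g) = coeff r g - c * coeff (r - 2) g := by
  obtain ⟨k, rfl⟩ := Nat.exists_eq_add_of_le' hr
  rw [sub_mul, one_mul, map_sub, mul_assoc, coeff_C_mul, coeff_X_pow_mul, Nat.add_sub_cancel]

theorem natDegree_polyE1 : D.polyE1.natDegree ≤ 4 := by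
  unfold polyE1; compute_degree

theorem natDegree_polyE2 : D.polyE2.natDegree ≤ 4 := by
  unfold polyE2; compute_degree

theorem continuous_coeff_chi (r : ℕ) : Continuous fun Z => coeff r (D.chi Z) := by
  have h : ∀ n, Continuous (D.gam n) := fun n => (D.differentiable_gam n).continuous
  simp only [chi, coeff_mul r, map_sub, mul_assoc, coeff_C_mul, coeff_rescale]
  simp only [coeff_mul, psi, coeff_mk]
  fun_prop

/-- The coefficients of the asymptotically free solution decay faster than any geometric sequence,
locally uniformly in `Z`. -/
theorem exists_norm_gam_le (R : ℝ) {ρ : ℝ} (hρ0 : 0 < ρ) (hρ1 : ρ ≤ 1) :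
    ∃ B, 0 ≤ B ∧ ∀ Z : ℂ, ‖Z‖ ≤ R → ∀ r, ‖D.gam r Z‖ ≤ B * ρ ^ r := by
  rcases lt_or_ge R 0 with hR | hR
  · exact ⟨0, le_rfl, fun Z hZ => absurd (hZ.trans_lt hR) (norm_nonneg Z).not_gt⟩
  have hp0 : 0 < ‖D.p‖ := norm_pos_iff.2 D.p_ne
  obtain ⟨M1, dM1⟩ : ∃ M, M = ∑ j ∈ Finset.range 5, ‖D.polyE1.coeff j‖ := ⟨_, rfl⟩
  obtain ⟨M2, dM2⟩ : ∃ M, M = ∑ j ∈ Finset.range 5, ‖D.polyE2.coeff j‖ := ⟨_, rfl⟩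
  have hM1' : 0 ≤ M1 := dM1 ▸ Finset.sum_nonneg fun _ _ => norm_nonneg _
  have hM2' : 0 ≤ M2 := dM2 ▸ Finset.sum_nonneg fun _ _ => norm_nonneg _
  obtain ⟨k1, dk1⟩ : ∃ k, k = ‖D.t‖ * R * M2 := ⟨_, rfl⟩
  obtain ⟨k2, dk2⟩ : ∃ k, k = ‖D.p‖⁻¹ := ⟨_, rfl⟩
  obtain ⟨k3, dk3⟩ : ∃ k, k = R / ‖D.t‖ * (M1 * (‖D.p‖ ^ 4)⁻¹) := ⟨_, rfl⟩
  obtain ⟨k4, dk4⟩ : ∃ k, k = (1 + ‖D.t‖ * R) * (1 + R / ‖D.t‖) := ⟨_, rfl⟩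
  have hk1 : 0 ≤ k1 := by rw [dk1]; positivity
  have hk2 : 0 ≤ k2 := by rw [dk2]; positivity
  have hk3 : 0 ≤ k3 := by rw [dk3]; positivity
  have hk4 : 0 ≤ k4 := by rw [dk4]; positivity
  obtain ⟨K, dK⟩ : ∃ K, K = 1 + k1 + k2 + k3 + k4 := ⟨_, rfl⟩
  have hK : 1 ≤ K := by linarith
  obtain ⟨N, hN4, η, hη, hmain⟩ := coupled_recursion_bound hp0 D.p_lt hK hρ0 hρ1
  -- A bound for `F` on the disc controls the finitely many initial coefficients uniformly in `Z`;
  -- the coupled recursion propagates it to all indices.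
  let F : ℂ → ℝ := fun Z =>
    ∑ r ∈ Finset.range N, (‖D.gam r Z‖ + η * ‖coeff r (D.chi Z)‖) / ρ ^ r
  have hF : Continuous F := by
    refine continuous_finsetSum _ fun r _ => ?_
    have h1 := (D.differentiable_gam r).continuous
    have h2 := D.continuous_coeff_chi r
    fun_prop
  obtain ⟨B, hB⟩ := (isCompact_closedBall (0 : ℂ) R).exists_bound_of_continuousOn hF.continuousOn
  have hB0 : 0 ≤ B := (norm_nonneg _).trans (hB 0 (by simpa using hR))
  refine ⟨B, hB0, fun Z hZ r => ?_⟩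
  refine (hmain (fun r => ‖D.gam r Z‖) (fun r => ‖coeff r (D.chi Z)‖) (fun _ => norm_nonneg _)
    (fun _ => norm_nonneg _) ?_ ?_ B hB0 ?_ r).1
  -- The coefficients of `f(X/p)` are `p^{-r} f_r`, so solving the first equation for `f_r` gains
  -- `p^r` on all other terms.
  · intro r hr
    have h := congrArg (coeff r) (D.firstEq_psi Z)
    have hU : (D.polyU : ℂ⟦X⟧) = 1 - C D.p⁻¹ * X ^ 2 := by simp [polyU]
    rw [coeff_rescale, map_add, mul_assoc, coeff_C_mul, hU, coeff_one_sub_mul _ _ (by omega)] at h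
    have e : coeff r (D.psi Z) = D.gam r Z := by simp [psi]
    have h2 : D.gam r Z = D.p ^ r * (D.t * Z * coeff r ((D.polyE2 : ℂ⟦X⟧) * D.psi Z) +
        (coeff r (D.chi Z) - D.p⁻¹ * coeff (r - 2) (D.chi Z))) := by
      rw [← h, e, ← mul_assoc, ← mul_pow, mul_inv_cancel₀ D.p_ne, one_pow, one_mul]
    have h3 := norm_coeff_coe_mul_le D.natDegree_polyE2 (D.psi Z) hr
    rw [← dM2] at h3
    simp only [psi, coeff_mk] at h3
    change ‖D.gam r Z‖ ≤ _
    rw [h2, norm_mul, norm_pow]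
    refine mul_le_mul_of_nonneg_left ?_ (by positivity)
    set sx := ∑ j ∈ Finset.range 5, ‖D.gam (r - j) Z‖ with hsx
    have hsx0 : 0 ≤ sx := Finset.sum_nonneg fun _ _ => norm_nonneg _
    have h4 : ‖D.t * Z * coeff r ((D.polyE2 : ℂ⟦X⟧) * D.psi Z)‖ ≤ k1 * sx := by
      rw [norm_mul, norm_mul]
      calc ‖D.t‖ * ‖Z‖ * ‖coeff r ((D.polyE2 : ℂ⟦X⟧) * D.psi Z)‖
          ≤ ‖D.t‖ * R * (M2 * sx) := by gcongr; exact h3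
        _ = k1 * sx := by rw [dk1]; ring
    have h5 : ‖D.p⁻¹ * coeff (r - 2) (D.chi Z)‖ = k2 * ‖coeff (r - 2) (D.chi Z)‖ := by
      rw [norm_mul, norm_inv, dk2]
    have h6 : k1 * sx ≤ K * sx := by gcongr; linarith
    have h7 : k2 * ‖coeff (r - 2) (D.chi Z)‖ ≤
        K * ‖coeff (r - 2) (D.chi Z)‖ := by gcongr; linarith
    have h8 := norm_add_le (D.t * Z * coeff r ((D.polyE2 : ℂ⟦X⟧) * D.psi Z))
      (coeff r (D.chi Z) - D.p⁻¹ * coeff (r - 2) (D.chi Z))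
    have h9 := norm_sub_le (coeff r (D.chi Z)) (D.p⁻¹ * coeff (r - 2) (D.chi Z))
    linarith
  -- Here the gain comes from `g(pX)`, up to the loss `‖p‖ ^ (-4)` from the degree of `E1`; the
  -- terms with `f` have no gain.
  · intro r hr
    have h := congrArg (coeff r) (D.secondEq_psi Z)
    have hW : (polyW : ℂ⟦X⟧) = 1 - C 1 * X ^ 2 := by simp [polyW]
    rw [map_add, mul_assoc, coeff_C_mul, mul_assoc, coeff_C_mul, hW,
      coeff_one_sub_mul _ _ (by omega), one_mul] at h
    have h3 := norm_coeff_coe_mul_le D.natDegree_polyE1 (rescale D.p (D.chi Z)) hr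
    rw [← dM1] at h3
    set sy := ∑ j ∈ Finset.range 5, ‖coeff (r - j) (D.chi Z)‖ with hsy
    have hsy0 : 0 ≤ sy := Finset.sum_nonneg fun _ _ => norm_nonneg _
    have h3' : ∑ j ∈ Finset.range 5, ‖coeff (r - j) (rescale D.p (D.chi Z))‖ ≤
        ‖D.p‖ ^ r * ((‖D.p‖ ^ 4)⁻¹ * sy) := by
      rw [hsy, Finset.mul_sum, Finset.mul_sum]
      refine Finset.sum_le_sum fun j hj => ?_
      rw [coeff_rescale, norm_mul, norm_pow, ← mul_assoc]
      refine mul_le_mul_of_nonneg_right ?_ (norm_nonneg _)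
      rw [← div_eq_mul_inv, le_div_iff₀ (by positivity), ← pow_add]
      refine pow_le_pow_of_le_one hp0.le D.p_lt.le ?_
      have := Finset.mem_range.1 hj
      omega
    have hkap : ‖D.kap Z‖ ≤ k4 := by
      rw [kap, norm_mul, dk4]
      have h1 : ‖1 - D.t * Z‖ ≤ 1 + ‖D.t‖ * R := by
        refine (norm_sub_le _ _).trans ?_
        rw [norm_one, norm_mul]; gcongr
      have h2 : ‖1 - Z / D.t‖ ≤ 1 + R / ‖D.t‖ := by
        refine (norm_sub_le _ _).trans ?_
        rw [norm_one, norm_div]; gcongr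
      exact mul_le_mul h1 h2 (norm_nonneg _) (by positivity)
    change ‖coeff r (D.chi Z)‖ ≤ _
    simp only [psi, coeff_mk] at h
    rw [h]
    have h4 : ‖Z / D.t * coeff r ((D.polyE1 : ℂ⟦X⟧) * rescale D.p (D.chi Z))‖ ≤
        ‖D.p‖ ^ r * (k3 * sy) := by
      rw [norm_mul, norm_div]
      calc ‖Z‖ / ‖D.t‖ * ‖coeff r ((D.polyE1 : ℂ⟦X⟧) * rescale D.p (D.chi Z))‖
          ≤ R / ‖D.t‖ * (M1 * (‖D.p‖ ^ r * ((‖D.p‖ ^ 4)⁻¹ * sy))) := by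
            gcongr
            exact h3.trans (mul_le_mul_of_nonneg_left h3' hM1')
        _ = ‖D.p‖ ^ r * (k3 * sy) := by rw [dk3]; ring
    have h5 : ‖D.kap Z * (D.gam r Z - D.gam (r - 2) Z)‖ ≤
        k4 * (‖D.gam r Z‖ + ‖D.gam (r - 2) Z‖) := by
      rw [norm_mul]
      exact mul_le_mul hkap (norm_sub_le _ _) (norm_nonneg _) hk4
    have h6 : ‖D.p‖ ^ r * (k3 * sy) ≤ ‖D.p‖ ^ r * (K * sy) := by
      gcongr; linarith
    have h7 : k4 * (‖D.gam r Z‖ + ‖D.gam (r - 2) Z‖) ≤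
        K * (‖D.gam r Z‖ + ‖D.gam (r - 2) Z‖) := by
      gcongr; linarith
    exact (norm_add_le _ _).trans (add_le_add (h4.trans h6) (h5.trans h7))
  · intro r hr
    have h1 : F Z ≤ B := (le_abs_self _).trans (hB Z (by simpa using hZ))
    have h2 : (‖D.gam r Z‖ + η * ‖coeff r (D.chi Z)‖) / ρ ^ r ≤ F Z :=
      Finset.single_le_sum (f := fun r => (‖D.gam r Z‖ + η * ‖coeff r (D.chi Z)‖) / ρ ^ r)
        (fun _ _ => by positivity) (Finset.mem_range.2 hr)
    have h3 := (div_le_iff₀ (pow_pos hρ0 r)).1 (h2.trans h1)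
    have h4 : 0 ≤ η * ‖coeff r (D.chi Z)‖ := by positivity
    have h5 := norm_nonneg (D.gam r Z)
    constructor
    · linarith
    · linarith

theorem exists_summable_bound (R S : ℝ) : ∃ u : ℕ → ℝ, Summable u ∧ ∀ Z x : ℂ, ‖Z‖ ≤ R → ‖x‖ ≤ S →
    ∀ r, ‖D.gam r Z * x ^ r‖ ≤ u r := by
  -- This rate beats `‖x‖ ^ r` and leaves the ratio `1/2`.
  set ρ : ℝ := 1 / (2 * (|S| + 1)) with hρ
  have hS : 0 ≤ |S| := abs_nonneg S
  obtain ⟨B, hB0, hB⟩ := D.exists_norm_gam_le R (ρ := ρ) (by positivity) (by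
    rw [hρ, div_le_one (by positivity)]; linarith)
  refine ⟨fun r => B * (1 / 2) ^ r, summable_geometric_two.mul_left B, fun Z x hZ hx r => ?_⟩
  have hx' : ‖x‖ ≤ |S| + 1 := (hx.trans (le_abs_self S)).trans (by linarith)
  rw [norm_mul, norm_pow]
  calc ‖D.gam r Z‖ * ‖x‖ ^ r ≤ B * ρ ^ r * (|S| + 1) ^ r := by gcongr; exact hB Z hZ r
    _ = B * (1 / 2) ^ r := by
      rw [mul_assoc, ← mul_pow]; congr 2; rw [hρ]; field_simp

theorem isEntire_psi (Z : ℂ) : IsEntire (D.psi Z) := by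
  intro x
  obtain ⟨u, hu, h⟩ := D.exists_summable_bound ‖Z‖ ‖x‖
  refine Summable.of_nonneg_of_le (fun _ => norm_nonneg _) (fun r => ?_) hu
  simpa [psi] using h Z x le_rfl le_rfl r

/-- The asymptotically free solution `Ψ` as a function of `X = q^x` and `Z = q^z`. -/
def Psi (x Z : ℂ) : ℂ := seriesEval (D.psi Z) x

theorem Psi_eq_tsum (x Z : ℂ) : D.Psi x Z = ∑' r, D.gam r Z * x ^ r := by
  simp [Psi, seriesEval, psi]

theorem differentiable_Psi_left (Z : ℂ) : Differentiable ℂ fun x => D.Psi x Z :=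
  (D.isEntire_psi Z).differentiable

theorem differentiable_Psi_right (x : ℂ) : Differentiable ℂ fun Z => D.Psi x Z := by
  intro Z
  simp only [Psi_eq_tsum]
  obtain ⟨u, hu, h⟩ := D.exists_summable_bound (‖Z‖ + 1) ‖x‖
  have hd : DifferentiableOn ℂ (fun Z => ∑' r, D.gam r Z * x ^ r) (Metric.ball 0 (‖Z‖ + 1)) := by
    refine Complex.differentiableOn_tsum_of_summable_norm hu (fun r => ?_) Metric.isOpen_ball
      fun r y hy => ?_
    · exact ((D.differentiable_gam r).mul_const _).differentiableOn
    · exact h y x (by simpa using (mem_ball_zero_iff.1 hy).le) le_rfl r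
  exact hd.differentiableAt (Metric.isOpen_ball.mem_nhds (by simp))

theorem Psi_zero_left (Z : ℂ) : D.Psi 0 Z = qPoch (D.p * Z ^ 2) D.p := by
  rw [Psi, seriesEval_zero, coeff_zero_psi, gam_zero]

/-- The difference of the two sides of `SeriesEq`. -/
def defect (Z : ℂ) (f : ℂ⟦X⟧) : ℂ⟦X⟧ :=
  C (Z ^ 2) * (D.polyL : ℂ⟦X⟧) * rescale D.p f + (D.polyV : ℂ⟦X⟧) * rescale D.p⁻¹ f -
    (C Z * (D.polyR1 : ℂ⟦X⟧) + C (Z ^ 2 + 1) * (D.polyR2 : ℂ⟦X⟧)) * f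

theorem defect_eq_zero_iff {Z : ℂ} {f : ℂ⟦X⟧} : D.defect Z f = 0 ↔ D.SeriesEq Z f := sub_eq_zero

theorem isEntire_defect (Z : ℂ) {f : ℂ⟦X⟧} (hf : IsEntire f) : IsEntire (D.defect Z f) :=
  ((((isEntire_C _).mul (isEntire_coe _)).mul (hf.rescale _)).add
    ((isEntire_coe _).mul (hf.rescale _))).sub
      ((((isEntire_C _).mul (isEntire_coe _)).add ((isEntire_C _).mul (isEntire_coe _))).mul hf)

theorem seriesEval_defect (Z : ℂ) {f : ℂ⟦X⟧} (hf : IsEntire f) (x : ℂ) :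
    seriesEval (D.defect Z f) x =
      Z ^ 2 * (D.E1 x * D.E2 (D.p * x) * (1 - x ^ 2 / D.p)) * seriesEval f (D.p * x) +
        (1 - D.p * x ^ 2) * seriesEval f (x / D.p) -
      (Z / D.t * (1 - x ^ 2 / D.p) * D.E1 x + D.t * Z * (1 - D.p * x ^ 2) * D.E2 x +
        D.kap Z * (1 - x ^ 2) * (1 - D.p * x ^ 2) * (1 - x ^ 2 / D.p)) * seriesEval f x := by
  have e1 := hf.rescale D.p
  have e2 := hf.rescale D.p⁻¹
  have eL := isEntire_coe D.polyL
  have eV := isEntire_coe D.polyV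
  have eR1 := isEntire_coe D.polyR1
  have eR2 := isEntire_coe D.polyR2
  have eR := ((isEntire_C Z).mul eR1).add ((isEntire_C (Z ^ 2 + 1)).mul eR2)
  rw [defect, seriesEval_sub ((((isEntire_C _).mul eL).mul e1).add (eV.mul e2)) (eR.mul hf),
    seriesEval_add (((isEntire_C _).mul eL).mul e1) (eV.mul e2),
    seriesEval_mul ((isEntire_C _).mul eL) e1, seriesEval_mul (isEntire_C _) eL,
    seriesEval_mul eV e2, seriesEval_mul eR hf,
    seriesEval_add ((isEntire_C _).mul eR1) ((isEntire_C _).mul eR2),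
    seriesEval_mul (isEntire_C _) eR1, seriesEval_mul (isEntire_C _) eR2, seriesEval_rescale,
    seriesEval_rescale, seriesEval_C, seriesEval_C, seriesEval_C, seriesEval_coe, seriesEval_coe,
    seriesEval_coe, seriesEval_coe]
  simp only [polyL, polyR1, polyR2, Polynomial.eval_mul, Polynomial.eval_add, Polynomial.eval_sub,
    Polynomial.eval_one, Polynomial.eval_pow, Polynomial.eval_X, Polynomial.eval_C, eval_polyE1,
    eval_polyE2, eval_polyU, eval_polyV, eval_dilate]
  have e3 : D.p⁻¹ * x = x / D.p := by rw [div_eq_mul_inv, mul_comm]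
  have e4 : D.p⁻¹ * x ^ 2 = x ^ 2 / D.p := by rw [div_eq_mul_inv, mul_comm]
  rw [e3, e4]
  have ht := D.t_ne
  have hk : D.kap Z = Z ^ 2 + 1 - Z * (D.t + D.t⁻¹) := by rw [kap]; field_simp; ring
  rw [hk, div_eq_mul_inv Z]
  ring

/-- The gauged eigenvalue equation. -/
theorem Psi_equation (x Z : ℂ) :
    Z ^ 2 * (D.E1 x * D.E2 (D.p * x) * (1 - x ^ 2 / D.p)) * D.Psi (D.p * x) Z +
      (1 - D.p * x ^ 2) * D.Psi (x / D.p) Z =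
    (Z / D.t * (1 - x ^ 2 / D.p) * D.E1 x + D.t * Z * (1 - D.p * x ^ 2) * D.E2 x +
      D.kap Z * (1 - x ^ 2) * (1 - D.p * x ^ 2) * (1 - x ^ 2 / D.p)) * D.Psi x Z := by
  have h := D.seriesEval_defect Z (D.isEntire_psi Z) x
  rw [D.defect_eq_zero_iff.2 (D.seriesEq_psi Z), ← map_zero C, seriesEval_C] at h
  simp only [Psi]
  linear_combination -h

theorem dense_generic : Dense {Z : ℂ | ∀ r : ℕ, r ≠ 0 → (Z / D.p) ^ 2 * D.p ^ r ≠ 1} := by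
  have hp := D.p_ne
  have hc : (⋃ r : ℕ, {Z : ℂ | (Z / D.p) ^ 2 * D.p ^ r = 1}).Countable := by
    refine Set.countable_iUnion fun r => Set.Finite.countable ?_
    obtain ⟨s, hs⟩ := IsAlgClosed.exists_pow_nat_eq (D.p ^ 2 / D.p ^ r) (n := 2) (by norm_num)
    refine (Set.toFinite {s, -s}).subset fun Z hZ => ?_
    have hZ' : Z ^ 2 = s ^ 2 := by
      have hZ : (Z / D.p) ^ 2 * D.p ^ r = 1 := hZ
      rw [hs]; field_simp at hZ ⊢; exact hZ
    simpa using sq_eq_sq_iff_eq_or_eq_neg.1 hZ'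
  refine Dense.mono ?_ (hc.dense_compl ℂ)
  intro Z hZ r _ h
  exact hZ (Set.mem_iUnion.2 ⟨r, h⟩)

/-- The contiguity relation in `Z`. -/
theorem Psi_contiguity (x Z : ℂ) :
    (1 - x ^ 2 / D.p) * D.Psi x (Z / D.p) =
      D.qz Z * D.Psi (x / D.p) Z + D.T x Z * D.Psi x Z := by
  have c1 : ∀ x, Continuous fun Z => D.Psi x Z := fun x => (D.differentiable_Psi_right x).continuous
  have c2 : Continuous fun Z => D.Psi x (Z / D.p) := (c1 x).comp (by fun_prop)
  have c3 := c1 x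
  have c4 := c1 (x / D.p)
  suffices key : (fun Z => (1 - x ^ 2 / D.p) * D.Psi x (Z / D.p)) =
      fun Z => D.qz Z * D.Psi (x / D.p) Z + D.T x Z * D.Psi x Z from congrFun key Z
  -- Comparison of formal solutions requires a nonresonant `Z`; both sides are continuous in `Z`, so
  -- the exceptional values follow.
  refine Continuous.ext_on D.dense_generic (by fun_prop)
    (by unfold T qz; fun_prop) fun Z hZ => ?_
  have hψ := D.isEntire_psi Z
  have h := congrArg (fun f => seriesEval f x) (D.contiguity_series hZ)
  beta_reduce at h
  have e2 := hψ.rescale D.p⁻¹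
  have eT := isEntire_coe (D.polyT Z)
  rw [seriesEval_mul (isEntire_coe _) (D.isEntire_psi _),
    seriesEval_add ((isEntire_C _).mul e2) (eT.mul hψ), seriesEval_mul (isEntire_C _) e2,
    seriesEval_mul eT hψ, seriesEval_rescale, seriesEval_C, seriesEval_coe, seriesEval_coe,
    eval_polyU, eval_polyT] at h
  have e3 : D.p⁻¹ * x = x / D.p := by rw [div_eq_mul_inv, mul_comm]
  have e4 : D.p⁻¹ * x ^ 2 = x ^ 2 / D.p := by rw [div_eq_mul_inv, mul_comm]
  rw [e3, e4] at h
  exact h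

end Series

end

end AWData

end AskeyWilson

/-! ### Dual parameters, the Casoratian and the bilinear forms -/

namespace AskeyWilson

/-- The set of complex numbers with absolute value outside a countable set is dense. -/
theorem dense_norm_notMem {S : Set ℝ} (hS : S.Countable) : Dense {x : ℂ | ‖x‖ ∉ S} := by
  intro x
  obtain ⟨e, he, r, hr⟩ : ∃ e : ℂ, ‖e‖ = 1 ∧ ∃ r : ℝ, x = r * e := by
    rcases eq_or_ne x 0 with rfl | hx
    · exact ⟨1, by simp, 0, by simp⟩
    · refine ⟨x / ‖x‖, by simp [hx], ‖x‖, ?_⟩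
      rw [mul_div_cancel₀]
      simpa using hx
  have hc : (S ∪ (fun s => -s) '' S).Countable := hS.union (hS.image _)
  have hcl := hc.dense_compl ℝ r
  have hcont : Continuous fun r : ℝ => (r : ℂ) * e := by fun_prop
  have := hcont.continuousAt.continuousWithinAt.mem_closure_image hcl
  rw [hr]
  refine closure_mono ?_ this
  rintro _ ⟨r', hr', rfl⟩ hmem
  rw [norm_mul, he, mul_one, Complex.norm_real, Real.norm_eq_abs] at hmem
  rcases abs_choice r' with h | h
  · exact hr' (Or.inl (h ▸ hmem))
  · exact hr' (Or.inr ⟨-r', h ▸ hmem, neg_neg r'⟩)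

theorem eq_of_dense_of_continuousAt {s : Set ℂ} (hs : Dense s) {f g : ℂ → ℂ} {x : ℂ}
    (hf : ContinuousAt f x) (hg : ContinuousAt g x) (h : ∀ y ∈ s, f y = g y) : f x = g x := by
  have hfr : ∃ᶠ y in 𝓝 x, f y = g y := (mem_closure_iff_frequently.1 (hs x)).mono h
  exact tendsto_nhds_unique_of_frequently_eq hf hg hfr

theorem zpow_mul_eq_zero {p : ℂ} (hp0 : p ≠ 0) {F e : ℂ → ℂ} (he : ∀ z ≠ 0, e z ≠ 0)
    (hF : ∀ z ≠ 0, F (p * z) = e z * F z) {y : ℂ} (hy : y ≠ 0) (h : F y = 0) (m : ℤ) :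
    F (p ^ m * y) = 0 := by
  have hne : ∀ m : ℤ, p ^ m * y ≠ 0 := fun m => mul_ne_zero (zpow_ne_zero _ hp0) hy
  induction m using Int.induction_on with
  | zero => simpa using h
  | succ n ih => rw [zpow_add_one₀ hp0, mul_comm (p ^ _), mul_assoc, hF _ (hne _), ih, mul_zero]
  | pred n ih =>
    have h1 := hF _ (hne (-n - 1))
    rw [← mul_assoc, ← zpow_one_add₀ hp0, add_sub_cancel, ih] at h1
    exact (mul_eq_zero.1 h1.symm).resolve_left (he _ (hne _))

namespace AWData

noncomputable section

variable (D : AWData)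

/-- The dual parameters. -/
def dual : AWData where
  p := D.p
  a := D.t
  b := D.a * D.b / D.t
  c := D.a * D.c / D.t
  d := D.a * D.d / D.t
  t := D.a
  p_ne := D.p_ne
  p_lt := D.p_lt
  a_ne := D.t_ne
  b_ne := div_ne_zero (mul_ne_zero D.a_ne D.b_ne) D.t_ne
  c_ne := div_ne_zero (mul_ne_zero D.a_ne D.c_ne) D.t_ne
  d_ne := div_ne_zero (mul_ne_zero D.a_ne D.d_ne) D.t_ne
  t_ne := D.a_ne
  rel := by
    have := D.t_ne
    field_simp
    linear_combination D.a ^ 2 * D.rel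

/-- `(aX, bX, cX, dX, pX/a, pX/b, pX/c, pX/d; p)_∞`. -/
def poch (x : ℂ) : ℂ :=
  qPoch (D.a * x) D.p * qPoch (D.b * x) D.p * qPoch (D.c * x) D.p * qPoch (D.d * x) D.p *
    (qPoch (D.p * x / D.a) D.p * qPoch (D.p * x / D.b) D.p * qPoch (D.p * x / D.c) D.p *
      qPoch (D.p * x / D.d) D.p)

theorem poch_step (x : ℂ) : D.poch x = D.E1 x * D.E2 (D.p * x) * D.poch (D.p * x) := by
  have e : ∀ u, qPoch (u * x) D.p = (1 - u * x) * qPoch (u * (D.p * x)) D.p := fun u => by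
    rw [qPoch_step D.p_lt, mul_left_comm]
  have f : ∀ u, qPoch (D.p * x / u) D.p =
      (1 - D.p * x / u) * qPoch (D.p * (D.p * x) / u) D.p := fun u => by
    rw [qPoch_step D.p_lt, mul_div_assoc D.p (D.p * x)]
  rw [poch, poch, e D.a, e D.b, e D.c, e D.d, f D.a, f D.b, f D.c, f D.d, E1_eq, E2_eq]
  ring

theorem poch_zero : D.poch 0 = 1 := by simp [poch]

theorem continuous_poch : Continuous D.poch := by
  have h := continuous_qPoch D.p_lt
  have e : ∀ u, Continuous fun x => qPoch (u * x) D.p := fun u => h.comp (by fun_prop)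
  have f : ∀ u, Continuous fun x => qPoch (D.p * x / u) D.p := fun u => h.comp (by fun_prop)
  exact ((((e _).mul (e _)).mul (e _)).mul (e _)).mul ((((f _).mul (f _)).mul (f _)).mul (f _))

theorem continuous_Psi_left (Z : ℂ) : Continuous fun x => D.Psi x Z :=
  (D.differentiable_Psi_left Z).continuous

theorem continuous_Psi_right (x : ℂ) : Continuous fun Z => D.Psi x Z :=
  (D.differentiable_Psi_right x).continuous

/-- Points at which the auxiliary denominators do not vanish. -/
structure Generic (x : ℂ) : Prop where
  ne_zero : x ≠ 0
  sq_norm_ne : ∀ k : ℤ, ‖x‖ ^ 2 ≠ ‖D.p‖ ^ k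
  sq_norm_mul_ne : ∀ k : ℤ, ‖D.d / D.t * x‖ ^ 2 ≠ ‖D.p‖ ^ k

theorem Generic.sq_ne {D : AWData} {x : ℂ} (h : D.Generic x) (k : ℤ) : x ^ 2 ≠ D.p ^ k := by
  intro e
  apply h.sq_norm_ne k
  rw [← norm_pow, e, norm_zpow]

theorem Generic.one_sub_ne {D : AWData} {x : ℂ} (h : D.Generic x) : 1 - x ^ 2 / D.p ≠ 0 := by
  intro e
  apply h.sq_ne 1
  have := D.p_ne
  rw [sub_eq_zero, eq_comm, div_eq_one_iff_eq this] at e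
  simpa using e

/-- Genericity is imposed through absolute values because the uniqueness theorem for theta-type
functions needs `‖x²‖` to avoid all powers of `‖p‖`. The condition on `(d/t) x` keeps the zeros of
`θ(Z²)` and `θ(τxZ)` apart. -/
theorem dense_generic_left : Dense {x | D.Generic x} := by
  have ht : ‖D.d / D.t‖ ≠ 0 := norm_ne_zero_iff.2 (div_ne_zero D.d_ne D.t_ne)
  have hc : ({0} ∪ ⋃ k : ℤ, ({√(‖D.p‖ ^ k)} ∪ {√(‖D.p‖ ^ k) / ‖D.d / D.t‖}) : Set ℝ).Countable :=
    (Set.countable_singleton _).union (Set.countable_iUnion fun k =>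
      (Set.countable_singleton _).union (Set.countable_singleton _))
  refine Dense.mono ?_ (dense_norm_notMem hc)
  intro x hx
  simp only [Set.mem_ofPred_eq, Set.mem_union, Set.mem_singleton_iff, Set.mem_iUnion, not_or,
    not_exists, norm_eq_zero] at hx
  refine ⟨hx.1, fun k h => (hx.2 k).1 ?_, fun k h => (hx.2 k).2 ?_⟩
  · rw [← h, Real.sqrt_sq (norm_nonneg _)]
  · rw [← h, Real.sqrt_sq (norm_nonneg _), norm_mul, mul_div_cancel_left₀ _ ht]

/-- The coefficient of the second contiguity relation in `Z`. -/
def T2 (x Z : ℂ) : ℂ :=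
  (1 - x ^ 2 * Z ^ 2) * (D.qz Z * (1 - D.p * x ^ 2) - D.eta * x * Z) +
    D.p * D.nu * x ^ 2 * Z * D.qz Z + D.sig * x * Z ^ 2 * (1 - D.p * x ^ 2)

/-- This is what remains when the difference equation is used to trade `Ψ(x/p, Z)` for `Ψ(px, Z)` in
the first contiguity relation. -/
theorem mul_T2 (x Z : ℂ) : (1 - x ^ 2 / D.p) * D.T2 x Z =
    D.qz Z * (Z / D.t * (1 - x ^ 2 / D.p) * D.E1 x + D.t * Z * (1 - D.p * x ^ 2) * D.E2 x +
      D.kap Z * (1 - x ^ 2) * (1 - D.p * x ^ 2) * (1 - x ^ 2 / D.p)) +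
    (1 - D.p * x ^ 2) * D.T x Z := by
  have hp := D.p_ne
  have ht := D.t_ne
  simp only [T2, T, qz, eta, nu, sig, kap, E1, E2]
  field_simp
  ring

theorem Psi_contiguity_two (x Z : ℂ) :
    (1 - D.p * x ^ 2) * D.Psi x (Z / D.p) =
      -(D.qz Z * Z ^ 2 * (D.E1 x * D.E2 (D.p * x))) * D.Psi (D.p * x) Z +
        D.T2 x Z * D.Psi x Z := by
  have c1 := D.continuous_Psi_left Z
  have c2 := D.continuous_Psi_left (Z / D.p)
  have c3 : Continuous fun x => D.Psi (D.p * x) Z := c1.comp (by fun_prop)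
  refine eq_of_dense_of_continuousAt D.dense_generic_left
    (f := fun x => (1 - D.p * x ^ 2) * D.Psi x (Z / D.p))
    (g := fun x => -(D.qz Z * Z ^ 2 * (D.E1 x * D.E2 (D.p * x))) * D.Psi (D.p * x) Z +
        D.T2 x Z * D.Psi x Z) (x := x) (by fun_prop) (by unfold E1 E2 T2; fun_prop) fun x hx => ?_
  refine mul_left_cancel₀ hx.one_sub_ne ?_
  linear_combination (1 - D.p * x ^ 2) * D.Psi_contiguity x Z + D.qz Z * D.Psi_equation x Z -
    D.Psi x Z * D.mul_T2 x Z

theorem T2_eq {x : ℂ} (hx : x ≠ 0) (Z : ℂ) : D.T2 x Z = -D.p * x ^ 4 * D.T x⁻¹ Z := by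
  have hp := D.p_ne
  simp only [T2, T]
  field_simp
  ring

theorem E1_eq_E2_inv {x : ℂ} (hx : x ≠ 0) : D.E1 x = D.p * D.t ^ 2 * x ^ 4 * D.E2 x⁻¹ := by
  have hp := D.p_ne
  have ht := D.t_ne
  simp only [E1, E2]
  field_simp
  ring

/-- The Casoratian of the solutions with spectral parameters `Z` and `Z⁻¹`. -/
def casoratian (x Z : ℂ) : ℂ :=
  Z * D.Psi x Z * D.Psi (x / D.p) Z⁻¹ - Z⁻¹ * D.Psi (x / D.p) Z * D.Psi x Z⁻¹

/-- After division by the spectral parameter, the coefficient of the middle term is the same for `Z`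
and `Z⁻¹`, since `Z⁻¹ kap Z = Z kap Z⁻¹`. Cross multiplication of the two equations therefore
cancels it. -/
theorem casoratian_step {Z : ℂ} (hZ : Z ≠ 0) (x : ℂ) :
    D.E1 x * D.E2 (D.p * x) * (1 - x ^ 2 / D.p) * D.casoratian (D.p * x) Z =
      (1 - D.p * x ^ 2) * D.casoratian x Z := by
  have h1 := D.Psi_equation x Z
  have h2 := D.Psi_equation x Z⁻¹
  have hp := D.p_ne
  have hk : Z⁻¹ * D.kap Z = Z * D.kap Z⁻¹ := by
    have ht := D.t_ne
    simp only [kap]; field_simp; ring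
  rw [casoratian, casoratian, mul_div_cancel_left₀ x hp]
  have hi : Z * Z⁻¹ = 1 := mul_inv_cancel₀ hZ
  obtain ⟨w, hw⟩ : ∃ w, Z⁻¹ = w := ⟨_, rfl⟩
  rw [hw] at h2 hk hi ⊢
  generalize D.Psi (D.p * x) Z = A1 at *
  generalize D.Psi (x / D.p) Z = A2 at *
  generalize D.Psi x Z = A3 at *
  generalize D.Psi (D.p * x) w = B1 at *
  generalize D.Psi (x / D.p) w = B2 at *
  generalize D.Psi x w = B3 at *
  generalize D.kap Z = k1 at *
  generalize D.kap w = k2 at *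
  generalize D.E1 x = f1 at *
  generalize D.E2 x = f2 at *
  generalize D.E2 (D.p * x) = f3 at *
  have hg : w * Z * w = w := by linear_combination w * hi
  have hZZ : w * Z ^ 2 = Z := by linear_combination Z * hi
  have hZw : Z * w ^ 2 = w := by linear_combination w * hi
  linear_combination (w * B3) * h1 - (Z * A3) * h2 +
    (1 - x ^ 2) * (1 - D.p * x ^ 2) * (1 - x ^ 2 / D.p) * A3 * B3 * hk -
    f1 * f3 * (1 - x ^ 2 / D.p) * A1 * B3 * hZZ + f1 * f3 * (1 - x ^ 2 / D.p) * A3 * B1 * hZw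

/-- Evaluation of the Casoratian. -/
theorem casoratian_eq {Z : ℂ} (hZ : Z ≠ 0) (x : ℂ) : D.casoratian x Z =
    -Z⁻¹ * theta (Z ^ 2) D.p * ((1 - x ^ 2 / D.p) * D.poch x) := by
  have hp := D.p_ne
  have c1 := D.continuous_Psi_left Z
  have c2 := D.continuous_Psi_left Z⁻¹
  have c3 : Continuous fun x => D.Psi (x / D.p) Z := c1.comp (by fun_prop)
  have c4 : Continuous fun x => D.Psi (x / D.p) Z⁻¹ := c2.comp (by fun_prop)
  have c5 := D.continuous_poch
  have cc : Continuous fun x => D.casoratian x Z := by unfold casoratian; fun_prop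
  refine eq_of_dense_of_continuousAt D.dense_generic_left (f := fun x => D.casoratian x Z)
    (g := fun x => -Z⁻¹ * theta (Z ^ 2) D.p * ((1 - x ^ 2 / D.p) * D.poch x)) (x := x)
    cc.continuousAt (by fun_prop) fun x hx => ?_
  have hv : ∀ n : ℕ, 1 - D.p * (D.p ^ n * x) ^ 2 ≠ 0 := by
    intro n h
    apply hx.sq_ne (-(2 * n + 1))
    rw [zpow_neg, eq_comm, inv_eq_iff_eq_inv, ← mul_eq_one_iff_eq_inv₀ (pow_ne_zero 2 hx.ne_zero)]
    have e : D.p ^ (2 * (n : ℤ) + 1) = D.p ^ (2 * n + 1) := by exact_mod_cast rfl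
    rw [e, pow_succ, pow_mul']
    linear_combination -h
  have hs : ∀ n : ℕ, D.p ^ (n + 1) * x = D.p * (D.p ^ n * x) := fun n => by ring
  -- Both sides obey the same recursion in `x`, so they are compared at `x = 0`; there `Ψ` reduces
  -- to Pochhammer symbols in `Z^{±2}`, which combine to `θ(Z²)`.
  have key := mul_eq_mul_of_step D.p_lt (f := fun x => D.casoratian x Z)
    (h := fun x => (1 - x ^ 2 / D.p) * D.poch x) cc.continuousAt (by fun_prop) (X := x)
    (fun n => D.E1 (D.p ^ n * x) * D.E2 (D.p * (D.p ^ n * x)) * (1 - (D.p ^ n * x) ^ 2 / D.p) /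
      (1 - D.p * (D.p ^ n * x) ^ 2)) (fun n => ?_) (fun n => ?_)
  · beta_reduce at key ⊢
    rw [poch_zero] at key
    simp only [casoratian, Psi_zero_left, zero_div] at key ⊢
    rw [theta, qPoch_step D.p_lt (Z ^ 2), ← casoratian]
    rw [← casoratian] at key
    have e : D.p / Z ^ 2 = D.p * Z⁻¹ ^ 2 := by field_simp
    rw [e]
    have hi : Z⁻¹ * Z ^ 2 = Z := by field_simp
    linear_combination key - ((1 - x ^ 2 / D.p) * D.poch x) * qPoch (D.p * Z ^ 2) D.p *
      qPoch (D.p * Z⁻¹ ^ 2) D.p * hi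
  · rw [div_mul_eq_mul_div, eq_div_iff (hv n), hs, D.casoratian_step hZ, mul_comm]
  · rw [div_mul_eq_mul_div, eq_div_iff (hv n), hs, D.poch_step (D.p ^ n * x)]
    have : (D.p * (D.p ^ n * x)) ^ 2 / D.p = D.p * (D.p ^ n * x) ^ 2 := by field_simp
    rw [this]
    ring

/-- The bilinear form with a single spectral parameter. -/
def normForm (x Z : ℂ) : ℂ :=
  (D.t * Z) ^ 2 * (D.E2 x * D.E2 (D.p / x)) * D.Psi x Z * D.Psi (D.p / x) Z -
    D.Psi (x / D.p) Z * D.Psi x⁻¹ Z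

/-- The bilinear form with spectral parameters `Z` and `Z⁻¹`. -/
def mixedForm (x Z : ℂ) : ℂ :=
  D.Psi x⁻¹ Z * D.Psi (x / D.p) Z⁻¹ -
    D.t ^ 2 * (D.E2 x * D.E2 (D.p / x)) * D.Psi (D.p / x) Z * D.Psi x Z⁻¹

/-- The Plücker relation for three vectors in a plane: the terms containing `Ψ(p/x, Z)` cancel. No
difference equation is needed, only the shape of the three forms. -/
theorem pluecker {Z : ℂ} (hZ : Z ≠ 0) (x : ℂ) : D.Psi x⁻¹ Z * D.casoratian x Z =
    Z * D.mixedForm x Z * D.Psi x Z + Z⁻¹ * D.normForm x Z * D.Psi x Z⁻¹ := by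
  simp only [casoratian, mixedForm, normForm]
  field_simp
  ring

theorem div_dual_b (Z : ℂ) : Z / (D.a * D.b / D.t) = D.c * D.d * (Z / (D.p * D.t)) := by
  have hp := D.p_ne
  have ht := D.t_ne
  have ha := D.a_ne
  have h := D.b_ne
  field_simp
  linear_combination -Z * D.rel

theorem div_dual_c (Z : ℂ) : Z / (D.a * D.c / D.t) = D.b * D.d * (Z / (D.p * D.t)) := by
  have hp := D.p_ne
  have ht := D.t_ne
  have ha := D.a_ne
  have h := D.c_ne
  field_simp
  linear_combination -Z * D.rel

theorem div_dual_d (Z : ℂ) : Z / (D.a * D.d / D.t) = D.b * D.c * (Z / (D.p * D.t)) := by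
  have hp := D.p_ne
  have ht := D.t_ne
  have ha := D.a_ne
  have h := D.d_ne
  field_simp
  linear_combination -Z * D.rel

/-- Apart from the factors of `t`, the roots pair up: with `w = Z/(pt)` the remaining factors are `1
- uw` for the six products `u` of two of `a, b, c, d`. Hence the product is symmetric in `a, b, c,
d` and expands in `e1`, `e2`, `e3` and `abcd = pt²`. -/
theorem dual_E1_mul_E2 (Z : ℂ) : D.dual.E1 (Z / D.p) * D.dual.E2 Z =
    (1 - D.t * Z / D.p) * (1 - Z / D.t) *
      (1 - D.e2 * (Z / (D.p * D.t)) + (D.e1 * D.e3 - D.p * D.t ^ 2) * (Z / (D.p * D.t)) ^ 2 -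
        (D.e3 ^ 2 + D.e1 ^ 2 * (D.p * D.t ^ 2) - 2 * D.e2 * (D.p * D.t ^ 2)) *
          (Z / (D.p * D.t)) ^ 3 +
        (D.p * D.t ^ 2) * (D.e1 * D.e3 - D.p * D.t ^ 2) * (Z / (D.p * D.t)) ^ 4 -
        (D.p * D.t ^ 2) ^ 2 * D.e2 * (Z / (D.p * D.t)) ^ 5 +
        (D.p * D.t ^ 2) ^ 3 * (Z / (D.p * D.t)) ^ 6) := by
  have hp := D.p_ne
  have ht := D.t_ne
  rw [E1_eq, E2_eq]
  simp only [dual]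
  have h4 : ∀ u, D.a * u / D.t * (Z / D.p) = D.a * u * (Z / (D.p * D.t)) := fun u => by field_simp
  rw [D.div_dual_b, D.div_dual_c, D.div_dual_d, h4, h4, h4, ← D.rel, e1, e2, e3]
  generalize Z / (D.p * D.t) = w
  ring

/-- Up to normalization, the determinant of the matrix that takes `(Ψ(x,Z), Ψ(x/p,Z))` to its value
at `Z/p`. -/
theorem T_mul_T {x : ℂ} (hx : x ≠ 0) (Z : ℂ) :
    D.T x Z * D.T (D.p / x) Z - (D.t * Z) ^ 2 * D.qz Z ^ 2 * (D.E2 x * D.E2 (D.p / x)) =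
      D.p ^ 2 * (1 - x ^ 2 / D.p) * (1 - D.p / x ^ 2) * (D.dual.E1 (Z / D.p) * D.dual.E2 Z) := by
  have hp := D.p_ne
  have ht := D.t_ne
  rw [dual_E1_mul_E2]
  simp only [T, qz, eta, nu, sig, E2]
  generalize D.e1 = e1
  generalize D.e2 = e2
  generalize D.e3 = e3
  generalize D.p = p at *
  generalize D.t = t at *
  field_simp
  ring

end

end AWData

end AskeyWilson

/-! ### Contiguity of the bilinear forms and evaluation of `normForm` -/

namespace AskeyWilson

theorem theta_nome_div {p : ℂ} (hp0 : p ≠ 0) (u : ℂ) : theta (p / u) p = theta u p := by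
  rcases eq_or_ne u 0 with rfl | hu
  · simp [theta]
  rw [theta, theta, div_div_cancel₀ hp0, mul_comm]

theorem theta_sq_mul_nome {p : ℂ} (hp : ‖p‖ < 1) (hp0 : p ≠ 0) {u : ℂ} (hu : u ≠ 0) :
    theta ((p * u) ^ 2) p = 1 / (p * u ^ 4) * theta (u ^ 2) p := by
  have e : (p * u) ^ 2 = p * (p * u ^ 2) := by ring
  rw [e, theta_mul_nome hp hp0 (mul_ne_zero hp0 (pow_ne_zero 2 hu)),
    theta_mul_nome hp hp0 (pow_ne_zero 2 hu)]
  field_simp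

namespace AWData

noncomputable section

variable (D : AWData)

theorem continuousAt_normForm_left {x : ℂ} (hx : x ≠ 0) (Z : ℂ) :
    ContinuousAt (fun x => D.normForm x Z) x := by
  have c1 := D.continuous_Psi_left Z
  have c2 : Continuous fun x => D.Psi (x / D.p) Z := c1.comp (by fun_prop)
  have h1 : ContinuousAt (fun x : ℂ => D.p / x) x := by fun_prop (disch := exact hx)
  have h2 : ContinuousAt (fun x : ℂ => x⁻¹) x := by fun_prop (disch := exact hx)
  have c3 : ContinuousAt (fun x => D.Psi (D.p / x) Z) x := ContinuousAt.comp c1.continuousAt h1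
  have c4 : ContinuousAt (fun x => D.Psi x⁻¹ Z) x := ContinuousAt.comp c1.continuousAt h2
  have e : Continuous D.E2 := by unfold E2; fun_prop
  have e2 : ContinuousAt (fun x => D.E2 (D.p / x)) x := ContinuousAt.comp e.continuousAt h1
  unfold normForm
  fun_prop

theorem continuous_normForm_right (x : ℂ) : Continuous fun Z => D.normForm x Z := by
  have c := fun x => D.continuous_Psi_right x
  have c1 := c x
  have c2 := c (D.p / x)
  have c3 := c (x / D.p)
  have c4 := c x⁻¹
  unfold normForm
  fun_prop

theorem E1_div_nome {x : ℂ} (hx : x ≠ 0) :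
    D.E1 (x / D.p) = D.p * D.t ^ 2 * (x / D.p) ^ 4 * D.E2 (D.p / x) := by
  rw [E1_eq_E2_inv _ (div_ne_zero hx D.p_ne), inv_div]

theorem one_sub_nome_div {x : ℂ} (hx : x ≠ 0) :
    1 - D.p / x ^ 2 = -(D.p / x ^ 2) * (1 - x ^ 2 / D.p) := by
  have := D.p_ne
  field_simp
  ring

/-- The values of the two contiguity relations at the four points entering the bilinear forms. -/
theorem contiguity_nome_div {x : ℂ} (hx : x ≠ 0) (Z : ℂ) :
    (1 - D.p / x ^ 2) * D.Psi (D.p / x) (Z / D.p) =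
      D.qz Z * D.Psi x⁻¹ Z + D.T (D.p / x) Z * D.Psi (D.p / x) Z := by
  have hp := D.p_ne
  have h := D.Psi_contiguity (D.p / x) Z
  have e1 : (D.p / x) ^ 2 / D.p = D.p / x ^ 2 := by field_simp
  have e2 : D.p / x / D.p = x⁻¹ := by field_simp
  rwa [e1, e2] at h

theorem contiguity_div_nome {x : ℂ} (hx : x ≠ 0) (Z : ℂ) :
    (1 - x ^ 2 / D.p) * D.Psi (x / D.p) (Z / D.p) = -(D.p * (x / D.p) ^ 4) *
      (D.qz Z * (D.t * Z) ^ 2 * (D.E2 x * D.E2 (D.p / x)) * D.Psi x Z +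
        D.T (D.p / x) Z * D.Psi (x / D.p) Z) := by
  have hp := D.p_ne
  have h := D.Psi_contiguity_two (x / D.p) Z
  have e1 : D.p * (x / D.p) ^ 2 = x ^ 2 / D.p := by field_simp
  rw [e1, mul_div_cancel₀ _ hp, D.E1_div_nome hx, D.T2_eq (div_ne_zero hx hp), inv_div] at h
  rw [h]
  ring

theorem contiguity_inv {x : ℂ} (hx : x ≠ 0) (Z : ℂ) :
    (1 - D.p / x ^ 2) * D.Psi x⁻¹ (Z / D.p) = -(D.p * x⁻¹ ^ 4) *
      (D.qz Z * (D.t * Z) ^ 2 * (D.E2 x * D.E2 (D.p / x)) * D.Psi (D.p / x) Z +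
        D.T x Z * D.Psi x⁻¹ Z) := by
  have hp := D.p_ne
  have h := D.Psi_contiguity_two x⁻¹ Z
  have e1 : D.p * x⁻¹ ^ 2 = D.p / x ^ 2 := by field_simp
  have e2 : D.p * x⁻¹ = D.p / x := by field_simp
  rw [e1, e2, D.E1_eq_E2_inv (inv_ne_zero hx), D.T2_eq (inv_ne_zero hx), inv_inv] at h
  rw [h]
  ring

/-- The pairs attached to `x` and to `p/x` are moved from `Z` to `Z/p` by companion matrices for
which the mixed products cancel; the form is multiplied by their determinant, which `T_mul_T`
factors into dual parameters. -/
theorem normForm_contiguity {x : ℂ} (hx : x ≠ 0) (Z : ℂ) :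
    D.normForm x (Z / D.p) = D.dual.E1 (Z / D.p) * D.dual.E2 Z * D.normForm x Z := by
  refine eq_of_dense_of_continuousAt D.dense_generic_left
    (f := fun x => D.normForm x (Z / D.p))
    (g := fun x => D.dual.E1 (Z / D.p) * D.dual.E2 Z * D.normForm x Z) (x := x)
    (D.continuousAt_normForm_left hx _)
    (continuousAt_const.mul (D.continuousAt_normForm_left hx _)) fun x hx => ?_
  have hx0 := hx.ne_zero
  have hp := D.p_ne
  have hu := hx.one_sub_ne
  have hu' : 1 - D.p / x ^ 2 ≠ 0 := by
    rw [D.one_sub_nome_div hx0]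
    exact mul_ne_zero (neg_ne_zero.2 (div_ne_zero hp (pow_ne_zero 2 hx0))) hu
  refine mul_left_cancel₀ (mul_ne_zero hu hu') ?_
  have h1 := D.Psi_contiguity x Z
  have h2 := D.contiguity_nome_div hx0 Z
  have h3 := D.contiguity_div_nome hx0 Z
  have h4 := D.contiguity_inv hx0 Z
  have h5 := D.T_mul_T hx0 Z
  have key : (1 - x ^ 2 / D.p) * (1 - D.p / x ^ 2) * D.normForm x (Z / D.p) =
      (D.t * Z / D.p) ^ 2 * (D.E2 x * D.E2 (D.p / x)) *
        ((1 - x ^ 2 / D.p) * D.Psi x (Z / D.p)) * ((1 - D.p / x ^ 2) * D.Psi (D.p / x) (Z / D.p)) -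
      ((1 - x ^ 2 / D.p) * D.Psi (x / D.p) (Z / D.p)) *
        ((1 - D.p / x ^ 2) * D.Psi x⁻¹ (Z / D.p)) := by
    rw [normForm]; ring
  have e : D.p * (x / D.p) ^ 4 * (D.p * x⁻¹ ^ 4) = (D.p⁻¹) ^ 2 := by field_simp
  have e' : D.p⁻¹ ^ 2 * D.p ^ 2 = 1 := by field_simp
  rw [key, h1, h2, h3, h4]
  simp only [normForm]
  rw [div_eq_mul_inv (D.t * Z)]
  generalize D.Psi x⁻¹ Z = A at *
  generalize D.Psi (D.p / x) Z = B at *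
  generalize D.Psi x Z = F at *
  generalize D.Psi (x / D.p) Z = G at *
  generalize D.T x Z = T1 at *
  generalize D.T (D.p / x) Z = T2 at *
  generalize D.E2 x * D.E2 (D.p / x) = E at *
  generalize D.dual.E1 (Z / D.p) * D.dual.E2 Z = Dz at *
  generalize D.qz Z = q at *
  linear_combination ((D.t * Z) ^ 2 * E * F * B - G * A) * (D.p⁻¹ ^ 2 * h5 +
      (1 - x ^ 2 / D.p) * (1 - D.p / x ^ 2) * Dz * e') -
    (q * (D.t * Z) ^ 2 * E * F + T2 * G) * (q * (D.t * Z) ^ 2 * E * B + T1 * A) * e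

/-- At `Z = 0` the term with `Ψ(px, Z)` drops out and `kap 0 = 1`, so the second order equation
collapses to first order. -/
theorem Psi_zero_right_step (x : ℂ) :
    D.Psi (x / D.p) 0 = (1 - x ^ 2) * (1 - x ^ 2 / D.p) * D.Psi x 0 := by
  have key : ∀ x, (1 - D.p * x ^ 2) * D.Psi (x / D.p) 0 =
      (1 - D.p * x ^ 2) * ((1 - x ^ 2) * (1 - x ^ 2 / D.p) * D.Psi x 0) := fun x => by
    have h := D.Psi_equation x 0
    simp only [kap] at h
    linear_combination h
  have c1 := D.continuous_Psi_left 0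
  have c2 : Continuous fun x => D.Psi (x / D.p) 0 := c1.comp (by fun_prop)
  refine eq_of_dense_of_continuousAt D.dense_generic_left (f := fun x => D.Psi (x / D.p) 0)
    (g := fun x => (1 - x ^ 2) * (1 - x ^ 2 / D.p) * D.Psi x 0) (x := x)
    (by fun_prop) (by fun_prop) fun x hx => mul_left_cancel₀ ?_ (key x)
  intro h
  apply hx.sq_ne (-1)
  rw [zpow_neg_one]
  refine eq_inv_of_mul_eq_one_left ?_
  linear_combination -h

theorem Psi_zero_right (x : ℂ) : D.Psi x 0 = qPoch (D.p * x ^ 2) D.p := by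
  have hp := D.p_ne
  have hq := continuous_qPoch D.p_lt
  have key := mul_eq_mul_of_step D.p_lt (f := fun x => D.Psi x 0)
    (h := fun x => qPoch (D.p * x ^ 2) D.p) (D.continuous_Psi_left 0).continuousAt
    (hq.comp (by fun_prop : Continuous fun x : ℂ => D.p * x ^ 2)).continuousAt (X := x)
    (fun n => (1 - (D.p ^ (n + 1) * x) ^ 2) * (1 - (D.p ^ (n + 1) * x) ^ 2 / D.p)) (fun n => ?_)
    (fun n => ?_)
  · simpa [Psi_zero_left] using key
  · have := D.Psi_zero_right_step (D.p ^ (n + 1) * x)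
    rwa [pow_succ', mul_assoc, mul_div_cancel_left₀ _ hp, ← mul_assoc, ← pow_succ'] at this
  · have e : (D.p ^ (n + 1) * x) ^ 2 = D.p * (D.p * (D.p ^ n * x) ^ 2) := by ring
    rw [e, mul_div_cancel_left₀ _ hp, qPoch_step D.p_lt (D.p * (D.p ^ n * x) ^ 2),
      qPoch_step D.p_lt (D.p * (D.p * (D.p ^ n * x) ^ 2))]
    ring

/-- Evaluation of the bilinear form `normForm`. -/
theorem normForm_eq {x : ℂ} (hx : x ≠ 0) (Z : ℂ) :
    D.normForm x Z = -(D.dual.poch Z * ((1 - x ^ 2 / D.p) * theta (x ^ 2) D.p)) := by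
  have hp := D.p_ne
  have hs : ∀ n : ℕ, D.p ^ (n + 1) * Z = D.p * (D.p ^ n * Z) := fun n => by ring
  -- The recursion in `Z` is the one satisfied by the dual Pochhammer product, so the constant is
  -- the value at `Z = 0`, where `Ψ` is explicit and the difference of two products collapses to a
  -- theta function.
  have key := mul_eq_mul_of_step D.p_lt (f := fun Z => D.normForm x Z) (h := D.dual.poch)
    (D.continuous_normForm_right x).continuousAt D.dual.continuous_poch.continuousAt (X := Z)
    (fun n => D.dual.E1 (D.p ^ n * Z) * D.dual.E2 (D.p * (D.p ^ n * Z))) (fun n => ?_)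
    (fun n => ?_)
  · beta_reduce at key
    rw [poch_zero, mul_one] at key
    rw [key]
    simp only [normForm, Psi_zero_right]
    have e1 : D.p * (x / D.p) ^ 2 = x ^ 2 / D.p := by field_simp
    have e2 : D.p * x⁻¹ ^ 2 = D.p / x ^ 2 := by field_simp
    rw [e1, e2, theta, qPoch_step D.p_lt (x ^ 2 / D.p), mul_div_cancel₀ _ hp]
    ring
  · have := D.normForm_contiguity hx (D.p ^ (n + 1) * Z)
    rw [hs] at this ⊢
    rwa [mul_div_cancel_left₀ _ hp] at this
  · rw [hs, poch_step]
    rfl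

theorem T_reflect {x Z : ℂ} (hx : x ≠ 0) (hZ : Z ≠ 0) :
    D.T (D.p / x) Z = -(Z ^ 4 / x ^ 4) * D.T x (D.p / Z) := by
  have hp := D.p_ne
  simp only [T, qz]
  field_simp
  ring

/-- Moving the first factor from `Z` to `Z/p` is matched with moving the second from `p/Z` to `Z⁻¹`.
By `T_reflect` and the analogous rule for `qz`, the two transfer matrices are adjoint for this form
up to monomials, so only a monomial multiplier survives. -/
theorem mixedForm_contiguity {x Z : ℂ} (hx : D.Generic x) (hZ : Z ≠ 0) :
    D.mixedForm x (Z / D.p) = Z ^ 4 / (D.p * x ^ 2) * D.mixedForm x Z := by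
  have hx0 := hx.ne_zero
  have hp := D.p_ne
  have hu := hx.one_sub_ne
  have hZ' : D.p / Z ≠ 0 := div_ne_zero hp hZ
  refine mul_left_cancel₀ (mul_ne_zero (neg_ne_zero.2 (div_ne_zero hp (pow_ne_zero 2 hx0))) hu) ?_
  rw [← D.one_sub_nome_div hx0]
  have h2 := D.contiguity_nome_div hx0 Z
  have h4 := D.contiguity_inv hx0 Z
  have h1 := D.Psi_contiguity x (D.p / Z)
  have h3 := D.contiguity_div_nome hx0 (D.p / Z)
  have e : D.p / Z / D.p = Z⁻¹ := by field_simp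
  rw [e] at h1 h3
  have r1 := D.T_reflect hx0 hZ
  have r2 := D.T_reflect (div_ne_zero hp hx0) hZ
  rw [div_div_cancel₀ hp] at r2
  have hq : D.qz Z = -(Z ^ 2 / D.p) * D.qz (D.p / Z) := by
    simp only [qz]; field_simp; ring
  have key1 : (1 - D.p / x ^ 2) * D.mixedForm x (Z / D.p) =
      ((1 - D.p / x ^ 2) * D.Psi x⁻¹ (Z / D.p)) * D.Psi (x / D.p) (D.p / Z) -
      D.t ^ 2 * (D.E2 x * D.E2 (D.p / x)) *
        ((1 - D.p / x ^ 2) * D.Psi (D.p / x) (Z / D.p)) * D.Psi x (D.p / Z) := by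
    rw [mixedForm, inv_div]; ring
  have key2 : (1 - x ^ 2 / D.p) * D.mixedForm x Z =
      D.Psi x⁻¹ Z * ((1 - x ^ 2 / D.p) * D.Psi (x / D.p) Z⁻¹) -
      D.t ^ 2 * (D.E2 x * D.E2 (D.p / x)) * D.Psi (D.p / x) Z *
        ((1 - x ^ 2 / D.p) * D.Psi x Z⁻¹) := by
    rw [mixedForm]; ring
  have key3 : (1 - D.p / x ^ 2) * (Z ^ 4 / (D.p * x ^ 2) * D.mixedForm x Z) =
      -(D.p / x ^ 2) * (Z ^ 4 / (D.p * x ^ 2)) * ((1 - x ^ 2 / D.p) * D.mixedForm x Z) := by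
    rw [D.one_sub_nome_div hx0]; ring
  rw [key1, key3, key2, h1, h2, h3, h4, r2, r1, hq]
  generalize D.T x (D.p / Z) = T1
  generalize D.T (D.p / x) (D.p / Z) = T2
  generalize D.qz (D.p / Z) = q
  generalize D.E2 x * D.E2 (D.p / x) = E
  generalize D.Psi x⁻¹ Z = A1
  generalize D.Psi (D.p / x) Z = A2
  generalize D.Psi (x / D.p) (D.p / Z) = A3
  generalize D.Psi x (D.p / Z) = A4
  field_simp
  ring

end

end AWData

end AskeyWilson

/-! ### Evaluation of `mixedForm` and the connection formula for `Psi` -/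

namespace AskeyWilson

theorem eq_zpow_mul_of_theta_sq_eq_zero {p u : ℂ} (hp : ‖p‖ < 1) (hp0 : p ≠ 0) (hu : u ≠ 0)
    (h : theta (u ^ 2) p = 0) : ∃ (m : ℤ) (y : ℂ), y ≠ 0 ∧ u = p ^ m * y ∧ (y ^ 2 = 1 ∨ y ^ 2 = p) := by
  obtain ⟨k, hk⟩ := (theta_eq_zero_iff hp hp0 (pow_ne_zero 2 hu)).1 h
  have hm : ∀ m : ℤ, u = p ^ m * (p ^ (-m) * u) := fun m => by
    rw [← mul_assoc, ← zpow_add₀ hp0, add_neg_cancel, zpow_zero, one_mul]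
  have hs : ∀ m : ℤ, (p ^ (-m) * u) ^ 2 = p ^ (k - 2 * m) := fun m => by
    rw [mul_pow, hk, ← zpow_natCast, ← zpow_mul, ← zpow_add₀ hp0]
    congr 1
    push_cast
    ring
  have hne : ∀ m : ℤ, p ^ (-m) * u ≠ 0 := fun m => mul_ne_zero (zpow_ne_zero _ hp0) hu
  obtain ⟨m, rfl | rfl⟩ := k.even_or_odd'
  · exact ⟨m, _, hne m, hm m, Or.inl (by rw [hs]; simp)⟩
  · exact ⟨m, _, hne m, hm m, Or.inr (by rw [hs]; simp)⟩

namespace AWData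

noncomputable section

variable (D : AWData)

theorem mixedForm_of_sq_eq_one {x Z : ℂ} (hZ : Z ^ 2 = 1) :
    D.mixedForm x Z = -D.normForm x Z := by
  have e : Z⁻¹ = Z := inv_eq_of_mul_eq_one_left (by rw [← sq, hZ])
  rw [mixedForm, normForm, e, mul_pow, hZ]
  ring

/-- This factorization supplies the zeroth Pochhammer factors needed to recognize the dual theta
product at `Z² = p`. -/
theorem sig_sub_eta {Z : ℂ} (hZ : Z ^ 2 = D.p) : D.p * D.sig - D.eta * Z =
    D.a * ((1 - Z / D.dual.a) * (1 - Z / D.dual.b) * (1 - Z / D.dual.c) * (1 - Z / D.dual.d)) := by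
  have hp := D.p_ne
  have ht := D.t_ne
  have ha := D.a_ne
  have hb := D.b_ne
  have hc := D.c_ne
  have hd := D.d_ne
  have hrel := D.rel
  simp only [dual]
  rw [D.div_dual_b, D.div_dual_c, D.div_dual_d, sig, eta, e1, e3, ← hZ]
  rw [← hZ] at hrel
  have hZ0 : Z ≠ 0 := by
    rintro rfl
    exact hp (by rw [← hZ]; simp)
  field_simp
  linear_combination ((D.b + D.c + D.d) * (Z ^ 2 * D.t - Z * D.t ^ 2) +
    D.b * D.c * D.d * (D.t - Z)) * hrel

/-- Here `qz Z = 0`, so contiguity degenerates to a proportionality between `Ψ(y, Z/p)` and `Ψ(y,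
Z)`; and `Z⁻¹ = Z/p`. -/
theorem mixedForm_of_sq_eq_nome {x Z : ℂ} (hZ : Z ^ 2 = D.p) :
    D.mixedForm x Z = -(D.p * D.sig - D.eta * Z) * (x / D.p) * D.normForm x Z := by
  have hp := D.p_ne
  have hZ0 : Z ≠ 0 := by
    rintro rfl
    exact hp (by rw [← hZ]; simp)
  have key : ∀ y, D.Psi y (Z / D.p) = (D.p * D.sig - D.eta * Z) * y * D.Psi y Z := by
    intro y
    have c1 := D.continuous_Psi_left Z
    have c2 := D.continuous_Psi_left (Z / D.p)
    refine eq_of_dense_of_continuousAt D.dense_generic_left (f := fun y => D.Psi y (Z / D.p))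
      (g := fun y => (D.p * D.sig - D.eta * Z) * y * D.Psi y Z) (x := y) (by fun_prop)
      (by fun_prop) fun y hy => mul_left_cancel₀ hy.one_sub_ne ?_
    have hq : D.qz Z = 0 := by rw [qz, hZ, div_self hp, sub_self]
    rw [D.Psi_contiguity, hq, T, hq, hZ]
    have : y ^ 2 = D.p * (y ^ 2 / D.p) := by field_simp
    rw [this]
    field_simp
    ring
  have e : Z⁻¹ = Z / D.p := by rw [← hZ]; field_simp
  rw [mixedForm, normForm, e, key, key, mul_pow, hZ]
  field_simp
  ring

/-- `τ = d/t`. -/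
def tau : ℂ := D.d / D.t

theorem tau_ne : D.tau ≠ 0 := div_ne_zero D.d_ne D.t_ne

/-- The difference of the two numerators entering the connection coefficients. -/
def connNum (x Z : ℂ) : ℂ :=
  x ^ 2 * theta (Z ^ 2) D.p * (theta (D.a / x) D.p * theta (D.b / x) D.p * theta (D.c / x) D.p *
      theta (D.d * x) D.p * theta (D.tau * Z / x) D.p) -
    Z ^ 2 * theta (x ^ 2) D.p * (theta (D.dual.a / Z) D.p * theta (D.dual.b / Z) D.p *
      theta (D.dual.c / Z) D.p * theta (D.dual.d * Z) D.p * theta (D.tau * x / Z) D.p)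

/-- The two summands have the same multiplier because the dual parameters satisfy `ã b̃ c̃ τ² = p
d̃`. -/
theorem connNum_step {x Z : ℂ} (hx : x ≠ 0) (hZ : Z ≠ 0) : D.connNum x (D.p * Z) =
    x ^ 2 * (1 / (D.p * Z ^ 4) * (-(D.tau * x * Z)⁻¹)) * D.connNum x Z := by
  have hp := D.p_ne
  have hτ := D.tau_ne
  have hd : D.dual.d ≠ 0 := D.dual.d_ne
  have t1 := theta_mul_nome D.p_lt hp (u := D.tau * Z / x) (by positivity)
  have t2 : ∀ α ≠ 0, theta (α / (D.p * Z)) D.p = -(α / (D.p * Z)) * theta (α / Z) D.p := by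
    intro α hα
    have := theta_div_nome D.p_lt hp (u := α / Z) (div_ne_zero hα hZ)
    rwa [div_div, mul_comm Z] at this
  have t3 := theta_mul_nome D.p_lt hp (u := D.dual.d * Z) (mul_ne_zero hd hZ)
  have e1 : D.tau * (D.p * Z) / x = D.p * (D.tau * Z / x) := by ring
  have e2 : D.dual.d * (D.p * Z) = D.p * (D.dual.d * Z) := by ring
  have hr : D.dual.a * D.dual.b * D.dual.c * D.tau ^ 2 = D.p * D.dual.d := by
    have ht := D.t_ne
    simp only [dual, tau]
    field_simp
    linear_combination D.a * D.d * D.rel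
  rw [connNum, connNum, theta_sq_mul_nome D.p_lt hp hZ, e1, e2, t1, t3, t2 _ D.dual.a_ne,
    t2 _ D.dual.b_ne, t2 _ D.dual.c_ne, t2 _ (mul_ne_zero hτ hx)]
  have ha := D.dual.a_ne
  have hb := D.dual.b_ne
  have hc := D.dual.c_ne
  have hinv : (D.dual.d * Z)⁻¹ = D.p / (D.dual.a * D.dual.b * D.dual.c * D.tau ^ 2 * Z) := by
    rw [hr]
    field_simp
  rw [hinv]
  generalize theta (Z ^ 2) D.p = θ1
  generalize theta (x ^ 2) D.p = θ2
  generalize theta (D.tau * Z / x) D.p = θ3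
  generalize theta (D.tau * x / Z) D.p = θ4
  generalize theta (D.dual.a / Z) D.p = θ5
  generalize theta (D.dual.b / Z) D.p = θ6
  generalize theta (D.dual.c / Z) D.p = θ7
  generalize theta (D.dual.d * Z) D.p = θ8
  generalize theta (D.a / x) D.p * theta (D.b / x) D.p * theta (D.c / x) D.p *
    theta (D.d * x) D.p = θ9
  generalize D.dual.a = a' at *
  generalize D.dual.b = b' at *
  generalize D.dual.c = c' at *
  field_simp
  ring

theorem differentiableAt_mixedForm (x : ℂ) {Z : ℂ} (hZ : Z ≠ 0) :
    DifferentiableAt ℂ (fun Z => D.mixedForm x Z) Z := by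
  have c := fun x => D.differentiable_Psi_right x
  have h : DifferentiableAt ℂ (fun Z : ℂ => Z⁻¹) Z := differentiableAt_inv hZ
  have ci : ∀ x, DifferentiableAt ℂ (fun Z => D.Psi x Z⁻¹) Z := fun x =>
    DifferentiableAt.comp Z (c x Z⁻¹) h
  have c1 := c x⁻¹ Z
  have c2 := ci (x / D.p)
  have c3 := c (D.p / x) Z
  have c4 := ci x
  unfold mixedForm
  fun_prop

theorem differentiableAt_connNum {x Z : ℂ} (hx : x ≠ 0) (hZ : Z ≠ 0) :
    DifferentiableAt ℂ (fun Z => D.connNum x Z) Z := by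
  have hτ := D.tau_ne
  have h : ∀ {f : ℂ → ℂ}, DifferentiableAt ℂ f Z → f Z ≠ 0 →
      DifferentiableAt ℂ (fun Z => theta (f Z) D.p) Z := fun {f} hf h0 =>
    DifferentiableAt.comp (g := fun u => theta u D.p) Z (differentiableAt_theta D.p_lt h0) hf
  have hd : ∀ α : ℂ, DifferentiableAt ℂ (fun Z : ℂ => α / Z) Z := fun α => by
    fun_prop (disch := exact hZ)
  have c1 := h (f := fun Z => Z ^ 2) (by fun_prop) (pow_ne_zero 2 hZ)
  have c2 := h (f := fun Z => D.tau * Z / x) (by fun_prop) (by positivity)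
  have c3 := h (hd D.dual.a) (div_ne_zero D.dual.a_ne hZ)
  have c4 := h (hd D.dual.b) (div_ne_zero D.dual.b_ne hZ)
  have c5 := h (hd D.dual.c) (div_ne_zero D.dual.c_ne hZ)
  have c6 := h (f := fun Z => D.dual.d * Z) (by fun_prop) (mul_ne_zero D.dual.d_ne hZ)
  have c7 := h (hd (D.tau * x)) (by positivity)
  unfold connNum
  fun_prop

theorem theta_dual_prod_of_sq_eq_one {x Z : ℂ} (hZ : Z ^ 2 = 1) :
    theta (D.dual.a / Z) D.p * theta (D.dual.b / Z) D.p * theta (D.dual.c / Z) D.p *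
      theta (D.dual.d * Z) D.p * theta (D.tau * x / Z) D.p =
    D.dual.poch Z * theta (D.tau * x * Z) D.p := by
  have hZ0 : Z ≠ 0 := by rintro rfl; simp at hZ
  have e : ∀ u, u / Z = u * Z := fun u => by
    rw [div_eq_iff hZ0, mul_assoc, ← sq, hZ, mul_one]
  have e2 : ∀ u, D.p / (u * Z) = D.p * Z / u := fun u => by
    rw [← div_div, e, div_mul_eq_mul_div]
  rw [e, e, e, e, poch]
  simp only [theta, e2, show D.dual.p = D.p from rfl]
  ring

/-- Shifting each argument `u/Z = uZ/p` by `p` produces monomials with product `a x`; the factors `1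
- Z/u` left over combine with `a` to `pσ - ηZ`. -/
theorem theta_dual_prod_of_sq_eq_nome {x Z : ℂ} (hx : x ≠ 0) (hZ : Z ^ 2 = D.p) :
    Z ^ 2 * (theta (D.dual.a / Z) D.p * theta (D.dual.b / Z) D.p * theta (D.dual.c / Z) D.p *
      theta (D.dual.d * Z) D.p * theta (D.tau * x / Z) D.p) =
    (D.p * D.sig - D.eta * Z) * x * (D.dual.poch Z * theta (D.tau * x * Z) D.p) := by
  have hp := D.p_ne
  have hZ0 : Z ≠ 0 := by
    rintro rfl
    exact hp (by rw [← hZ]; simp)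
  have hτ := D.tau_ne
  have e0 : ∀ u, u / Z = u * Z / D.p := fun u => by rw [← hZ]; field_simp
  have e1 : ∀ u ≠ 0, theta (u * Z) D.p =
      qPoch (u * Z) D.p * ((1 - Z / u) * qPoch (D.p * Z / u) D.p) := by
    intro u hu
    have e : D.p / (u * Z) = Z / u := by rw [← hZ]; field_simp
    rw [theta, e, qPoch_step D.p_lt (Z / u), mul_div_assoc D.p]
  have e2 : ∀ u ≠ 0, theta (u / Z) D.p = -(u * Z / D.p) * theta (u * Z) D.p := fun u hu => by
    rw [e0, theta_div_nome D.p_lt hp (mul_ne_zero hu hZ0)]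
  have hr : D.dual.a * D.dual.b * D.dual.c * D.tau = D.p * D.a := by
    have ht := D.t_ne
    simp only [dual, tau]
    field_simp
    linear_combination D.a * D.rel
  have h3 : Z ^ 2 * ((D.dual.a * Z / D.p) * (D.dual.b * Z / D.p) * (D.dual.c * Z / D.p) *
      (D.tau * x * Z / D.p)) = D.a * x := by
    have : Z ^ 6 = D.p ^ 3 := by rw [← hZ]; ring
    field_simp
    linear_combination Z ^ 6 * hr + D.p * D.a * this
  rw [e2 _ D.dual.a_ne, e2 _ D.dual.b_ne, e2 _ D.dual.c_ne, e2 (D.tau * x) (mul_ne_zero hτ hx),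
    e1 _ D.dual.a_ne, e1 _ D.dual.b_ne, e1 _ D.dual.c_ne, e1 _ D.dual.d_ne, D.sig_sub_eta hZ, poch]
  simp only [show D.dual.p = D.p from rfl]
  generalize (1 - Z / D.dual.a) = u1
  generalize (1 - Z / D.dual.b) = u2
  generalize (1 - Z / D.dual.c) = u3
  generalize (1 - Z / D.dual.d) = u4
  generalize qPoch (D.dual.a * Z) D.p = v1
  generalize qPoch (D.dual.b * Z) D.p = v2
  generalize qPoch (D.dual.c * Z) D.p = v3
  generalize qPoch (D.dual.d * Z) D.p = v4
  generalize qPoch (D.p * Z / D.dual.a) D.p = w1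
  generalize qPoch (D.p * Z / D.dual.b) D.p = w2
  generalize qPoch (D.p * Z / D.dual.c) D.p = w3
  generalize qPoch (D.p * Z / D.dual.d) D.p = w4
  generalize theta (D.tau * x * Z) D.p = θ
  linear_combination u1 * u2 * u3 * u4 * v1 * v2 * v3 * v4 * w1 * w2 * w3 * w4 * θ * h3

/-- On `τxZ = 1` the dual theta arguments become the original ones up to the symmetry `u ↦ p/u`, and
the two summands cancel. -/
theorem connNum_of_mul_eq_one {x Z : ℂ} (hx : x ≠ 0) (h : D.tau * x * Z = 1) :
    D.connNum x Z = 0 := by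
  have hp := D.p_ne
  have hτ := D.tau_ne
  have ht := D.t_ne
  have ha := D.a_ne
  have hb := D.b_ne
  have hc := D.c_ne
  have hd := D.d_ne
  have hZ : Z = (D.tau * x)⁻¹ := (inv_eq_of_mul_eq_one_right h).symm
  have hy : D.tau * x ≠ 0 := mul_ne_zero hτ hx
  have e1 : D.dual.a / Z = D.d * x := by rw [hZ]; simp only [dual, tau]; field_simp
  have e2 : D.dual.b / Z = D.p / (D.c / x) := by
    rw [hZ]; simp only [dual, tau]; field_simp; linear_combination D.rel
  have e3 : D.dual.c / Z = D.p / (D.b / x) := by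
    rw [hZ]; simp only [dual, tau]; field_simp; linear_combination D.rel
  have e4 : D.dual.d * Z = D.a / x := by rw [hZ]; simp only [dual, tau]; field_simp
  have e5 : D.tau * Z / x = (x ^ 2)⁻¹ := by rw [hZ]; field_simp
  have e6 : D.tau * x / Z = (D.tau * x) ^ 2 := by rw [hZ]; field_simp
  have e7 : Z ^ 2 = ((D.tau * x) ^ 2)⁻¹ := by rw [hZ, inv_pow]
  rw [connNum, e1, e2, e3, e4, e5, e6, e7, theta_nome_div hp, theta_nome_div hp,
    theta_inv D.p_lt (pow_ne_zero 2 hx), theta_inv D.p_lt (pow_ne_zero 2 hy)]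
  field_simp
  ring

/-- Evaluation of the bilinear form `mixedForm`. -/
theorem mixedForm_eq {x Z : ℂ} (hx : D.Generic x) (hZ : Z ≠ 0) :
    Z ^ 2 * D.mixedForm x Z * theta (D.tau * x * Z) D.p =
      -((1 - x ^ 2 / D.p) * D.connNum x Z) := by
  have hp := D.p_ne
  have hτ := D.tau_ne
  have hx0 := hx.ne_zero
  have hy : D.tau * x ≠ 0 := mul_ne_zero hτ hx0
  have dG1 : ∀ Z ≠ 0, HasDerivAt (fun Z => theta (Z ^ 2) D.p)
      (deriv (fun u => theta u D.p) (Z ^ 2) * (2 * Z)) Z := fun Z hZ => by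
    have h := (differentiableAt_theta D.p_lt (pow_ne_zero 2 hZ)).hasDerivAt
    exact h.comp Z (by simpa using hasDerivAt_pow 2 Z)
  have dG2 : ∀ Z ≠ 0, HasDerivAt (fun Z => theta (D.tau * x * Z) D.p)
      (deriv (fun u => theta u D.p) (D.tau * x * Z) * (D.tau * x)) Z := fun Z hZ => by
    have h := (differentiableAt_theta D.p_lt (mul_ne_zero hy hZ)).hasDerivAt
    exact h.comp Z (by simpa using (hasDerivAt_id Z).const_mul (D.tau * x))
  set e : ℂ → ℂ := fun Z => 1 / (D.p * Z ^ 4) * (-(D.tau * x * Z)⁻¹) with he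
  have he0 : ∀ Z ≠ 0, e Z ≠ 0 := fun Z hZ => by
    have := mul_ne_zero hy hZ
    rw [he]
    exact mul_ne_zero (one_div_ne_zero (mul_ne_zero hp (pow_ne_zero 4 hZ))) (neg_ne_zero.2 (inv_ne_zero this))
  have hθ : ∀ Z ≠ 0, theta (D.tau * x * (D.p * Z)) D.p =
      -(D.tau * x * Z)⁻¹ * theta (D.tau * x * Z) D.p := fun Z hZ => by
    rw [mul_left_comm, theta_mul_nome D.p_lt hp (mul_ne_zero hy hZ)]
  have hM : ∀ Z ≠ 0, D.mixedForm x (D.p * Z) = x ^ 2 / (D.p ^ 3 * Z ^ 4) * D.mixedForm x Z := by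
    intro Z hZ
    have h := D.mixedForm_contiguity hx (mul_ne_zero hp hZ)
    rw [mul_div_cancel_left₀ _ hp] at h
    rw [h]
    field_simp
  -- The claim is `F = 0`. Relative to `θ(Z²) θ(τxZ)` the multiplier of `F` has the extra factor
  -- `x²`, whose modulus is not a power of `‖p‖`; so it suffices that `F` vanish at the zeros of
  -- this product.
  set F : ℂ → ℂ := fun Z => Z ^ 2 * D.mixedForm x Z * theta (D.tau * x * Z) D.p +
    (1 - x ^ 2 / D.p) * D.connNum x Z with hF
  have hFs : ∀ Z ≠ 0, F (D.p * Z) = x ^ 2 * e Z * F Z := fun Z hZ => by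
    simp only [hF, he]
    rw [hM Z hZ, hθ Z hZ, D.connNum_step hx0 hZ]
    field_simp
    ring
  suffices F Z = 0 by simp only [hF] at this; linear_combination this
  refine eq_zero_of_multiplier D.p_lt hp (F := F)
    (G := fun Z => theta (Z ^ 2) D.p * theta (D.tau * x * Z) D.p) (e := e) (μ := x ^ 2)
    (fun Z hZ => ?_) (fun Z hZ => ((dG1 Z hZ).mul (dG2 Z hZ)).differentiableAt) he0
    (pow_ne_zero 2 hx0) (fun k => by rw [norm_pow]; exact hx.sq_norm_ne k) hFs (fun Z hZ => ?_)
    (fun Z hZ h0 => ?_) Z hZ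
  · have h1 := D.differentiableAt_mixedForm x hZ
    have h2 := (dG2 Z hZ).differentiableAt
    have h3 := D.differentiableAt_connNum hx0 hZ
    simp only [hF]
    fun_prop
  · simp only [he]
    rw [theta_sq_mul_nome D.p_lt hp hZ, hθ Z hZ]
    ring
  · have hne : ¬ (theta (Z ^ 2) D.p = 0 ∧ theta (D.tau * x * Z) D.p = 0) := by
      rintro ⟨h1, h2⟩
      obtain ⟨k, hk⟩ := (theta_eq_zero_iff D.p_lt hp (pow_ne_zero 2 hZ)).1 h1
      obtain ⟨j, hj⟩ := (theta_eq_zero_iff D.p_lt hp (mul_ne_zero hy hZ)).1 h2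
      apply hx.sq_norm_mul_ne (2 * j - k)
      have hh : (D.tau * x) ^ 2 = D.p ^ (2 * j - k) := by
        rw [zpow_sub₀ hp, ← hk, eq_div_iff (pow_ne_zero 2 hZ), ← mul_pow, hj, ← zpow_natCast,
          ← zpow_mul, mul_comm j]
        rfl
      rw [← norm_pow, ← norm_zpow, ← hh]
      rfl
    -- Quasi-periodicity reduces the vanishing of `F` to the representatives `Z² = 1`, `Z² = p` and
    -- `τxZ = 1`.
    have hstep := fun y hy h m => zpow_mul_eq_zero (F := F) hp (e := fun Z => x ^ 2 * e Z)
      (fun Z hZ => mul_ne_zero (pow_ne_zero 2 hx0) (he0 Z hZ)) hFs (y := y) hy h m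
    have hd := ((dG1 Z hZ).mul (dG2 Z hZ)).deriv
    have hdt : ∀ u ≠ 0, theta u D.p = 0 → deriv (fun u => theta u D.p) u ≠ 0 := fun u hu h =>
      deriv_theta_ne_zero D.p_lt hp hu h
    refine ⟨?_, ?_⟩
    · rcases mul_eq_zero.1 h0 with h1 | h1
      · obtain ⟨m, y, hy0, rfl, hy1⟩ := eq_zpow_mul_of_theta_sq_eq_zero D.p_lt hp hZ h1
        refine hstep y hy0 ?_ m
        simp only [hF]
        rcases hy1 with hy1 | hy1
        · rw [D.mixedForm_of_sq_eq_one hy1, D.normForm_eq hx0, connNum,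
            D.theta_dual_prod_of_sq_eq_one hy1, hy1, theta_one D.p_lt]
          ring
        · have h3 := D.theta_dual_prod_of_sq_eq_nome hx0 hy1
          have h4 : theta D.p D.p = 0 := by simpa using theta_nome_zpow D.p_lt hp 1
          rw [D.mixedForm_of_sq_eq_nome hy1, D.normForm_eq hx0, connNum]
          rw [hy1] at h3 ⊢
          rw [h4]
          have h5 : D.p * (x / D.p) = x := mul_div_cancel₀ _ hp
          linear_combination -(1 - x ^ 2 / D.p) * theta (x ^ 2) D.p * h3 +
            (D.p * D.sig - D.eta * y) * (D.dual.poch y * ((1 - x ^ 2 / D.p) *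
              theta (x ^ 2) D.p)) * theta (D.tau * x * y) D.p * h5
      · obtain ⟨j, hj⟩ := (theta_eq_zero_iff D.p_lt hp (mul_ne_zero hy hZ)).1 h1
        have hZe : Z = D.p ^ j * (D.tau * x)⁻¹ := by rw [← hj]; field_simp
        have h3 : D.tau * x * (D.tau * x)⁻¹ = 1 := mul_inv_cancel₀ hy
        rw [hZe]
        refine hstep _ (inv_ne_zero hy) ?_ j
        simp only [hF]
        rw [h3, D.connNum_of_mul_eq_one hx0 h3, theta_one D.p_lt]
        ring
    · change deriv ((fun Z => theta (Z ^ 2) D.p) * fun Z => theta (D.tau * x * Z) D.p) Z ≠ 0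
      rw [hd]
      rcases mul_eq_zero.1 h0 with h1 | h1
      · have h2 : theta (D.tau * x * Z) D.p ≠ 0 := fun h => hne ⟨h1, h⟩
        rw [h1, zero_mul, add_zero]
        exact mul_ne_zero (mul_ne_zero (hdt _ (pow_ne_zero 2 hZ) h1)
          (mul_ne_zero two_ne_zero hZ)) h2
      · have h2 : theta (Z ^ 2) D.p ≠ 0 := fun h => hne ⟨h, h1⟩
        rw [h1, mul_zero, zero_add]
        exact mul_ne_zero h2 (mul_ne_zero (hdt _ (mul_ne_zero hy hZ) h1) hy)

/-- The connection formula for the functions `Psi`, free of denominators. -/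
theorem Psi_connection {x Z : ℂ} (hx : x ≠ 0) (hZ : Z ≠ 0) :
    theta (D.tau * x * Z) D.p * theta (Z ^ 2) D.p * D.poch x * D.Psi x⁻¹ Z =
      D.connNum x Z * D.Psi x Z +
        theta (D.tau * x * Z) D.p * D.dual.poch Z * theta (x ^ 2) D.p * D.Psi x Z⁻¹ := by
  have hp := D.p_ne
  have hτ := D.tau_ne
  have hθ : ∀ {f : ℂ → ℂ}, ContinuousAt f x → f x ≠ 0 →
      ContinuousAt (fun x => theta (f x) D.p) x := fun {f} hf h0 =>
    ContinuousAt.comp (g := fun u => theta u D.p) (differentiableAt_theta D.p_lt h0).continuousAt hf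
  have hd : ∀ α : ℂ, ContinuousAt (fun x : ℂ => α / x) x := fun α => by
    fun_prop (disch := exact hx)
  have c1 := hθ (f := fun x => x ^ 2) (by fun_prop) (pow_ne_zero 2 hx)
  have c2 := hθ (hd (D.tau * Z)) (by positivity)
  have c3 := hθ (hd D.a) (div_ne_zero D.a_ne hx)
  have c4 := hθ (hd D.b) (div_ne_zero D.b_ne hx)
  have c5 := hθ (hd D.c) (div_ne_zero D.c_ne hx)
  have c6 := hθ (f := fun x => D.d * x) (by fun_prop) (mul_ne_zero D.d_ne hx)
  have c7 := hθ (f := fun x => D.tau * x / Z) (by fun_prop) (by positivity)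
  have c8 := hθ (f := fun x => D.tau * x * Z) (by fun_prop) (by positivity)
  have c9 := D.continuous_poch
  have c10 := D.continuous_Psi_left Z
  have c11 := D.continuous_Psi_left Z⁻¹
  have c12 : ContinuousAt (fun x => D.Psi x⁻¹ Z) x :=
    ContinuousAt.comp c10.continuousAt (by fun_prop (disch := exact hx))
  refine eq_of_dense_of_continuousAt D.dense_generic_left
    (f := fun x => theta (D.tau * x * Z) D.p * theta (Z ^ 2) D.p * D.poch x * D.Psi x⁻¹ Z)
    (g := fun x => D.connNum x Z * D.Psi x Z +
        theta (D.tau * x * Z) D.p * D.dual.poch Z * theta (x ^ 2) D.p * D.Psi x Z⁻¹) (x := x)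
    (by fun_prop) (by unfold connNum; fun_prop) fun x hx => ?_
  -- All three forms carry the factor `1 - x²/p`, which is cancelled at generic `x`; continuity
  -- gives the rest.
  have h1 := D.pluecker hZ x
  rw [D.casoratian_eq hZ, D.normForm_eq hx.ne_zero] at h1
  have h2 := D.mixedForm_eq hx hZ
  have hi : Z * Z⁻¹ = 1 := mul_inv_cancel₀ hZ
  refine mul_left_cancel₀ hx.one_sub_ne ?_
  linear_combination (-Z * theta (D.tau * x * Z) D.p) * h1 - D.Psi x Z * h2 +
    (-theta (D.tau * x * Z) D.p * (1 - x ^ 2 / D.p) * (theta (Z ^ 2) D.p * D.poch x * D.Psi x⁻¹ Z -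
      D.dual.poch Z * theta (x ^ 2) D.p * D.Psi x Z⁻¹)) * hi

end

end AWData

end AskeyWilson

/-! ### The singular term, and translation to the Hecke parameters -/

namespace AskeyWilson

namespace AWData

noncomputable section

variable (D : AWData)

/-- `(pX/a, pX/b, pX/c, pX/d; p)_∞`. -/
def halfPoch (x : ℂ) : ℂ :=
  qPoch (D.p * x / D.a) D.p * qPoch (D.p * x / D.b) D.p * qPoch (D.p * x / D.c) D.p *
    qPoch (D.p * x / D.d) D.p

theorem halfPoch_step (x : ℂ) : D.halfPoch x = D.E2 (D.p * x) * D.halfPoch (D.p * x) := by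
  have f : ∀ u, qPoch (D.p * x / u) D.p =
      (1 - D.p * x / u) * qPoch (D.p * (D.p * x) / u) D.p := fun u => by
    rw [qPoch_step D.p_lt, mul_div_assoc D.p (D.p * x)]
  rw [halfPoch, halfPoch, f D.a, f D.b, f D.c, f D.d, E2_eq]
  ring

theorem halfPoch_zero : D.halfPoch 0 = 1 := by simp [halfPoch]

theorem continuous_halfPoch : Continuous D.halfPoch := by
  have f : ∀ u, Continuous fun x => qPoch (D.p * x / u) D.p := fun u =>
    (continuous_qPoch D.p_lt).comp (by fun_prop)
  exact (((f _).mul (f _)).mul (f _)).mul (f _)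

theorem norm_of_halfPoch_eq_zero {x : ℂ} (h : D.halfPoch x = 0) :
    ∃ u ∈ ({‖D.a‖, ‖D.b‖, ‖D.c‖, ‖D.d‖} : Set ℝ), ∃ i : ℕ, ‖x‖ = u / ‖D.p‖ ^ (i + 1) := by
  have hp := norm_ne_zero_iff.2 D.p_ne
  have key : ∀ u ≠ 0, qPoch (D.p * x / u) D.p = 0 → ∃ i : ℕ, ‖x‖ = ‖u‖ / ‖D.p‖ ^ (i + 1) := by
    intro u hu h
    obtain ⟨i, hi⟩ := (qPoch_eq_zero_iff D.p_lt).1 h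
    refine ⟨i, ?_⟩
    have := congrArg norm hi
    rw [norm_mul, norm_div, norm_mul, norm_pow, norm_one] at this
    have hu' := norm_ne_zero_iff.2 hu
    field_simp at this ⊢
    rw [← this]; ring
  rw [halfPoch, mul_eq_zero, mul_eq_zero, mul_eq_zero] at h
  rcases h with ((h | h) | h) | h
  · exact ⟨‖D.a‖, by simp, key _ D.a_ne h⟩
  · exact ⟨‖D.b‖, by simp, key _ D.b_ne h⟩
  · exact ⟨‖D.c‖, by simp, key _ D.c_ne h⟩
  · exact ⟨‖D.d‖, by simp, key _ D.d_ne h⟩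

theorem dense_halfPoch_ne_zero :
    Dense {Z : ℂ | D.halfPoch Z ≠ 0 ∧ ∀ r : ℕ, r ≠ 0 → Z ^ 2 * D.p ^ r ≠ 1} := by
  have hp := norm_ne_zero_iff.2 D.p_ne
  have hc : ((⋃ u ∈ ({‖D.a‖, ‖D.b‖, ‖D.c‖, ‖D.d‖} : Set ℝ), ⋃ i : ℕ, {u / ‖D.p‖ ^ (i + 1)}) ∪
      ⋃ r : ℕ, {√(‖D.p‖ ^ r)⁻¹} : Set ℝ).Countable := by
    refine Set.Countable.union (Set.Countable.biUnion (Set.toFinite _).countable fun u _ =>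
      Set.countable_iUnion fun i => Set.countable_singleton _)
      (Set.countable_iUnion fun i => Set.countable_singleton _)
  refine Dense.mono ?_ (dense_norm_notMem hc)
  intro Z hZ
  refine ⟨fun h => hZ (Or.inl ?_), fun r _ h => hZ (Or.inr ?_)⟩
  · obtain ⟨u, hu, i, hi⟩ := D.norm_of_halfPoch_eq_zero h
    exact Set.mem_biUnion hu (Set.mem_iUnion.2 ⟨i, hi⟩)
  · refine Set.mem_iUnion.2 ⟨r, ?_⟩
    have := congrArg norm h
    rw [norm_mul, norm_pow, norm_pow, norm_one] at this
    rw [Set.mem_singleton_iff, ← eq_inv_of_mul_eq_one_left this, Real.sqrt_sq (norm_nonneg _)]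

end

end AWData

namespace Params

noncomputable section

variable (P : Params)

/-- The standing assumptions `0 < q < 1` and `0 < s`. -/
structure Admissible : Prop where
  q_pos : 0 < P.q
  q_lt : P.q < 1
  s_pos : 0 < P.s

variable {P : Params}

theorem Admissible.dual (h : P.Admissible) : P.dual.Admissible := ⟨h.q_pos, h.q_lt, h.s_pos⟩

theorem Admissible.q_ne (h : P.Admissible) : (P.q : ℂ) ≠ 0 := by exact_mod_cast h.q_pos.ne'

theorem Admissible.log_neg (h : P.Admissible) : Real.log P.q < 0 := Real.log_neg h.q_pos h.q_lt

theorem Admissible.log_ne (h : P.Admissible) : Complex.log P.q ≠ 0 := by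
  rw [← Complex.ofReal_log h.q_pos.le]
  exact_mod_cast h.log_neg.ne

theorem qpow_add (h : P.Admissible) (x y : ℂ) : P.qpow (x + y) = P.qpow x * P.qpow y :=
  Complex.cpow_add _ _ h.q_ne

theorem qpow_sub (h : P.Admissible) (x y : ℂ) : P.qpow (x - y) = P.qpow x / P.qpow y :=
  Complex.cpow_sub _ _ h.q_ne

theorem qpow_neg (x : ℂ) : P.qpow (-x) = (P.qpow x)⁻¹ := Complex.cpow_neg _ _

theorem qpow_ne (h : P.Admissible) (x : ℂ) : P.qpow x ≠ 0 := by
  rw [qpow, Ne, Complex.cpow_eq_zero_iff]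
  exact fun h0 => h.q_ne h0.1

theorem qpow_nat_mul (n : ℕ) (x : ℂ) : P.qpow (n * x) = P.qpow x ^ n := Complex.cpow_nat_mul _ _ _

theorem qpow_two_mul (x : ℂ) : P.qpow (2 * x) = P.qpow x ^ 2 := by
  exact_mod_cast P.qpow_nat_mul 2 x

theorem qpow_eq_exp (h : P.Admissible) (x : ℂ) :
    P.qpow x = Complex.exp (Complex.log P.q * x) := Complex.cpow_def_of_ne_zero h.q_ne _

theorem differentiable_qpow (h : P.Admissible) : Differentiable ℂ P.qpow := by
  rw [show P.qpow = fun x => Complex.exp (Complex.log P.q * x) from funext (qpow_eq_exp h)]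
  fun_prop

/-- Openness is needed to pull dense sets of `Z` back to dense sets of `z`. -/
theorem isOpenMap_qpow (h : P.Admissible) : IsOpenMap P.qpow := by
  rw [show P.qpow = Complex.exp ∘ fun x => Complex.log P.q * x from funext (qpow_eq_exp h)]
  exact Complex.isOpenMap_exp.comp (Homeomorph.mulLeft₀ _ h.log_ne).isOpenMap

theorem exists_qpow_eq (h : P.Admissible) {X : ℂ} (hX : X ≠ 0) : ∃ x, P.qpow x = X := by
  refine ⟨Complex.log X / Complex.log P.q, ?_⟩
  rw [qpow_eq_exp h, mul_div_cancel₀ _ h.log_ne, Complex.exp_log hX]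

theorem norm_nome_lt (h : P.Admissible) : ‖P.nome‖ < 1 := by
  rw [nome, qpow, Complex.norm_cpow_eq_rpow_re_of_pos h.q_pos, Complex.ofReal_re]
  exact Real.rpow_lt_one h.q_pos.le h.q_lt h.s_pos

/-- The Askey--Wilson parameters attached to the Hecke parameters. -/
def toData (h : P.Admissible) : AWData where
  p := P.nome
  a := P.a
  b := P.b
  c := P.c
  d := P.d
  t := P.dual.a
  p_ne := qpow_ne h _
  p_lt := norm_nome_lt h
  a_ne := qpow_ne h _
  b_ne := neg_ne_zero.2 (qpow_ne h _)
  c_ne := qpow_ne h _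
  d_ne := neg_ne_zero.2 (qpow_ne h _)
  t_ne := qpow_ne h.dual _
  rel := by
    change P.qpow _ * -P.qpow _ * P.qpow _ * -P.qpow _ = P.qpow _ * P.qpow _ ^ 2
    rw [← qpow_two_mul, ← qpow_add h]
    simp only [mul_neg, neg_mul, neg_neg]
    rw [← qpow_add h, ← qpow_add h, ← qpow_add h]
    congr 1
    simp only [Params.dual]
    ring

theorem toData_dual (h : P.Admissible) : (toData h).dual = toData h.dual := by
  have key : ∀ x y z w : ℂ, x + y - z = w → P.qpow x * P.qpow y / P.qpow z = P.qpow w := by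
    rintro x y z w rfl
    rw [qpow_sub h, qpow_add h]
  refine AWData.ext rfl rfl ?_ ?_ ?_ rfl
  · change P.qpow _ * -P.qpow _ / P.qpow _ = -P.qpow _
    rw [mul_neg, neg_div, key]
    simp only [Params.dual]; ring
  · change P.qpow _ * P.qpow _ / P.qpow _ = P.qpow _
    rw [key]
    simp only [Params.dual]; ring
  · change P.qpow _ * -P.qpow _ / P.qpow _ = -P.qpow _
    rw [mul_neg, neg_div, key]
    simp only [Params.dual]; ring

theorem St_eq (h : P.Admissible) (x : ℂ) : P.St x = (toData h).halfPoch (P.qpow x) := by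
  rw [St, qpow_add h]
  rfl

theorem dual_St_eq (h : P.Admissible) (z : ℂ) :
    P.dual.St z = (toData h).dual.halfPoch (P.qpow z) := by
  rw [St_eq h.dual, toData_dual]
  rfl

theorem W_ne (h : P.Admissible) (x z : ℂ) : P.W x z ≠ 0 := qpow_ne h _

theorem W_add (h : P.Admissible) (x z : ℂ) :
    P.W (x + P.s) z = P.W x z * (P.dual.a * P.qpow z) := by
  have hs : (P.s : ℂ) ≠ 0 := by exact_mod_cast h.s_pos.ne'
  change P.qpow _ = P.qpow _ * (P.qpow _ * _)
  rw [← qpow_add h, ← qpow_add h]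
  congr 1
  simp only [Params.dual]
  field_simp
  ring

theorem dual_W (x z : ℂ) : P.dual.W z x = P.W x z := by
  change P.qpow _ = P.qpow _
  congr 1
  simp only [Params.dual]
  ring

end

end Params

end AskeyWilson

/-! ### Gauging the eigenvalue equation -/

namespace AskeyWilson

namespace Params

noncomputable section

variable {P : Params}

/-- Shifting `x` by `s` changes `St` by a factor `E2` and `W` by `tZ`. This cancels part of `A(±x)`
and leaves polynomial coefficients times a nonzero common factor. It holds for arbitrary `Γ`, so it
serves both existence and uniqueness. -/
theorem D_Phi (h : P.Admissible) (Γ : ℕ → ℂ → ℂ) {x z : ℂ} (h1 : P.qpow (2 * x) ≠ 1)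
    (h2 : P.qpow (P.s + 2 * x) ≠ 1) (h3 : P.qpow (P.s - 2 * x) ≠ 1)
    (h4 : P.St (x + P.s) ≠ 0) (h5 : P.St (x - P.s) ≠ 0) (h6 : P.dual.St z ≠ 0) :
    ∃ K ≠ 0, P.D (fun y => P.Phi Γ y z) x +
      (-P.qpow z - P.qpow (-z) + P.dual.a + (P.dual.a)⁻¹) * P.Phi Γ x z =
    K * (P.qpow z ^ 2 * ((toData h).E1 (P.qpow x) * (toData h).E2 (P.nome * P.qpow x) *
          (1 - P.qpow x ^ 2 / P.nome)) * P.Psi Γ (x + P.s) z +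
        (1 - P.nome * P.qpow x ^ 2) * P.Psi Γ (x - P.s) z -
      (P.qpow z / P.dual.a * (1 - P.qpow x ^ 2 / P.nome) * (toData h).E1 (P.qpow x) +
        P.dual.a * P.qpow z * (1 - P.nome * P.qpow x ^ 2) * (toData h).E2 (P.qpow x) +
        (toData h).kap (P.qpow z) * (1 - P.qpow x ^ 2) * (1 - P.nome * P.qpow x ^ 2) *
          (1 - P.qpow x ^ 2 / P.nome)) * P.Psi Γ x z) := by
  set D := toData h with hD
  have hX := qpow_ne h x
  have hZ := qpow_ne h z
  have hp : P.nome ≠ 0 := qpow_ne h _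
  have ht : P.dual.a ≠ 0 := qpow_ne h.dual _
  have hS1 : P.St x = D.E2 (P.nome * P.qpow x) * P.St (x + P.s) := by
    rw [St_eq h, St_eq h, qpow_add h, ← hD, D.halfPoch_step, mul_comm (P.qpow x)]
    rfl
  have hS2 : P.St (x - P.s) = D.E2 (P.qpow x) * P.St x := by
    have e : D.p * (P.qpow x / P.nome) = P.qpow x := mul_div_cancel₀ _ hp
    have e' : P.qpow (x - P.s) = P.qpow x / P.nome := qpow_sub h _ _
    rw [St_eq h, St_eq h, e', ← hD, D.halfPoch_step, e]
  have hW1 := W_add h x z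
  have hW2 : P.W x z = P.W (x - P.s) z * (P.dual.a * P.qpow z) := by
    rw [← W_add h, sub_add_cancel]
  have hW := W_ne h (x - P.s) z
  have hE1 : (1 - P.a * P.qpow x) * (1 - P.b * P.qpow x) * (1 - P.c * P.qpow x) *
      (1 - P.d * P.qpow x) = D.E1 (P.qpow x) := (D.E1_eq _).symm
  have hE2 : (1 - P.a * P.qpow (-x)) * (1 - P.b * P.qpow (-x)) * (1 - P.c * P.qpow (-x)) *
      (1 - P.d * P.qpow (-x)) = P.nome * P.dual.a ^ 2 * (P.qpow x)⁻¹ ^ 4 * D.E2 (P.qpow x) := by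
    refine (D.E1_eq _).symm.trans ?_
    rw [qpow_neg, D.E1_eq_E2_inv (inv_ne_zero hX), inv_inv]
    rfl
  have q1 : P.qpow (2 * x) = P.qpow x ^ 2 := qpow_two_mul x
  have q2 : P.qpow (P.s + 2 * x) = P.nome * P.qpow x ^ 2 := by rw [qpow_add h, q1]; rfl
  have q3 : P.qpow (P.s - 2 * x) = P.nome / P.qpow x ^ 2 := by rw [qpow_sub h, q1]; rfl
  have q4 : P.qpow (2 * -x) = (P.qpow x ^ 2)⁻¹ := by rw [mul_neg, qpow_neg, q1]
  have q5 : P.qpow (P.s + 2 * -x) = P.nome / P.qpow x ^ 2 := by rw [mul_neg, ← sub_eq_add_neg, q3]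
  rw [q1] at h1
  rw [q2] at h2
  rw [q3] at h3
  have u1 : 1 - P.qpow x ^ 2 ≠ 0 := sub_ne_zero.2 h1.symm
  have u2 : 1 - P.nome * P.qpow x ^ 2 ≠ 0 := sub_ne_zero.2 h2.symm
  have u3 : P.nome - P.qpow x ^ 2 ≠ 0 := fun h0 => h3 (by
    rw [sub_eq_zero.1 h0, div_self (pow_ne_zero 2 hX)])
  have u4 : P.qpow x ^ 2 - 1 ≠ 0 := sub_ne_zero.2 h1
  have u5 : P.qpow x ^ 2 - P.nome ≠ 0 := by rw [← neg_sub]; exact neg_ne_zero.2 u3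
  have hkap : D.kap (P.qpow z) = (1 - P.dual.a * P.qpow z) * (1 - P.qpow z / P.dual.a) := rfl
  rw [hS2] at h5
  have v1 : D.E2 (P.qpow x) ≠ 0 := left_ne_zero_of_mul h5
  have v2 := right_ne_zero_of_mul h5
  rw [hS1] at v2
  have v3 : D.E2 (P.nome * P.qpow x) ≠ 0 := left_ne_zero_of_mul v2
  -- The prefactor of `Φ` divided by the cleared denominators; the extra `q^z` comes from
  -- multiplying the eigenvalue `q^z + q^{-z}` by `q^z`.
  refine ⟨P.W x z / (P.St x * P.dual.St z) / (P.qpow z * (1 - P.qpow x ^ 2) *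
    (1 - P.nome * P.qpow x ^ 2) * (1 - P.qpow x ^ 2 / P.nome)), ?_, ?_⟩
  · have u6 : 1 - P.qpow x ^ 2 / P.nome ≠ 0 := by
      rw [one_sub_div hp]; exact div_ne_zero u3 hp
    have := W_ne h x z
    rw [hS1]
    exact div_ne_zero (div_ne_zero this (mul_ne_zero v2 h6))
      (mul_ne_zero (mul_ne_zero (mul_ne_zero hZ u1) u2) u6)
  · simp only [Params.D, A, Phi]
    rw [hE1, hE2, q1, q2, q4, q5, hS2, hS1, hW1, hW2, qpow_neg, hkap]
    generalize D.E1 (P.qpow x) = E at *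
    generalize D.E2 (P.qpow x) = E' at *
    generalize D.E2 (P.nome * P.qpow x) = E'' at *
    generalize P.St (x + P.s) = S at *
    generalize P.dual.St z = S' at *
    generalize P.W (x - P.s) z = w at *
    generalize P.Psi Γ (x + P.s) z = f1 at *
    generalize P.Psi Γ (x - P.s) z = f2 at *
    generalize P.Psi Γ x z = f3 at *
    generalize P.qpow x = X at *
    generalize P.qpow z = Z at *
    generalize P.nome = p at *
    generalize P.dual.a = t at *
    have r1 : 1 - (X ^ 2)⁻¹ = -(1 - X ^ 2) / X ^ 2 := by field_simp; ring
    have r2 : 1 - p / X ^ 2 = -(p - X ^ 2) / X ^ 2 := by field_simp; ring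
    have r3 : 1 - X ^ 2 / p = (p - X ^ 2) / p := by field_simp
    rw [r1, r2, r3]
    clear hS1 hS2 hW1 hW2 hE1 hE2 q1 q2 q3 q4 q5 h1 h2 h3 u4 u5 r1 r2 r3 hkap h5 v2
    generalize hα : 1 - X ^ 2 = α at *
    generalize hβ : 1 - p * X ^ 2 = β at *
    generalize hγ : p - X ^ 2 = γ at *
    field_simp
    ring

end

end Params

end AskeyWilson

/-! ### Existence, uniqueness and the connection formula for `Phi` -/

namespace AskeyWilson

namespace Params

noncomputable section

variable {P : Params}

/-- The coefficients of the asymptotically free eigenfunction. -/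
def gamma (h : P.Admissible) (r : ℕ) (z : ℂ) : ℂ := (toData h).gam r (P.qpow z)

theorem Psi_gamma (h : P.Admissible) (x z : ℂ) :
    P.Psi (gamma h) x z = (toData h).Psi (P.qpow x) (P.qpow z) := by
  rw [AWData.Psi_eq_tsum]
  exact tsum_congr fun r => by rw [qpow_nat_mul]; rfl

theorem isAsymptoticallyFree_gamma (h : P.Admissible) : P.IsAsymptoticallyFree (gamma h) where
  holomorphic r := ((toData h).differentiable_gam r).comp (differentiable_qpow h)
  initial z := by
    rw [gamma, AWData.gam_zero, qpow_add h, qpow_two_mul]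
    rfl
  normal_convergence K hK := by
    have hc := (differentiable_qpow h).continuous
    obtain ⟨R, hR⟩ := hK.exists_bound_of_continuousOn
      (f := fun w : ℂ × ℂ => P.qpow w.2) (hc.comp continuous_snd).continuousOn
    obtain ⟨S, hS⟩ := hK.exists_bound_of_continuousOn
      (f := fun w : ℂ × ℂ => P.qpow w.1) (hc.comp continuous_fst).continuousOn
    obtain ⟨u, hu, hb⟩ := (toData h).exists_summable_bound R S
    refine ⟨u, hu, fun r w hw => ?_⟩
    rw [qpow_nat_mul]
    exact hb _ _ (hR w hw) (hS w hw) r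
  eigenvalue_equation x z h1 h2 h3 h4 h5 h6 h7 := by
    obtain ⟨K, -, hK⟩ := D_Phi h (gamma h) h1 h2 h3 h5 h6 h7
    rw [hK, Psi_gamma, Psi_gamma, Psi_gamma, qpow_add h, qpow_sub h]
    have key := (toData h).Psi_equation (P.qpow x) (P.qpow z)
    have e : P.qpow x * P.qpow P.s = (toData h).p * P.qpow x := mul_comm _ _
    have e' : P.qpow x / P.qpow P.s = P.qpow x / (toData h).p := rfl
    rw [e, e', mul_eq_zero]
    exact Or.inr (sub_eq_zero.2 key)

/-- For fixed `z` the coefficients form an entire power series in `X`. The eigenvalue equation makes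
its defect vanish on a punctured neighbourhood of `0`, hence identically; the formal recursion and
the prescribed constant term then determine every coefficient. -/
theorem IsAsymptoticallyFree.eq_gamma_of_generic (h : P.Admissible) {Γ : ℕ → ℂ → ℂ}
    (hΓ : P.IsAsymptoticallyFree Γ) {z : ℂ} (hS : (toData h).dual.halfPoch (P.qpow z) ≠ 0)
    (hZ : ∀ r : ℕ, r ≠ 0 → P.qpow z ^ 2 * P.nome ^ r ≠ 1) (r : ℕ) : Γ r z = gamma h r z := by
  set D := toData h with hD
  have hp : P.nome ≠ 0 := qpow_ne h _
  set f : PowerSeries ℂ := PowerSeries.mk fun r => Γ r z with hf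
  have hval : ∀ x, P.Psi Γ x z = seriesEval f (P.qpow x) := fun x =>
    tsum_congr fun r => by rw [qpow_nat_mul, hf, PowerSeries.coeff_mk]
  have hent : IsEntire f := by
    intro X
    rcases eq_or_ne X 0 with rfl | hX
    · refine summable_of_ne_finset_zero (s := {0}) fun n hn => ?_
      simp [Finset.mem_singleton.not.1 hn]
    obtain ⟨x, rfl⟩ := exists_qpow_eq h hX
    obtain ⟨u, hu, hb⟩ := hΓ.normal_convergence {(x, z)} isCompact_singleton
    refine Summable.of_nonneg_of_le (fun _ => norm_nonneg _) (fun r => ?_) hu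
    have := hb r (x, z) rfl
    rw [qpow_nat_mul] at this
    rwa [hf, PowerSeries.coeff_mk]
  -- All excluded denominators are nonzero at `X = 0`, hence near it; only `X = 0` itself is not of
  -- the form `q^x`.
  have hev : ∀ᶠ X in 𝓝[≠] (0 : ℂ), seriesEval (D.defect (P.qpow z) f) X = 0 := by
    have c0 := D.continuous_halfPoch
    have c1 : Continuous fun X => D.halfPoch (P.nome * X) := c0.comp (by fun_prop)
    have c2 : Continuous fun X => D.halfPoch (X / P.nome) := c0.comp (by fun_prop)
    have n0 : ∀ᶠ X in 𝓝 (0 : ℂ), D.halfPoch X ≠ 0 :=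
      c0.continuousAt.eventually_ne (by simp [D.halfPoch_zero])
    have n1 : ∀ᶠ X in 𝓝 (0 : ℂ), D.halfPoch (P.nome * X) ≠ 0 :=
      c1.continuousAt.eventually_ne (by simp [D.halfPoch_zero])
    have n2 : ∀ᶠ X in 𝓝 (0 : ℂ), D.halfPoch (X / P.nome) ≠ 0 :=
      c2.continuousAt.eventually_ne (by simp [D.halfPoch_zero])
    have n3 : ∀ᶠ X in 𝓝 (0 : ℂ), X ^ 2 ≠ 1 :=
      (by fun_prop : Continuous fun X : ℂ => X ^ 2).continuousAt.eventually_ne (by simp)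
    have n4 : ∀ᶠ X in 𝓝 (0 : ℂ), P.nome * X ^ 2 ≠ 1 :=
      (by fun_prop : Continuous fun X : ℂ => P.nome * X ^ 2).continuousAt.eventually_ne (by simp)
    have n5 : ∀ᶠ X in 𝓝 (0 : ℂ), X ^ 2 ≠ P.nome :=
      (by fun_prop : Continuous fun X : ℂ => X ^ 2).continuousAt.eventually_ne
        (by simpa using hp.symm)
    filter_upwards [n0.filter_mono nhdsWithin_le_nhds, n1.filter_mono nhdsWithin_le_nhds,
      n2.filter_mono nhdsWithin_le_nhds, n3.filter_mono nhdsWithin_le_nhds,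
      n4.filter_mono nhdsWithin_le_nhds, n5.filter_mono nhdsWithin_le_nhds,
      self_mem_nhdsWithin] with X m0 m1 m2 m3 m4 m5 hX
    obtain ⟨x, rfl⟩ := exists_qpow_eq h (X := X) hX
    have ea : P.qpow (x + P.s) = P.nome * P.qpow x := by rw [qpow_add h, mul_comm]; rfl
    have es : P.qpow (x - P.s) = P.qpow x / P.nome := qpow_sub h _ _
    have h1 : P.qpow (2 * x) ≠ 1 := by rwa [qpow_two_mul]
    have h2 : P.qpow (P.s + 2 * x) ≠ 1 := by rw [qpow_add h, qpow_two_mul]; exact m4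
    have h3 : P.qpow (P.s - 2 * x) ≠ 1 := by
      rw [qpow_sub h, qpow_two_mul, Ne, div_eq_one_iff_eq (pow_ne_zero 2 (qpow_ne h x))]
      exact m5.symm
    have h4 : P.St x ≠ 0 := by rwa [St_eq h]
    have h5 : P.St (x + P.s) ≠ 0 := by rwa [St_eq h, ea]
    have h6 : P.St (x - P.s) ≠ 0 := by rwa [St_eq h, es]
    have h7 : P.dual.St z ≠ 0 := by rwa [dual_St_eq h]
    obtain ⟨K, hK0, hK⟩ := D_Phi h Γ h1 h2 h3 h5 h6 h7
    have := hΓ.eigenvalue_equation x z h1 h2 h3 h4 h5 h6 h7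
    rw [hK, hval, hval, hval, ea, es] at this
    rw [D.seriesEval_defect _ hent]
    exact (mul_eq_zero.1 this).resolve_left hK0
  have hser : D.SeriesEq (P.qpow z) f := D.defect_eq_zero_iff.1
    ((D.isEntire_defect _ hent).eq_zero_of_frequently hev.frequently)
  have h0 : PowerSeries.coeff 0 f = PowerSeries.coeff 0 (D.psi (P.qpow z)) := by
    rw [D.coeff_zero_psi, hf, PowerSeries.coeff_mk, hΓ.initial, D.gam_zero, qpow_add h,
      qpow_two_mul]
    rfl
  have := congrArg (PowerSeries.coeff r)
    (D.eq_of_seriesEq (Z := P.qpow z) hZ hser (D.seriesEq_psi _) h0)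
  rwa [hf, PowerSeries.coeff_mk, AWData.psi, PowerSeries.coeff_mk] at this

theorem IsAsymptoticallyFree.eq_gamma (h : P.Admissible) {Γ : ℕ → ℂ → ℂ}
    (hΓ : P.IsAsymptoticallyFree Γ) : Γ = gamma h := by
  funext r
  have hd := (toData h).dual.dense_halfPoch_ne_zero.preimage (isOpenMap_qpow h)
  refine Continuous.ext_on hd (hΓ.holomorphic r).continuous
    ((isAsymptoticallyFree_gamma h).holomorphic r).continuous fun z hz => ?_
  exact hΓ.eq_gamma_of_generic h hz.1 hz.2 r

theorem cNum_eq (h : P.Admissible) (x z : ℂ) : P.cNum x z =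
    theta ((toData h).dual.a / P.qpow z) P.nome * theta ((toData h).dual.b / P.qpow z) P.nome *
      theta ((toData h).dual.c / P.qpow z) P.nome *
      theta ((toData h).tau * P.qpow x / P.qpow z) P.nome := by
  have e : P.d * P.qpow (x - z) / P.dual.a = (toData h).tau * P.qpow x / P.qpow z := by
    rw [qpow_sub h, AWData.tau, div_mul_eq_mul_div, mul_div_assoc', div_right_comm]
    rfl
  rw [toData_dual, cNum, e, qpow_neg]
  rfl

theorem cDen_eq (x z : ℂ) : P.cDen x z =
    P.W x z * (theta (P.qpow z ^ 2)⁻¹ P.nome * theta (P.d * P.qpow x) P.nome) := by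
  rw [cDen, neg_mul, qpow_neg, qpow_two_mul]

theorem tau_dual (h : P.Admissible) : (toData h.dual).tau = (toData h).tau := by
  have ht := (toData h).t_ne
  have ha := (toData h).a_ne
  have e := toData_dual h
  rw [← e, AWData.tau, AWData.tau, AWData.dual]
  field_simp

theorem dual_cNum_eq (h : P.Admissible) (x z : ℂ) : P.dual.cNum z x =
    theta (P.a / P.qpow x) P.nome * theta (P.b / P.qpow x) P.nome *
      theta (P.c / P.qpow x) P.nome * theta ((toData h).tau * P.qpow z / P.qpow x) P.nome := by
  rw [cNum_eq h.dual, toData_dual h.dual, tau_dual h]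
  rfl

theorem dual_cDen_eq (x z : ℂ) : P.dual.cDen z x =
    P.W x z * (theta (P.qpow x ^ 2)⁻¹ P.nome * theta (P.dual.d * P.qpow z) P.nome) := by
  rw [cDen_eq, dual_W]
  rfl

theorem theta_mul_eq (p u X : ℂ) :
    theta (u * X) p = qPoch (u * X) p * qPoch (p * X⁻¹ / u) p := by
  rw [theta, ← div_eq_mul_inv, div_div, mul_comm X]

/-- The rational identity that turns the connection formula for `Psi` into the one for `Phi`. -/
theorem connection_of_clear_denominators {X Z S R t1 t2 t3 v1 v2 w1 w2 w3 α1 α2 α3 α4 σ1 σ2 σ3 σ4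
    β1 β2 β3 β4 ρ1 ρ2 ρ3 ρ4 ψ ψ' ψm : ℂ} (hS : S ≠ 0) (hR : R ≠ 0)
    (ht1 : t1 ≠ 0) (ht2 : t2 ≠ 0) (hw1 : w1 ≠ 0) (hw2 : w2 ≠ 0) (hw3 : w3 ≠ 0)
    (hσ : σ1 * σ2 * σ3 * σ4 ≠ 0) (hρ : ρ1 * ρ2 * ρ3 * ρ4 ≠ 0) (h4 : α4 * σ4 ≠ 0)
    (h4' : β4 * ρ4 ≠ 0) (h : α1 * σ1 * (α2 * σ2) * (α3 * σ3) * t3 ≠ 0)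
    (key : t3 * t2 * (α1 * α2 * α3 * α4 * S) * ψm =
      (X ^ 2 * t2 * (v1 * (α4 * σ4)) - Z ^ 2 * t1 * (v2 * (β4 * ρ4))) * ψ +
        t3 * (β1 * β2 * β3 * β4 * R) * t1 * ψ') :
    w1 / (σ1 * σ2 * σ3 * σ4 * R) * ψm =
      (v2 / (w2 * (-(Z ^ 2)⁻¹ * t2 * (α4 * σ4))) - v1 / (w2 * (-(X ^ 2)⁻¹ * t1 * (β4 * ρ4)))) /
          (α1 * σ1 * (α2 * σ2) * (α3 * σ3) * t3 / (w1 * (t1 * (β4 * ρ4)))) *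
          (w2 / (S * R) * ψ) +
        β1 * ρ1 * (β2 * ρ2) * (β3 * ρ3) * t3 / (w3 * (t2 * (α4 * σ4))) /
          (α1 * σ1 * (α2 * σ2) * (α3 * σ3) * t3 / (w1 * (t1 * (β4 * ρ4)))) *
          (w3 / (S * (ρ1 * ρ2 * ρ3 * ρ4)) * ψ') := by
  simp only [mul_ne_zero_iff] at hσ hρ h4 h4' h
  obtain ⟨⟨⟨a1, a2⟩, a3⟩, a4⟩ := hσ
  obtain ⟨⟨⟨b1, b2⟩, b3⟩, b4⟩ := hρ
  obtain ⟨c4, -⟩ := h4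
  obtain ⟨d4, -⟩ := h4'
  obtain ⟨⟨⟨⟨c1, -⟩, c2, -⟩, c3, -⟩, ht3⟩ := h
  have e : ψm = ((X ^ 2 * t2 * (v1 * (α4 * σ4)) - Z ^ 2 * t1 * (v2 * (β4 * ρ4))) * ψ +
        t3 * (β1 * β2 * β3 * β4 * R) * t1 * ψ') / (t3 * t2 * (α1 * α2 * α3 * α4 * S)) := by
    rw [eq_div_iff (by simp [*]), ← key]
    ring
  rw [e]
  field_simp
  ring

theorem Phi_connection (h : P.Admissible) {x z : ℂ} (h1 : P.St x ≠ 0) (h2 : P.St (-x) ≠ 0)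
    (h3 : P.dual.St z ≠ 0) (h4 : P.dual.St (-z) ≠ 0) (h6 : P.cDen x (-z) ≠ 0)
    (h8 : P.dual.cDen z (-x) ≠ 0) (h9 : P.dual.cFun z (-x) ≠ 0) :
    P.Phi (gamma h) (-x) z =
      (P.cFun x z - P.dual.cFun z x) / P.dual.cFun z (-x) * P.Phi (gamma h) x z +
        P.cFun x (-z) / P.dual.cFun z (-x) * P.Phi (gamma h) x (-z) := by
  set D := toData h with hD
  have hp : ‖P.nome‖ < 1 := norm_nome_lt h
  have hX := qpow_ne h x
  have hZ := qpow_ne h z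
  have key := D.Psi_connection hX hZ
  have h9 := (div_ne_zero_iff.1 h9).1
  have hSt : ∀ y, P.St y = qPoch (P.nome * P.qpow y / P.a) P.nome *
      qPoch (P.nome * P.qpow y / P.b) P.nome * qPoch (P.nome * P.qpow y / P.c) P.nome *
      qPoch (P.nome * P.qpow y / P.d) P.nome := fun y => St_eq h y
  have hSt' : ∀ y, P.dual.St y = qPoch (P.nome * P.qpow y / P.dual.a) P.nome *
      qPoch (P.nome * P.qpow y / P.dual.b) P.nome * qPoch (P.nome * P.qpow y / P.dual.c) P.nome *
      qPoch (P.nome * P.qpow y / P.dual.d) P.nome := fun y => St_eq h.dual y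
  have hc : ∀ y w, P.cNum y w = theta (P.dual.a / P.qpow w) P.nome *
      theta (P.dual.b / P.qpow w) P.nome * theta (P.dual.c / P.qpow w) P.nome *
      theta (D.tau * P.qpow y / P.qpow w) P.nome := fun y w => by
    rw [cNum_eq h, toData_dual]; rfl
  have hP : D.poch (P.qpow x) = qPoch (P.a * P.qpow x) P.nome * qPoch (P.b * P.qpow x) P.nome *
      qPoch (P.c * P.qpow x) P.nome * qPoch (P.d * P.qpow x) P.nome * P.St x := by
    rw [St_eq h]; rfl
  have hP' : D.dual.poch (P.qpow z) = qPoch (P.dual.a * P.qpow z) P.nome *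
      qPoch (P.dual.b * P.qpow z) P.nome * qPoch (P.dual.c * P.qpow z) P.nome *
      qPoch (P.dual.d * P.qpow z) P.nome * P.dual.St z := by
    rw [St_eq h.dual, hD, toData_dual]; rfl
  have hN : D.connNum (P.qpow x) (P.qpow z) =
      P.qpow x ^ 2 * theta (P.qpow z ^ 2) P.nome *
        (P.dual.cNum z x * theta (P.d * P.qpow x) P.nome) -
      P.qpow z ^ 2 * theta (P.qpow x ^ 2) P.nome *
        (P.cNum x z * theta (P.dual.d * P.qpow z) P.nome) := by
    rw [hc, dual_cNum_eq h, AWData.connNum, hD, toData_dual]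
    change P.qpow x ^ 2 * theta (P.qpow z ^ 2) P.nome * (theta (P.a / P.qpow x) P.nome *
      theta (P.b / P.qpow x) P.nome * theta (P.c / P.qpow x) P.nome *
      theta (P.d * P.qpow x) P.nome * _) - P.qpow z ^ 2 * theta (P.qpow x ^ 2) P.nome *
      (theta (P.dual.a / P.qpow z) P.nome * theta (P.dual.b / P.qpow z) P.nome *
      theta (P.dual.c / P.qpow z) P.nome * theta (P.dual.d * P.qpow z) P.nome * _) = _
    rw [show (toData h).p = P.nome from rfl]
    ring
  have i1 : ((P.qpow x)⁻¹ ^ 2)⁻¹ = P.qpow x ^ 2 := by rw [inv_pow, inv_inv]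
  have i2 : ((P.qpow z)⁻¹ ^ 2)⁻¹ = P.qpow z ^ 2 := by rw [inv_pow, inv_inv]
  have i3 : D.tau * P.qpow z * P.qpow x = D.tau * P.qpow x * P.qpow z := by ring
  have e1 : P.dual.cNum z (-x) = theta (P.a * P.qpow x) P.nome * theta (P.b * P.qpow x) P.nome *
      theta (P.c * P.qpow x) P.nome * theta (D.tau * P.qpow x * P.qpow z) P.nome := by
    rw [dual_cNum_eq h, qpow_neg]
    simp only [div_inv_eq_mul]
    rw [← hD, i3]
  have e2 : P.cNum x (-z) = theta (P.dual.a * P.qpow z) P.nome *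
      theta (P.dual.b * P.qpow z) P.nome * theta (P.dual.c * P.qpow z) P.nome *
      theta (D.tau * P.qpow x * P.qpow z) P.nome := by
    rw [hc, qpow_neg]
    simp only [div_inv_eq_mul]
  have e3 : P.dual.cDen z (-x) = P.W (-x) z * (theta (P.qpow x ^ 2) P.nome *
      theta (P.dual.d * P.qpow z) P.nome) := by
    rw [dual_cDen_eq, qpow_neg, i1]
  have e4 : P.cDen x (-z) = P.W x (-z) * (theta (P.qpow z ^ 2) P.nome *
      theta (P.d * P.qpow x) P.nome) := by
    rw [cDen_eq, qpow_neg, i2]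
  rw [e1] at h9
  rw [e3] at h8
  rw [e4] at h6
  have g1 := left_ne_zero_of_mul (right_ne_zero_of_mul h8)
  have g2 := right_ne_zero_of_mul (right_ne_zero_of_mul h8)
  have g3 := left_ne_zero_of_mul (right_ne_zero_of_mul h6)
  have g4 := right_ne_zero_of_mul (right_ne_zero_of_mul h6)
  have ta := theta_mul_eq P.nome P.a (P.qpow x)
  have tb := theta_mul_eq P.nome P.b (P.qpow x)
  have tc := theta_mul_eq P.nome P.c (P.qpow x)
  have td := theta_mul_eq P.nome P.d (P.qpow x)
  have ta' := theta_mul_eq P.nome P.dual.a (P.qpow z)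
  have tb' := theta_mul_eq P.nome P.dual.b (P.qpow z)
  have tc' := theta_mul_eq P.nome P.dual.c (P.qpow z)
  have td' := theta_mul_eq P.nome P.dual.d (P.qpow z)
  rw [ta, tb, tc] at h9
  rw [td] at g4
  rw [td'] at g2
  rw [hP, hP', hN, td, td'] at key
  rw [hSt, qpow_neg] at h2
  rw [hSt', qpow_neg] at h4
  simp only [Phi, cFun]
  rw [e1, e2, e3, e4, cDen_eq (P := P) x z, dual_cDen_eq, theta_inv hp (pow_ne_zero 2 hX),
    theta_inv hp (pow_ne_zero 2 hZ), Psi_gamma, Psi_gamma, Psi_gamma, hSt (-x), hSt' (-z),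
    qpow_neg, qpow_neg, ta, tb, tc, td, ta', tb', tc', td']
  -- Each theta function has been split into two Pochhammer symbols, one of which belongs to the
  -- singular term: `σ1 σ2 σ3 σ4 = St(-x)` and `ρ1 ρ2 ρ3 ρ4 = St^d(-z)`. The other halves `αi`, `βi`
  -- come from `poch` and its dual; `t1, t2, t3` are `θ(X²)`, `θ(Z²)`, `θ(τXZ)`.
  exact connection_of_clear_denominators h1 h3 g1 g3 (W_ne h _ _) (W_ne h _ _) (W_ne h _ _) h2 h4
    g4 g2 h9 key

end

end Params

end AskeyWilson

theorem mainTheorem3 (q : ℝ) (hq0 : 0 < q) (hq1 : q < 1) (s : ℚ) (hs : 0 < s)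
    (κ lam υ ς : ℝ) (P : AskeyWilson.Params) (hP : P = ⟨q, (s : ℝ), κ, lam, υ, ς⟩) :
    (∃! Γ : ℕ → ℂ → ℂ, P.IsAsymptoticallyFree Γ) ∧
    ∀ Γ : ℕ → ℂ → ℂ, P.IsAsymptoticallyFree Γ →
      ∀ x z : ℂ,
        P.St x ≠ 0 → P.St (-x) ≠ 0 → P.dual.St z ≠ 0 → P.dual.St (-z) ≠ 0 →
        P.cDen x z ≠ 0 → P.cDen x (-z) ≠ 0 →
        P.dual.cDen z x ≠ 0 → P.dual.cDen z (-x) ≠ 0 →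
        P.dual.cFun z (-x) ≠ 0 →
        P.Phi Γ (-x) z =
          (P.cFun x z - P.dual.cFun z x) / P.dual.cFun z (-x) * P.Phi Γ x z +
            P.cFun x (-z) / P.dual.cFun z (-x) * P.Phi Γ x (-z) := by
  have h : P.Admissible := by
    subst hP
    exact ⟨hq0, hq1, Rat.cast_pos.2 hs⟩
  refine ⟨⟨AskeyWilson.Params.gamma h, AskeyWilson.Params.isAsymptoticallyFree_gamma h,
    fun Γ hΓ => hΓ.eq_gamma h⟩, ?_⟩
  intro Γ hΓ x z h1 h2 h3 h4 _ h6 _ h8 h9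
  rw [hΓ.eq_gamma h]
  exact AskeyWilson.Params.Phi_connection h h1 h2 h3 h4 h6 h8 h9
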